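/- Let $G$ be a Lie group, $H\subset G$ a closed subgroup, $G/H$ the smooth coset space with origin $o=eH$, and $\mathfrak g=\mathfrak h+\mathfrak m$ a linear decomposition (a direct sum of vector spaces, not necessarily reductive), where $\mathfrak h=\mathrm{Lie}(H)$; identify $\mathfrak m=T_o(G/H)$ through the differential of $G\to G/H$. Let $\mathbf G$ be a $G$-invariant spray structure on $G/H$, i.e. a $G$-invariant smooth vector field on $T(G/H)\setminus 0$ which in standard local coordinates reads $y^i\partial_{x^i}-2\mathbf G^i(x,y)\partial_{y^i}$ with $\mathbf G^i$ positively $2$-homogeneous in $y$. Let $\eta:\mathfrak m\setminus\{0\}\to\mathfrak m$ be the spray vector field: $\eta(y)=-\frac{d}{dt}\big|_{t=0}(L_{\bar c(t)^{-1}})_*\dot{\bar c}(t)$, where $\bar c$ is the smooth curve in $G$, defined near $t=0$, with $\bar c(0)=e$ and $(L_{\bar c(t)^{-1}})_*\dot{\bar c}(t)\in\mathfrak m\setminus\{0\}$ such that $\bar c(t)\cdot o$ is the geodesic of $\mathbf G$ with initial point $o$ and initial velocity $y$. Let $N(y,u)=\frac12 D\eta(y,u)-\frac12[y,u]_{\mathfrak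 m}$ be the connection operator, where $D\eta(y,u)=\frac{d}{dt}\big|_{t=0}\eta(y+tu)$ and $[\cdot,\cdot]_{\mathfrak m}$ is the $\mathfrak m$-component of the bracket of $\mathfrak g$. Fix $w\in\mathfrak m\setminus\{0\}$ and put $c(t)=\exp(tw)\cdot o$, $t\in\mathbb R$. A smooth nowhere-vanishing vector field $X(t)=X^i(t)\partial_{x^i}$ along $c$ is nonlinearly parallel if $\frac{d}{dt}X^i+\dot c^j\,\frac{\partial\mathbf G^i}{\partial y^j}(c,X)=0$ in standard local coordinates. Then the vector field $-N(\cdot,w)$ on $\mathfrak m\setminus\{0\}$ is smooth and generates a unique one-parameter group $\rho_t$, $t\in\mathbb R$, of diffeomorphisms of $\mathfrak m\setminus\{0\}$; for every $y\in\mathfrak m\setminus\{0\}$ there is exactly one nonlinearly parallel vector field $X$ along $c$ with $X(0)=y$, so that the nonlinearly parallel translation $\mathrm P^{nl}_{c;0,t}:T_o(G/H)\setminus\{0\}\to T_{c(t)}(G/H)\setminus\{0\}$, $y\mapsto X(t)$, is defined for all $t\in\mathbb R$; and $$\rho_t=(\exp(-tw))_*\circ \mathrm P^{nl}_{c;0,t}\qquad\text{for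 all } t\in\mathbb R .$$ -/

import Mathlib

open scoped Manifold ContDiff Topology
open Set

noncomputable section

namespace SprayGeometry

/-! ### Spray structures on a smooth manifold -/

section Spray

variable {E : Type*} [NormedAddCommGroup E] [NormedSpace ℝ E]
  {M : Type*} [TopologicalSpace M] [ChartedSpace E M]
  [IsManifold 𝓘(ℝ, E) ∞ M]

/-- The standard local coordinates `(x, y)` on `TM` induced by the chart of `M` at `x₀`:
`x` is the coordinate of the base point and `y` consists of the components of the tangent vector
with respect to the coordinate frame. -/
def stdCoord (x₀ : M) (p : TangentBundle 𝓘(ℝ, E) M) : E × E :=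
  (extChartAt 𝓘(ℝ, E) x₀ p.1,
    (mfderiv 𝓘(ℝ, E) 𝓘(ℝ, E) (extChartAt 𝓘(ℝ, E) x₀) p.1 p.2 : E))

/-- The tangent vector with given standard local coordinates `(x, y)`,
for `x` in the target of the chart at `x₀`. -/
def stdCoordSymm (x₀ : M) (q : E × E) : TangentBundle 𝓘(ℝ, E) M :=
  ⟨(extChartAt 𝓘(ℝ, E) x₀).symm q.1,
    mfderiv 𝓘(ℝ, E) 𝓘(ℝ, E) (extChartAt 𝓘(ℝ, E) x₀).symm q.1 q.2⟩

/-- The components `(a, b)` of a tangent vector `a ∂_x + b ∂_y` of `TM` at `p`,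
in the standard local coordinates induced by the chart at `x₀`. -/
def fieldCoord (x₀ : M) (p : TangentBundle 𝓘(ℝ, E) M)
    (ξ : TangentSpace 𝓘(ℝ, E).tangent p) : E × E :=
  mfderiv 𝓘(ℝ, E).tangent 𝓘(ℝ, E × E) (stdCoord x₀) p ξ

/-- The functions `𝐆ⁱ(x, y)` of a vector field `V` on `TM ∖ 0`, defined by writing the
`∂_y`-component of `V` in the standard local coordinates as `-2 𝐆`. -/
def sprayCoeff (V : (p : TangentBundle 𝓘(ℝ, E) M) → TangentSpace 𝓘(ℝ, E).tangent p)
    (x₀ : M) (x y : E) : E :=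
  -(1 / 2 : ℝ) • (fieldCoord x₀ (stdCoordSymm x₀ (x, y)) (V (stdCoordSymm x₀ (x, y)))).2

variable (E M) in
/-- A spray structure: a smooth vector field on `TM ∖ 0` which in standard local
coordinates reads `yⁱ ∂_{xⁱ} - 2 𝐆ⁱ(x, y) ∂_{yⁱ}`, with `𝐆ⁱ` positively `2`-homogeneous in `y`.
(Its values on the zero section are junk and are never used. Since the `∂_x`-components are `yⁱ`,
smoothness of the field on `TM ∖ 0` is smoothness of the coefficients `𝐆ⁱ`.) -/
structure Spray where
  /-- the vector field -/
  field : (p : TangentBundle 𝓘(ℝ, E) M) → TangentSpace 𝓘(ℝ, E).tangent p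
  horizontal : ∀ (x₀ : M) (p : TangentBundle 𝓘(ℝ, E) M),
    p.1 ∈ (extChartAt 𝓘(ℝ, E) x₀).source → p.2 ≠ 0 →
      (fieldCoord x₀ p (field p)).1 = (stdCoord x₀ p).2
  smooth : ∀ x₀ : M, ContDiffOn ℝ ∞ (fun q : E × E => sprayCoeff field x₀ q.1 q.2)
    ((extChartAt 𝓘(ℝ, E) x₀).target ×ˢ {0}ᶜ)
  homogeneous : ∀ (x₀ : M), ∀ x ∈ (extChartAt 𝓘(ℝ, E) x₀).target, ∀ y : E, y ≠ 0 →
    ∀ l : ℝ, 0 < l → sprayCoeff field x₀ x (l • y) = l ^ 2 • sprayCoeff field x₀ x y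

/-- `𝐍(x, y) v = vʲ ∂𝐆/∂yʲ (x, y)`, i.e. the components `𝐍ⁱ_j vʲ`. -/
def Spray.connCoeff (S : Spray E M) (x₀ : M) (x y v : E) : E :=
  fderiv ℝ (fun z : E => sprayCoeff S.field x₀ x z) y v

/-- The lifting `(c(t), ċ(t))` of a curve to the tangent bundle. -/
def velocity (c : ℝ → M) (t : ℝ) : TangentBundle 𝓘(ℝ, E) M :=
  ⟨c t, mfderiv 𝓘(ℝ, ℝ) 𝓘(ℝ, E) c t (1 : ℝ)⟩

/-- `c` is a geodesic of `S` on the open interval `J`: it is smooth with nowhere-vanishing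
velocity, and `(c, ċ)` is an integral curve of the vector field `S`. -/
structure Spray.IsGeodesicOn (S : Spray E M) (c : ℝ → M) (J : Set ℝ) : Prop where
  smooth : ContMDiffOn 𝓘(ℝ, ℝ) 𝓘(ℝ, E) ∞ c J
  velocity_ne_zero : ∀ t ∈ J, (velocity (E := E) c t).2 ≠ 0
  integralCurve : IsMIntegralCurveOn (velocity (E := E) c) S.field J

/-- The nonlinear covariant derivative at time `t` of a vector field `X` along `c`,
`dXⁱ/dt + ċʲ 𝐍ⁱ_j(c, X)`, in the standard local coordinates of the chart at `c t`.
(As this is a tangent vector at `c t`, its vanishing does not depend on the chart.) -/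
def Spray.nonlinCovDeriv (S : Spray E M) (c : ℝ → M) (X : ℝ → TangentBundle 𝓘(ℝ, E) M)
    (t : ℝ) : E :=
  deriv (fun s => (stdCoord (c t) (X s)).2) t
    + S.connCoeff (c t) (stdCoord (c t) (X t)).1 (stdCoord (c t) (X t)).2
        (stdCoord (c t) (velocity c t)).2

/-- `X` is a nonlinearly parallel vector field along the curve `c : ℝ → M`: a smooth
nowhere-vanishing vector field along `c` whose nonlinear covariant derivative vanishes. -/
structure Spray.IsNonlinParallel (S : Spray E M) (c : ℝ → M)
    (X : ℝ → TangentBundle 𝓘(ℝ, E) M) : Prop where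
  along : ∀ t, (X t).1 = c t
  smooth : ContMDiff 𝓘(ℝ, ℝ) 𝓘(ℝ, E).tangent ∞ X
  ne_zero : ∀ t, (X t).2 ≠ 0
  parallel : ∀ t, S.nonlinCovDeriv c X t = 0

/-- Nonlinearly parallel translation along `c` from `c a` to `c b`: it maps `p ∈ T_{c(a)}M ∖ 0`
to `X(b) ∈ T_{c(b)}M ∖ 0`, where `X` is the nonlinearly parallel vector field along `c`
with `X(a) = p`. -/
def Spray.nonlinTransport (S : Spray E M) (c : ℝ → M) (a b : ℝ)
    (p : TangentBundle 𝓘(ℝ, E) M) : TangentBundle 𝓘(ℝ, E) M :=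
  @Classical.epsilon _ ⟨p⟩ fun q => ∃ X, S.IsNonlinParallel c X ∧ X a = p ∧ X b = q

end Spray

/-! ### Lie groups and coset spaces

The Lie algebra `T_1 G` of a Lie group `G` modelled on `EG` is `GroupLieAlgebra 𝓘(ℝ, EG) G`, whose
underlying vector space is by definition the normed space `EG`; its elements are written
as elements of `EG` here. -/

section LieGroup

variable {EG : Type*} [NormedAddCommGroup EG] [NormedSpace ℝ EG]
  (G : Type*) [Group G] [TopologicalSpace G] [ChartedSpace EG G]

/-- The vector `(L_g)_* v ∈ T_g G` for `v` in the Lie algebra. -/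
def leftInv (v : EG) (g : G) : TangentSpace 𝓘(ℝ, EG) g :=
  mulInvariantVectorField (I := 𝓘(ℝ, EG)) (G := G) (show GroupLieAlgebra 𝓘(ℝ, EG) G from v) g

/-- The bracket of the Lie algebra of `G`. -/
def lieBr (v w : EG) : EG :=
  (⁅(show GroupLieAlgebra 𝓘(ℝ, EG) G from v), (show GroupLieAlgebra 𝓘(ℝ, EG) G from w)⁆ :
    GroupLieAlgebra 𝓘(ℝ, EG) G)

/-- The exponential map of `G`: `exp v = γ(1)`, for the integral curve `γ` of the left invariant
vector field of `v` with `γ(0) = 1`. -/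
def lieExp (v : EG) : G :=
  Classical.epsilon fun g : G =>
    ∃ γ : ℝ → G, γ 0 = 1 ∧ IsMIntegralCurve (I := 𝓘(ℝ, EG)) γ (leftInv G v) ∧ γ 1 = g

end LieGroup

section Coset

variable {EG : Type*} [NormedAddCommGroup EG] [NormedSpace ℝ EG]
  {G : Type*} [Group G] [TopologicalSpace G] [ChartedSpace EG G]
  {H : Subgroup G}
  {EM : Type*} [NormedAddCommGroup EM] [NormedSpace ℝ EM] [ChartedSpace EM (G ⧸ H)]
  [IsManifold 𝓘(ℝ, EM) ∞ (G ⧸ H)]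

variable (EG H EM) in
/-- `G ⧸ H` is a smooth coset space: `H` is a closed subgroup and the manifold structure of
`G ⧸ H` is the (unique) one for which `G → G ⧸ H` is a smooth submersion. -/
structure IsSmoothCosetSpace : Prop where
  isClosed : IsClosed (H : Set G)
  isSubmersion : Manifold.IsSubmersion 𝓘(ℝ, EG) 𝓘(ℝ, EM) ∞ (fun g : G => (g : G ⧸ H))

variable (H EM) in
/-- The image of `v ∈ 𝔤` in `T_o(G ⧸ H)` under the differential of `G → G ⧸ H`,
as an element of the tangent bundle. On `𝔪` this is the identification `𝔪 = T_o(G ⧸ H)`. -/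
def originVec (v : EG) : TangentBundle 𝓘(ℝ, EM) (G ⧸ H) :=
  ⟨((1 : G) : G ⧸ H),
    mfderiv 𝓘(ℝ, EG) 𝓘(ℝ, EM) (fun g : G => (g : G ⧸ H)) (1 : G)
      (show TangentSpace 𝓘(ℝ, EG) (1 : G) from v)⟩

variable (H EM) in
/-- The tangent map `g_*` of the action of `g` on `G ⧸ H`. -/
def actTangent (g : G) : TangentBundle 𝓘(ℝ, EM) (G ⧸ H) → TangentBundle 𝓘(ℝ, EM) (G ⧸ H) :=
  tangentMap 𝓘(ℝ, EM) 𝓘(ℝ, EM) (fun x : G ⧸ H => g • x)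

/-- The spray structure is `G`-invariant: `(g_*)_* 𝐆 = 𝐆` for every `g ∈ G`. -/
def IsInvariant (S : Spray EM (G ⧸ H)) : Prop :=
  ∀ (g : G) (p : TangentBundle 𝓘(ℝ, EM) (G ⧸ H)), p.2 ≠ 0 →
    mfderiv 𝓘(ℝ, EM).tangent 𝓘(ℝ, EM).tangent (actTangent H EM g) p (S.field p)
      = S.field (actTangent H EM g p)

/-- `v = η(y)`: there are a geodesic `c` near `0` with `c(0) = o` and `ċ(0) = y`, and a smooth
curve `cb` in `G` with `cb(0) = 1`, `c(t) = cb(t) · o` and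
`u(t) = (L_{cb(t)⁻¹})_* (d/dt cb(t)) ∈ 𝔪 ∖ 0`, such that `v = - u'(0)`. -/
def IsSprayVector (S : Spray EM (G ⧸ H)) (𝔪 : Submodule ℝ EG) (y v : 𝔪) : Prop :=
  ∃ (ε : ℝ) (c : ℝ → G ⧸ H) (cb : ℝ → G) (u : ℝ → 𝔪), 0 < ε ∧
    S.IsGeodesicOn c (Ioo (-ε) ε) ∧
    velocity c 0 = originVec H EM (y : EG) ∧
    ContMDiffOn 𝓘(ℝ, ℝ) 𝓘(ℝ, EG) ∞ cb (Ioo (-ε) ε) ∧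
    cb 0 = 1 ∧
    (∀ t ∈ Ioo (-ε) ε, c t = (cb t : G ⧸ H)) ∧
    (∀ t ∈ Ioo (-ε) ε, u t ≠ 0 ∧
      mfderiv 𝓘(ℝ, ℝ) 𝓘(ℝ, EG) cb t (1 : ℝ) = leftInv G (u t : EG) (cb t)) ∧
    HasDerivAt u (-v) 0

/-- The spray vector field `η : 𝔪 ∖ 0 → 𝔪` (with a junk value at `0`). -/
def sprayVectorField (S : Spray EM (G ⧸ H)) (𝔪 : Submodule ℝ EG) (y : 𝔪) : 𝔪 :=
  Classical.epsilon fun v : 𝔪 => IsSprayVector S 𝔪 y v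

/-- The connection operator `N(y, w) = ½ Dη(y, w) - ½ [y, w]_𝔪` on `𝔪 ∖ 0 × 𝔪`, for a linear
decomposition `𝔤 = 𝔥 + 𝔪`. -/
def connOp (S : Spray EM (G ⧸ H)) {𝔥 𝔪 : Submodule ℝ EG} (hc : IsCompl 𝔥 𝔪) (y w : 𝔪) : 𝔪 :=
  (1 / 2 : ℝ) • deriv (fun t : ℝ => sprayVectorField S 𝔪 (y + t • w)) 0
    - (1 / 2 : ℝ) • 𝔪.projectionOnto 𝔥 hc.symm (lieBr G (y : EG) (w : EG))

end Coset

/-! ### One-parameter groups of diffeomorphisms of `V ∖ 0` -/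

section Flow

/-- The open submanifold `V ∖ 0` of a normed space. -/
def slit (V : Type*) [NormedAddCommGroup V] : TopologicalSpace.Opens V :=
  ⟨{0}ᶜ, isOpen_compl_singleton⟩

/-- `ρ` is the one-parameter group of diffeomorphisms of `V ∖ 0` generated by the
vector field `Z`. -/
structure IsOneParamGroup {V : Type*} [NormedAddCommGroup V] [NormedSpace ℝ V]
    (ρ : ℝ → slit V → slit V) (Z : slit V → V) : Prop where
  zero : ∀ y, ρ 0 y = y
  add : ∀ s t y, ρ (s + t) y = ρ s (ρ t y)
  smooth : ContMDiff (𝓘(ℝ, ℝ).prod 𝓘(ℝ, V)) 𝓘(ℝ, V) ∞ (fun q : ℝ × slit V => ρ q.1 q.2)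
  generator : ∀ t y, HasDerivAt (fun s => (ρ s y : V)) (Z (ρ t y)) t

end Flow

end SprayGeometry

end

/-! Everything is pulled back to `G`. A chart of `G ⧸ H` composed with the projection is a
vector-valued function `φ` on `G` (`cosetChart`), and `leftDeriv φ g` is its derivative along left
invariant fields, a linear map on the Lie algebra. A tangent vector `g_* u` of `G ⧸ H` then has
coordinates `(φ g, leftDeriv φ g u)` (`stdCoord_projTangent`). On `𝔪` the map `leftDeriv φ g` is an
isomorphism (`exists_equiv_leftDeriv`).

Write `D` for `leftDeriv φ g` and `B` for the second left derivative. Invariance turns the geodesic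
equation into one identity valid at all `g`, in all charts: `-2 𝐆(φ g, D u) = B u u - D (η u)`
(`IsSprayEquation`). Solving it at the origin produces a smooth `2`-homogeneous `η`, and
`sprayVectorField_eq` shows that this is the spray vector field. Differentiating the identity at `u`
in the direction `w` gives `-2 𝐍(D u) (D w) = B w u + B u w - D (Dη(u, w))`. Left invariant
derivatives commute up to the bracket, `B w u - B u w = D [w, u]`, and `D` kills `𝔥`, so `B w u +
𝐍(D u) (D w) = D (N(u, w))` (`leftDeriv_leftDeriv_add_connCoeff`). For `X(t) = exp(tw)_* y(t)` the
nonlinear covariant derivative is therefore `D (y' + N(y, w))`, and `X` is parallel exactly when `y'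
= -N(y, w)`. In the frame transported by `exp(tw)`, parallel translation is the flow of `-N(·, w)`.

It remains to know that this flow is global and smooth. The field is positively `1`-homogeneous,
hence Lipschitz on `𝔪 ∖ 0` and of linear growth, so near each `x` solutions exist, and avoid `0`,
for a time independent of `x` (`exists_flow_of_homogeneous`). Smooth dependence on initial values
comes from the implicit function theorem applied to the integral equation in `C([0,1], E)`. -/

noncomputable section

namespace SprayGeometry

universe u

/-! ### Composition operators on spaces of continuous maps. -/

section Nemytskii

/-- Pointwise application of a continuous family of linear maps, as a continuous linear map. -/
def pointwiseApply (K : Type*) [TopologicalSpace K] [CompactSpace K]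
    (E F : Type*) [NormedAddCommGroup E] [NormedSpace ℝ E] [NormedAddCommGroup F]
    [NormedSpace ℝ F] : C(K, E →L[ℝ] F) →L[ℝ] C(K, E) →L[ℝ] C(K, F) :=
  LinearMap.mkContinuous₂
    (LinearMap.mk₂ ℝ (fun (A : C(K, E →L[ℝ] F)) (h : C(K, E)) =>
      (⟨fun k => A k (h k), A.continuous.clm_apply h.continuous⟩ : C(K, F)))
      (fun _ _ _ => by ext; simp) (fun _ _ _ => by ext; simp)
      (fun _ _ _ => by ext; simp) (fun _ _ _ => by ext; simp)) 1
    (fun (A : C(K, E →L[ℝ] F)) (h : C(K, E)) => by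
      rw [one_mul]
      refine (ContinuousMap.norm_le _ (mul_nonneg (norm_nonneg A) (norm_nonneg h))).2 ?_
      intro k
      exact ((A k).le_opNorm (h k)).trans
        (mul_le_mul (A.norm_coe_le_norm k) (h.norm_coe_le_norm k) (norm_nonneg _) (norm_nonneg _)))

variable {K : Type*} [TopologicalSpace K] [CompactSpace K]

@[simp] lemma pointwiseApply_apply {E F : Type*} [NormedAddCommGroup E] [NormedSpace ℝ E]
    [NormedAddCommGroup F] [NormedSpace ℝ F] (A : C(K, E →L[ℝ] F)) (h : C(K, E)) (k : K) :
    pointwiseApply K E F A h k = A k (h k) := rfl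

/-- The range of `γ` is compact, so `fderiv ℝ f` is uniformly continuous around it. The mean value
inequality then bounds the remainder by `ε ‖h‖` with the same `δ` at every point of `K`. -/
lemma hasFDerivAt_comp_left {E F : Type*} [NormedAddCommGroup E] [NormedSpace ℝ E]
    [NormedAddCommGroup F] [NormedSpace ℝ F] {f : E → F} (hf : ContDiff ℝ 1 f) (γ : C(K, E)) :
    HasFDerivAt (fun γ : C(K, E) => (⟨f, hf.continuous⟩ : C(E, F)).comp γ)
      (pointwiseApply K E F ((⟨fderiv ℝ f, hf.continuous_fderiv one_ne_zero⟩ :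
        C(E, E →L[ℝ] F)).comp γ)) γ := by
  rw [hasFDerivAt_iff_isLittleO_nhds_zero, Asymptotics.isLittleO_iff]
  intro ε hε
  have hD : Continuous (fderiv ℝ f) := hf.continuous_fderiv one_ne_zero
  have hcpt : IsCompact (range γ) := isCompact_range γ.continuous
  have hu := hcpt.uniformContinuousAt_of_continuousAt (fderiv ℝ f)
    (fun a _ => hD.continuousAt) (Metric.dist_mem_uniformity hε)
  obtain ⟨δ, hδ, hδ'⟩ := Metric.mem_uniformity_dist.1 hu
  filter_upwards [Metric.ball_mem_nhds (0 : C(K, E)) hδ] with h hh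
  rw [ContinuousMap.norm_le _ (by positivity)]
  intro k
  have hhk : ‖h k‖ < δ := (h.norm_coe_le_norm k).trans_lt (by simpa using hh)
  have key := (convex_ball (γ k) δ).norm_image_sub_le_of_norm_hasFDerivWithin_le'
    (f := f) (f' := fderiv ℝ f) (φ := fderiv ℝ f (γ k)) (C := ε)
    (x := γ k) (y := γ k + h k)
    (fun x _ => ((hf.differentiable one_ne_zero) x).hasFDerivAt.hasFDerivWithinAt)
    (fun x hx => by
      have := @hδ' (γ k) x (by rw [dist_comm]; exact hx) ⟨k, rfl⟩
      rw [← dist_eq_norm, dist_comm]; exact this.le)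
    (Metric.mem_ball_self hδ) (by simpa [Metric.mem_ball, dist_eq_norm] using hhk)
  simp only [add_sub_cancel_left] at key
  simpa using key.trans (mul_le_mul_of_nonneg_left (h.norm_coe_le_norm k) hε.le)

/-- The composition operator of a `C^n` map between normed spaces is `C^n` on continuous maps
from a compact space. -/
lemma contDiff_comp_left {E : Type u} [NormedAddCommGroup E] [NormedSpace ℝ E] (n : ℕ) :
    ∀ {F : Type u} [NormedAddCommGroup F] [NormedSpace ℝ F] {f : E → F}
    (_ : ContDiff ℝ n f) (hc : Continuous f), ContDiff ℝ n
      (fun γ : C(K, E) => (⟨f, hc⟩ : C(E, F)).comp γ) := by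
  induction n with
  | zero =>
    intro F _ _ f hf hc
    exact contDiff_zero.2 (ContinuousMap.continuous_postcomp _)
  | succ n ih =>
    intro F _ _ f hf hc
    have h1 : ContDiff ℝ 1 f := hf.of_le (by exact_mod_cast Nat.le_add_left 1 n)
    have hD : ContDiff ℝ n (fderiv ℝ f) :=
      hf.fderiv_right (by norm_cast)
    -- The derivative is again a composition operator, for `fderiv ℝ f`, followed by the bounded
    -- linear `pointwiseApply`. The induction thus changes the codomain to `E →L[ℝ] F`, which is why
    -- `E` and `F` share a universe and `F` is quantified inside.
    refine contDiff_succ_iff_hasFDerivAt.2 ?_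
    exact ⟨fun γ => pointwiseApply K E F
      ((⟨fderiv ℝ f, h1.continuous_fderiv one_ne_zero⟩ : C(E, E →L[ℝ] F)).comp γ),
      ContDiff.comp (g := pointwiseApply K E F) (ContinuousLinearMap.contDiff _) (ih hD _), fun γ => hasFDerivAt_comp_left h1 γ⟩

end Nemytskii

/-! ### Smooth dependence of flows on initial values. -/

section LocalFlow

variable {E : Type u} [NormedAddCommGroup E] [NormedSpace ℝ E] [CompleteSpace E]

/-- The operator `γ ↦ ∫₀ γ` on continuous functions on `[0, 1]`. -/
def integralOp (E : Type*) [NormedAddCommGroup E] [NormedSpace ℝ E] [CompleteSpace E] :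
    C(Icc (0 : ℝ) 1, E) →L[ℝ] C(Icc (0 : ℝ) 1, E) :=
  LinearMap.mkContinuous
    { toFun := fun γ => ⟨fun s => ∫ τ in (0 : ℝ)..s, γ (projIcc 0 1 zero_le_one τ), by
        have hc : Continuous fun τ : ℝ => γ (projIcc 0 1 zero_le_one τ) :=
          γ.continuous.comp continuous_projIcc
        exact (intervalIntegral.continuous_primitive (fun a b => hc.intervalIntegrable a b) 0).comp
          continuous_subtype_val⟩
      map_add' := fun γ δ => by
        ext s
        exact intervalIntegral.integral_add
          ((γ.continuous.comp continuous_projIcc).intervalIntegrable _ _)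
          ((δ.continuous.comp continuous_projIcc).intervalIntegrable _ _)
      map_smul' := fun c γ => by
        ext s
        exact intervalIntegral.integral_smul c _ } 1
    (fun γ => by
      rw [one_mul]
      refine (ContinuousMap.norm_le _ (norm_nonneg _)).2 fun s => ?_
      refine (intervalIntegral.norm_integral_le_of_norm_le_const
        (C := ‖γ‖) (fun τ _ => γ.norm_coe_le_norm _)).trans ?_
      rw [sub_zero, abs_of_nonneg s.2.1]
      exact mul_le_of_le_one_right (norm_nonneg _) s.2.2)

lemma integralOp_apply (γ : C(Icc (0 : ℝ) 1, E)) (s : Icc (0 : ℝ) 1) :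
    integralOp E γ s = ∫ τ in (0 : ℝ)..s, γ (projIcc 0 1 zero_le_one τ) := rfl

/-- A `C^n` vector field on a Banach space has, near every point, solutions on a fixed time
interval (after rescaling time by `ε`) that depend in a `C^n` way on the initial value and `ε`. -/
lemma exists_contDiffAt_localFlow {n : ℕ} (hn : n ≠ 0) {Z : E → E} (hZ : ContDiff ℝ n Z) (y₀ : E) :
    ∃ ψ : E × ℝ → C(Icc (0 : ℝ) 1, E), ContDiffAt ℝ n ψ (y₀, 0) ∧
      ψ (y₀, 0) = ContinuousMap.const _ y₀ ∧
      ∀ᶠ q in 𝓝 (y₀, (0 : ℝ)), ∀ s : Icc (0 : ℝ) 1,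
        ψ q s = q.1 + q.2 • ∫ τ in (0 : ℝ)..s, Z (ψ q (projIcc 0 1 zero_le_one τ)) := by
  let I := Icc (0 : ℝ) 1
  let cst : E →L[ℝ] C(I, E) := ContinuousLinearMap.const ℝ I
  let NZ : C(I, E) → C(I, E) := fun γ => (⟨Z, hZ.continuous⟩ : C(E, E)).comp γ
  have hNZ : ContDiff ℝ n NZ := contDiff_comp_left n hZ hZ.continuous
  -- Zeros of `Φ` are the solutions of `γ(s) = y + ε ∫₀ˢ Z(γ)`, the integral equation with time
  -- rescaled to `[0, 1]`. At `ε = 0` the integral disappears and the partial derivative in `γ` is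
  -- the identity, so the implicit function theorem applies.
  let Φ : (E × ℝ) × C(I, E) → C(I, E) :=
    fun p => p.2 - cst p.1.1 - p.1.2 • integralOp E (NZ p.2)
  have hΦ : ContDiff ℝ n Φ := by
    have : ContDiff ℝ n fun p : (E × ℝ) × C(I, E) => integralOp E (NZ p.2) :=
      (integralOp E).contDiff.comp (hNZ.comp contDiff_snd)
    have h2 : ContDiff ℝ n fun p : (E × ℝ) × C(I, E) => cst p.1.1 :=
      cst.contDiff.comp (contDiff_fst.comp contDiff_fst)
    exact (contDiff_snd.sub h2).sub ((contDiff_snd.comp contDiff_fst).smul this)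
  let u : (E × ℝ) × C(I, E) := ((y₀, 0), cst y₀)
  have hn' : (n : WithTop ℕ∞) ≠ 0 := by exact_mod_cast hn
  have hinv : (fderiv ℝ Φ u ∘L .inr ℝ (E × ℝ) C(I, E)).IsInvertible := by
    have h1 : HasFDerivAt (fun γ : C(I, E) => Φ ((y₀, 0), γ))
        (fderiv ℝ Φ u ∘L .inr ℝ (E × ℝ) C(I, E)) (cst y₀) :=
      ((hΦ.differentiable hn') u).hasFDerivAt.comp (cst y₀) (hasFDerivAt_prodMk_right _ _)
    have h2 : HasFDerivAt (fun γ : C(I, E) => Φ ((y₀, 0), γ))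
        (ContinuousLinearMap.id ℝ C(I, E)) (cst y₀) := by
      have : (fun γ : C(I, E) => Φ ((y₀, 0), γ)) = fun γ => γ - cst y₀ := by
        funext γ; simp [Φ]
      rw [this]
      exact (hasFDerivAt_id _).sub_const _
    rw [h1.unique h2]
    exact ⟨ContinuousLinearEquiv.refl ℝ _, rfl⟩
  have hΦu : Φ u = 0 := by simp [Φ, u]
  obtain ⟨ψ, hψ, hψ0, hψe⟩ : ∃ ψ : E × ℝ → C(I, E), ContDiffAt ℝ n ψ (y₀, 0) ∧
      ψ (y₀, 0) = ContinuousMap.const _ y₀ ∧ ∀ᶠ q in 𝓝 (y₀, (0 : ℝ)), Φ (q, ψ q) = Φ u :=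
    ⟨hΦ.contDiffAt.implicitFunction hn' hinv, hΦ.contDiffAt.contDiffAt_implicitFunction hn' hinv,
      hΦ.contDiffAt.implicitFunction_apply_self hn' hinv,
      hΦ.contDiffAt.eventually_apply_implicitFunction hn' hinv⟩
  refine ⟨ψ, hψ, hψ0, ?_⟩
  filter_upwards [hψe] with q hq s
  rw [hΦu] at hq
  have := congrArg (fun γ : C(I, E) => γ s) hq
  simp only [Φ, ContinuousMap.sub_apply, ContinuousMap.zero_apply,
    sub_sub, sub_eq_zero] at this
  rw [ContinuousMap.add_apply, ContinuousMap.smul_apply, integralOp_apply,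
    show cst q.1 s = q.1 from rfl] at this
  exact this

variable {U : Set E} {Z : E → E} {ρ : ℝ → E → E} {K : NNReal}

/-- Near time `0` a flow of a `C^n` vector field is `C^n`. -/
lemma flow_contDiffAt_zero [FiniteDimensional ℝ E] (hU : IsOpen U) (hZ : ContDiffOn ℝ ∞ Z U) (hK : LipschitzOnWith K Z U)
    (h0 : ∀ y ∈ U, ρ 0 y = y) (hρU : ∀ t, ∀ y ∈ U, ρ t y ∈ U)
    (hρ : ∀ y ∈ U, ∀ t, HasDerivAt (fun s => ρ s y) (Z (ρ t y)) t)
    {n : ℕ} (hn : n ≠ 0) {y₀ : E} (hy₀ : y₀ ∈ U) :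
    ContDiffAt ℝ n (fun q : E × ℝ => ρ q.2 q.1) (y₀, 0) := by
  -- `exists_contDiffAt_localFlow` needs a field on all of `E`, so `Z` is cut off. This is harmless,
  -- since the solutions stay where `χ = 1`.
  obtain ⟨χ, hχ⟩ : ∃ χ : ContDiffBump y₀, tsupport χ ⊆ U := by
    obtain ⟨r, hr, hrU⟩ := Metric.nhds_basis_closedBall.mem_iff.1 (hU.mem_nhds hy₀)
    exact ⟨⟨r / 2, r, by positivity, by linarith⟩, by rw [ContDiffBump.tsupport_eq]; exact hrU⟩
  have hZ' : ContDiff ℝ n (fun y => χ y • Z y) := by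
    rw [← contMDiff_iff_contDiff]
    refine contMDiff_of_tsupport fun x hx => contMDiffAt_iff_contDiffAt.2 ?_
    have hxU : x ∈ U := hχ (tsupport_smul_subset_left _ _ hx)
    exact χ.contDiffAt.smul ((hZ.contDiffAt (hU.mem_nhds hxU)).of_le (by exact_mod_cast le_top))
  obtain ⟨ψ, hψ, hψ0, hψe⟩ := exists_contDiffAt_localFlow hn hZ' y₀
  have hev : ContDiffAt ℝ n (fun q => ψ q ⟨1, right_mem_Icc.2 zero_le_one⟩) (y₀, 0) :=
    ContDiffAt.comp (g := fun γ : C(Icc (0 : ℝ) 1, E) => γ ⟨1, right_mem_Icc.2 zero_le_one⟩) _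
      (ContinuousLinearMap.contDiff (ContinuousMap.evalCLM (M := E) ℝ
        (⟨1, right_mem_Icc.2 zero_le_one⟩ : Icc (0 : ℝ) 1))).contDiffAt hψ
  refine hev.congr_of_eventuallyEq ?_
  obtain ⟨r, hr, hrU⟩ := Metric.nhds_basis_ball.mem_iff.1
    (Filter.inter_mem (hU.mem_nhds hy₀) χ.eventuallyEq_one)
  have hball : ∀ᶠ q in 𝓝 (y₀, (0 : ℝ)), ψ q ∈ Metric.ball (ContinuousMap.const _ y₀) r := by
    apply hψ.continuousAt.eventually_mem
    rw [hψ0]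
    exact Metric.ball_mem_nhds _ hr
  have hfst : ∀ᶠ q in 𝓝 (y₀, (0 : ℝ)), q.1 ∈ U :=
    continuousAt_fst.eventually_mem (hU.mem_nhds hy₀)
  filter_upwards [hψe, hball, hfst] with q hq hqb hqU
  let f : ℝ → E := fun s => ψ q (projIcc 0 1 zero_le_one s)
  have hfmem : ∀ s, f s ∈ Metric.ball y₀ r := fun s => by
    rw [mem_ball_iff_norm] at hqb ⊢
    exact ((ψ q - ContinuousMap.const _ y₀).norm_coe_le_norm (projIcc 0 1 zero_le_one s)).trans_lt hqb
  have hfc : Continuous f := (ψ q).continuous.comp continuous_projIcc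
  have hZf : ∀ s, χ (f s) • Z (f s) = Z (f s) := fun s => by
    have : χ (f s) = 1 := (hrU (hfmem s)).2
    rw [this, one_smul]
  have hZfc : Continuous fun s => Z (f s) := by
    have := hZ'.continuous.comp hfc
    simpa only [Function.comp_def, hZf] using this
  have hfeq : ∀ s ∈ Icc (0 : ℝ) 1, f s = q.1 + q.2 • ∫ τ in (0 : ℝ)..s, Z (f τ) := fun s hs => by
    have := hq ⟨s, hs⟩
    simp only [hZf, f] at this ⊢
    rw [projIcc_of_mem _ hs, this]
  have hfder : ∀ s ∈ Ico (0 : ℝ) 1, HasDerivWithinAt f (q.2 • Z (f s)) (Ici s) s := fun s hs => by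
    have h1 : HasDerivAt (fun s => q.1 + q.2 • ∫ τ in (0 : ℝ)..s, Z (f τ)) (q.2 • Z (f s)) s :=
      ((intervalIntegral.integral_hasDerivAt_right (hZfc.intervalIntegrable _ _)
        (hZfc.stronglyMeasurableAtFilter _ _) hZfc.continuousAt).const_smul q.2).const_add q.1
    refine h1.hasDerivWithinAt.congr_of_eventuallyEq ?_ (hfeq s ⟨hs.1, hs.2.le⟩)
    filter_upwards [Icc_mem_nhdsGE hs.2] with τ hτ
    exact hfeq τ ⟨hs.1.trans hτ.1, hτ.2⟩
  have hgder : ∀ s, HasDerivAt (fun s => ρ (q.2 * s) q.1) (q.2 • Z (ρ (q.2 * s) q.1)) s := fun s => by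
    have := (hρ q.1 hqU (q.2 * s)).scomp s ((hasDerivAt_id s).const_mul q.2)
    simpa [Function.comp_def] using this
  -- Both `f` and the rescaled orbit `s ↦ ρ (q.2 * s) q.1` solve the equation of the field `q.2 • Z`
  -- from `q.1`. Their values at `s = 1` give the claim.
  have := ODE_solution_unique_of_mem_Icc_right (v := fun _ y => q.2 • Z y) (s := fun _ => U)
    (K := ‖q.2‖₊ * K) (f := f) (g := fun s => ρ (q.2 * s) q.1) (a := 0) (b := 1)
    (fun t _ => by
      refine LipschitzOnWith.of_dist_le_mul fun x hx y hy => ?_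
      rw [dist_smul₀, NNReal.coe_mul, mul_assoc]
      exact mul_le_mul_of_nonneg_left (hK.dist_le_mul x hx y hy) (norm_nonneg _))
    hfc.continuousOn hfder (fun t _ => (hrU (hfmem t)).1)
    (fun s _ => (hgder s).continuousAt.continuousWithinAt)
    (fun s _ => (hgder s).hasDerivWithinAt) (fun t _ => hρU _ _ hqU)
    (by rw [hfeq 0 (left_mem_Icc.2 zero_le_one)]; simp [h0 q.1 hqU])
    (right_mem_Icc.2 zero_le_one)
  simp only [mul_one, f] at this
  rw [← this, projIcc_right]

/-- A global flow of a smooth vector field is smooth. -/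
lemma flow_contDiffOn [FiniteDimensional ℝ E] (hU : IsOpen U) (hZ : ContDiffOn ℝ ∞ Z U) (hK : LipschitzOnWith K Z U)
    (h0 : ∀ y ∈ U, ρ 0 y = y) (hρU : ∀ t, ∀ y ∈ U, ρ t y ∈ U)
    (hadd : ∀ s t, ∀ y ∈ U, ρ (s + t) y = ρ s (ρ t y))
    (hρ : ∀ y ∈ U, ∀ t, HasDerivAt (fun s => ρ s y) (Z (ρ t y)) t) :
    ContDiffOn ℝ ∞ (fun q : ℝ × E => ρ q.1 q.2) (univ ×ˢ U) := by
  rintro ⟨t, y₀⟩ ⟨-, hy₀⟩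
  refine ContDiffAt.contDiffWithinAt ?_
  -- One finite order at a time: being `C^n` at a point is an open condition only for finite `n`.
  have key : ∀ n : ℕ, n ≠ 0 → ContDiffAt ℝ n (fun q : ℝ × E => ρ q.1 q.2) (t, y₀) := by
    intro n hn
    have hz : ∀ y ∈ U, ContDiffAt ℝ n (fun q : ℝ × E => ρ q.1 q.2) (0, y) := fun y hy =>
      (flow_contDiffAt_zero hU hZ hK h0 hρU hρ hn hy).comp (0, y)
        (contDiff_snd.prodMk contDiff_fst).contDiffAt
    let A : Set ℝ := {t | ContDiffAt ℝ n (fun q : ℝ × E => ρ q.1 q.2) (t, y₀)}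
    have hAo : IsOpen A := by
      rw [isOpen_iff_mem_nhds]
      intro s hs
      exact (Continuous.prodMk_left y₀).continuousAt.eventually
        (ContDiffAt.eventually hs (by simp))
    -- For `s` in the closure choose `r ∈ A` close to `s` and write `ρ_s = ρ_{s-r} ∘ ρ_r`. The outer
    -- factor is a flow for short time near `ρ r y₀`, hence `C^n` there. Being clopen and containing
    -- `0`, the set `A` is everything.
    have hAc : IsClosed A := by
      rw [← closure_subset_iff_isClosed]
      intro s hs
      have h1 : ∀ᶠ r in 𝓝 s, ContDiffAt ℝ n (fun q : ℝ × E => ρ q.1 q.2) (s - r, ρ r y₀) := by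
        have hcont : ContinuousAt (fun r => (s - r, ρ r y₀)) s :=
          (continuousAt_const.sub continuousAt_id).prodMk (hρ y₀ hy₀ s).continuousAt
        have hzz := (hz (ρ s y₀) (hρU s y₀ hy₀)).eventually (by simp)
        exact hcont.eventually (by simpa using hzz)
      obtain ⟨r, hr, hrA⟩ := (mem_closure_iff_frequently.1 hs).and_eventually h1 |>.exists
      have h2 : ContDiffAt ℝ n (fun q : ℝ × E => ρ r q.2) (s, y₀) :=
        ContDiffAt.comp (g := fun q : ℝ × E => ρ q.1 q.2) (f := fun q : ℝ × E => (r, q.2)) (s, y₀) hr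
          (contDiff_const.prodMk contDiff_snd).contDiffAt
      have h3 : ContDiffAt ℝ n (fun q : ℝ × E => ρ (q.1 - r) (ρ r q.2)) (s, y₀) :=
        ContDiffAt.comp (g := fun q : ℝ × E => ρ q.1 q.2)
          (f := fun q : ℝ × E => (q.1 - r, ρ r q.2)) (s, y₀) hrA
          ((contDiff_fst.sub contDiff_const).contDiffAt.prodMk h2)
      refine h3.congr_of_eventuallyEq ?_
      filter_upwards [continuousAt_snd.eventually_mem (hU.mem_nhds hy₀)] with q hq
      rw [← hadd _ _ _ hq, sub_add_cancel]
    have : A = univ := IsClopen.eq_univ ⟨hAc, hAo⟩ ⟨0, hz y₀ hy₀⟩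
    exact (this.symm ▸ mem_univ t : t ∈ A)
  rw [contDiffAt_infty]
  intro n
  exact (key (n + 1) n.succ_ne_zero).of_le (by exact_mod_cast Nat.le_succ n)

end LocalFlow


/-! ### Global flows of homogeneous vector fields. -/

section GlobalFlow

/-- The Picard fixed point lies in a space of curves confined to the ball, so the solution does too.
The confinement later keeps solutions away from `0`. -/
lemma exists_solution_mem_closedBall {E : Type*} [NormedAddCommGroup E] [NormedSpace ℝ E]
    [CompleteSpace E] {f : ℝ → E → E} {tmin tmax : ℝ} {t₀ : Icc tmin tmax} {x₀ : E}
    {a L K : NNReal} (hf : IsPicardLindelof f t₀ x₀ a 0 L K) :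
    ∃ α : ℝ → E, α t₀ = x₀ ∧ ∀ t ∈ Icc tmin tmax,
      HasDerivWithinAt α (f t (α t)) (Icc tmin tmax) t ∧ α t ∈ Metric.closedBall x₀ a := by
  obtain ⟨α, hα⟩ := ODE.FunSpace.exists_isFixedPt_next hf (Metric.mem_closedBall_self le_rfl)
  refine ⟨α.compProj, by rw [ODE.FunSpace.compProj_val, ← hα, ODE.FunSpace.next_apply₀],
    fun t ht => ⟨?_, α.compProj_mem_closedBall hf.mul_max_le⟩⟩
  refine (ODE.hasDerivWithinAt_picard_Icc t₀.2 hf.continuousOn_uncurry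
    α.continuous_compProj.continuousOn (fun _ _ => α.compProj_mem_closedBall hf.mul_max_le)
    x₀ ht).congr_of_mem ?_ ht
  intro t' ht'
  nth_rw 1 [← hα]
  rw [ODE.FunSpace.compProj_of_mem ht', ODE.FunSpace.next_apply]

variable {E : Type u} [NormedAddCommGroup E] [NormedSpace ℝ E] {U : Set E} {Z : E → E} {K : NNReal}

/-- Restarting at the points `α (±A/2)` gives solutions living for time `A` from there, which reach
`±3A/2`. By uniqueness they agree with `α` on the overlaps and can be glued. -/
lemma exists_solution_extend (hK : LipschitzOnWith K Z U) {A : ℝ} (hA : 0 < A)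
    (h : ∀ x ∈ U, ∃ α : ℝ → E, α 0 = x ∧ ∀ t ∈ Ioo (-A) A, HasDerivAt α (Z (α t)) t ∧ α t ∈ U) :
    ∀ x ∈ U, ∃ α : ℝ → E, α 0 = x ∧
      ∀ t ∈ Ioo (-(3 / 2 * A)) (3 / 2 * A), HasDerivAt α (Z (α t)) t ∧ α t ∈ U := by
  intro x hx
  obtain ⟨α, hα0, hα⟩ := h x hx
  have hshift : ∀ c ∈ Ioo (-A) A, ∃ β : ℝ → E, EqOn β α (Ioo (max (-A) (c - A)) (min A (c + A))) ∧
      ∀ t ∈ Ioo (c - A) (c + A), HasDerivAt β (Z (β t)) t ∧ β t ∈ U := by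
    intro c hc
    obtain ⟨δ, hδ0, hδ⟩ := h (α c) (hα c hc).2
    have hβ : ∀ t ∈ Ioo (c - A) (c + A),
        HasDerivAt (fun t => δ (t - c)) (Z (δ (t - c))) t ∧ δ (t - c) ∈ U := fun t ht => by
      have ht' : t - c ∈ Ioo (-A) A := ⟨by linarith [ht.1], by linarith [ht.2]⟩
      exact ⟨(hδ _ ht').1.comp_sub_const t c, (hδ _ ht').2⟩
    refine ⟨fun t => δ (t - c), ?_, hβ⟩
    refine ODE_solution_unique_of_mem_Ioo (v := fun _ => Z) (s := fun _ => U) (t₀ := c)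
      (fun _ _ => hK) ⟨max_lt hc.1 (by linarith), lt_min hc.2 (by linarith)⟩
      (fun t ht => hβ t ⟨(le_max_right _ _).trans_lt ht.1, ht.2.trans_le (min_le_right _ _)⟩)
      (fun t ht => hα t ⟨(le_max_left _ _).trans_lt ht.1, ht.2.trans_le (min_le_left _ _)⟩) ?_
    simp [hδ0]
  obtain ⟨β, hβα, hβ⟩ := hshift (A / 2) ⟨by linarith, by linarith⟩
  obtain ⟨δ, hδα, hδ⟩ := hshift (-(A / 2)) ⟨by linarith, by linarith⟩
  rw [max_eq_right (by linarith), min_eq_left (by linarith)] at hβα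
  rw [max_eq_left (by linarith), min_eq_right (by linarith)] at hδα
  let γ : ℝ → E := fun t => if t < 0 then δ t else β t
  have hγα : EqOn γ α (Ioo (A / 2 - A) (-(A / 2) + A)) := fun t ht => by
    by_cases h0 : t < 0
    · simpa [γ, h0] using hδα ⟨by linarith [ht.1], ht.2⟩
    · simpa [γ, h0] using hβα ⟨ht.1, by linarith [ht.2]⟩
  refine ⟨γ, by rw [hγα ⟨by linarith, by linarith⟩, hα0], fun t ht => ?_⟩
  -- The two branches of `γ` meet at `0`, where both coincide with `α` on a whole neighbourhood;
  -- hence `γ` is differentiable there.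
  rcases lt_trichotomy t 0 with h0 | h0 | h0
  · have he : γ =ᶠ[𝓝 t] δ := by
      filter_upwards [Iio_mem_nhds h0] with s hs
      simp [γ, show s < 0 from hs]
    have hd := hδ t ⟨by linarith [ht.1], by linarith⟩
    rw [he.eq_of_nhds]
    exact ⟨hd.1.congr_of_eventuallyEq he, hd.2⟩
  · have he : γ =ᶠ[𝓝 t] α :=
      hγα.eventuallyEq_of_mem (Ioo_mem_nhds (by linarith) (by linarith))
    have hd := hα t ⟨by linarith, by linarith⟩
    rw [he.eq_of_nhds]
    exact ⟨hd.1.congr_of_eventuallyEq he, hd.2⟩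
  · have he : γ =ᶠ[𝓝 t] β := by
      filter_upwards [Ioi_mem_nhds h0] with s hs
      simp [γ, not_lt.2 (le_of_lt (show 0 < s from hs))]
    have hd := hβ t ⟨by linarith, by linarith [ht.2]⟩
    rw [he.eq_of_nhds]
    exact ⟨hd.1.congr_of_eventuallyEq he, hd.2⟩

/-- If solutions of an autonomous equation exist for a uniform time, they exist for all times. -/
lemma exists_global_solution (hK : LipschitzOnWith K Z U) {ε : ℝ} (hε : 0 < ε)
    (h : ∀ x ∈ U, ∃ α : ℝ → E, α 0 = x ∧ ∀ t ∈ Ioo (-ε) ε, HasDerivAt α (Z (α t)) t ∧ α t ∈ U)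
    {x : E} (hx : x ∈ U) :
    ∃ α : ℝ → E, α 0 = x ∧ ∀ t, HasDerivAt α (Z (α t)) t ∧ α t ∈ U := by
  have hpos : ∀ n : ℕ, 0 < (3 / 2 : ℝ) ^ n * ε := fun n => by positivity
  have hall : ∀ n : ℕ, ∀ x ∈ U, ∃ α : ℝ → E, α 0 = x ∧
      ∀ t ∈ Ioo (-((3 / 2 : ℝ) ^ n * ε)) ((3 / 2) ^ n * ε), HasDerivAt α (Z (α t)) t ∧ α t ∈ U := by
    intro n
    induction n with
    | zero => simpa using h
    | succ n ih =>
      have := exists_solution_extend hK (hpos n) ih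
      simpa only [pow_succ', mul_assoc] using this
  choose α hα0 hα using fun n => hall n x hx
  have hN : ∀ t : ℝ, ∃ n : ℕ, |t| < (3 / 2 : ℝ) ^ n * ε := fun t => by
    obtain ⟨n, hn⟩ := pow_unbounded_of_one_lt (|t| / ε) (by norm_num : (1 : ℝ) < 3 / 2)
    exact ⟨n, (div_lt_iff₀ hε).1 hn⟩
  choose N hN using hN
  have hagree : ∀ n m : ℕ, ∀ t : ℝ, |t| < (3 / 2 : ℝ) ^ n * ε → |t| < (3 / 2 : ℝ) ^ m * ε →
      α n t = α m t := by
    intro n m t hn hm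
    let A := min ((3 / 2 : ℝ) ^ n * ε) ((3 / 2 : ℝ) ^ m * ε)
    have hA : 0 < A := lt_min (hpos n) (hpos m)
    have hAn : A ≤ (3 / 2 : ℝ) ^ n * ε := min_le_left _ _
    have hAm : A ≤ (3 / 2 : ℝ) ^ m * ε := min_le_right _ _
    refine ODE_solution_unique_of_mem_Ioo (v := fun _ => Z) (s := fun _ => U) (t₀ := 0)
      (a := -A) (b := A) (fun _ _ => hK) ⟨by linarith, hA⟩
      (fun s hs => hα n s ⟨by linarith [hs.1], by linarith [hs.2]⟩)
      (fun s hs => hα m s ⟨by linarith [hs.1], by linarith [hs.2]⟩)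
      (by rw [hα0, hα0]) (abs_lt.1 (lt_min hn hm))
  -- The index `N t` varies with `t`, but by `hagree` the curve equals the single solution `α (N t)`
  -- near `t`.
  refine ⟨fun t => α (N t) t, hα0 _, fun t => ?_⟩
  have hd := hα (N t) t (abs_lt.1 (hN t))
  refine ⟨hd.1.congr_of_eventuallyEq ?_, hd.2⟩
  filter_upwards [continuous_abs.continuousAt.eventually_mem (Iio_mem_nhds (hN t))] with s hs
  exact hagree _ _ s (hN s) hs

variable [FiniteDimensional ℝ E]

/-- A smooth positively `1`-homogeneous vector field on `E ∖ 0` is Lipschitz. -/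
lemma exists_lipschitzOnWith_of_homogeneous (hZ : ContDiffOn ℝ ∞ Z {0}ᶜ)
    (hZh : ∀ y ≠ 0, ∀ l : ℝ, 0 < l → Z (l • y) = l • Z y) :
    ∃ C : NNReal, LipschitzOnWith C Z {0}ᶜ ∧ ∀ y ≠ 0, ‖Z y‖ ≤ C * ‖y‖ := by
  have hopen : IsOpen ({0}ᶜ : Set E) := isOpen_compl_singleton
  have hsph : Metric.sphere (0 : E) 1 ⊆ {0}ᶜ := fun y hy => by
    rintro rfl
    simp at hy
  have hcpt : IsCompact (Metric.sphere (0 : E) 1) := isCompact_sphere 0 1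
  obtain ⟨C₁, hC₁⟩ := hcpt.exists_bound_of_continuousOn (hZ.continuousOn.mono hsph)
  obtain ⟨C₂, hC₂⟩ := hcpt.exists_bound_of_continuousOn
    ((hZ.continuousOn_fderiv_of_isOpen hopen (by simp)).mono hsph)
  have hunit : ∀ y : E, y ≠ 0 → ‖y‖⁻¹ • y ∈ Metric.sphere (0 : E) 1 := fun y hy => by
    simp [norm_smul, norm_ne_zero_iff.2 hy]
  let C : ℝ := max 0 (max C₁ C₂)
  have hC : 0 ≤ C := le_max_left _ _
  have hbd : ∀ y : E, y ≠ 0 → ‖Z y‖ ≤ C * ‖y‖ := fun y hy => by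
    have hy' : 0 < ‖y‖ := norm_pos_iff.2 hy
    have h1 : Z y = ‖y‖ • Z (‖y‖⁻¹ • y) := by
      rw [← hZh _ (hsph (hunit y hy)) _ hy', smul_smul, mul_inv_cancel₀ hy'.ne', one_smul]
    rw [h1, norm_smul, norm_norm, mul_comm]
    exact mul_le_mul_of_nonneg_right ((hC₁ _ (hunit y hy)).trans
      ((le_max_left _ _).trans (le_max_right _ _))) hy'.le
  -- The derivative of a `1`-homogeneous map is `0`-homogeneous, so its bound on the unit sphere
  -- holds everywhere.
  have hder : ∀ y : E, y ≠ 0 → ∃ D : E →L[ℝ] E, HasFDerivAt Z D y ∧ ‖D‖ ≤ C := fun y hy => by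
    have hy' : 0 < ‖y‖ := norm_pos_iff.2 hy
    have he := hsph (hunit y hy)
    have hd : HasFDerivAt Z (fderiv ℝ Z (‖y‖⁻¹ • y)) (‖y‖⁻¹ • y) :=
      ((hZ.contDiffAt (hopen.mem_nhds he)).differentiableAt (by simp)).hasFDerivAt
    refine ⟨fderiv ℝ Z (‖y‖⁻¹ • y), ?_, (hC₂ _ (hunit y hy)).trans
      ((le_max_right _ _).trans (le_max_right _ _))⟩
    have h2 := (HasFDerivAt.comp y hd ((hasFDerivAt_id (𝕜 := ℝ) y).const_smul ‖y‖⁻¹)).const_smul ‖y‖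
    have h3 : ‖y‖ • (fderiv ℝ Z (‖y‖⁻¹ • y)).comp (‖y‖⁻¹ • ContinuousLinearMap.id ℝ E)
        = fderiv ℝ Z (‖y‖⁻¹ • y) := by
      ext v
      simp [smul_smul, hy'.ne']
    rw [h3] at h2
    refine h2.congr_of_eventuallyEq ?_
    filter_upwards [hopen.mem_nhds hy] with z hz
    have hz' : ‖y‖⁻¹ • z ≠ 0 := smul_ne_zero (inv_ne_zero hy'.ne') hz
    simp only [Pi.smul_apply, Function.comp_apply]
    rw [← hZh _ hz' _ hy', smul_smul, mul_inv_cancel₀ hy'.ne', one_smul]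
  refine ⟨NNReal.mk C hC, LipschitzOnWith.of_dist_le_mul fun x hx y hy => ?_, hbd⟩
  rw [dist_eq_norm, dist_eq_norm, NNReal.coe_mk]
  -- The domain is not convex. If the segment meets `0`, then `‖x‖ + ‖y‖ = ‖x - y‖` and the growth
  -- bound suffices; otherwise the mean value inequality applies along the segment.
  by_cases hseg : (0 : E) ∈ segment ℝ x y
  · have h1 : ‖x‖ + ‖y‖ = ‖x - y‖ := by
      have := dist_add_dist_of_mem_segment hseg
      rwa [dist_zero_right, dist_zero_left, dist_eq_norm] at this
    calc ‖Z x - Z y‖ ≤ ‖Z x‖ + ‖Z y‖ := norm_sub_le _ _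
      _ ≤ C * ‖x‖ + C * ‖y‖ := add_le_add (hbd x hx) (hbd y hy)
      _ = C * ‖x - y‖ := by rw [← mul_add, h1]
  · have hne : ∀ z ∈ segment ℝ x y, z ≠ 0 := fun z hz h0 => hseg (h0 ▸ hz)
    choose! D hD hDC using hder
    exact (convex_segment x y).norm_image_sub_le_of_norm_hasFDerivWithin_le
      (fun z hz => (hD z (hne z hz)).hasFDerivWithinAt) (fun z hz => hDC z (hne z hz))
      (right_mem_segment ℝ x y) (left_mem_segment ℝ x y)

/-- A smooth positively `1`-homogeneous vector field on `E ∖ 0` has a smooth global flow. -/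
theorem exists_flow_of_homogeneous (hZ : ContDiffOn ℝ ∞ Z {0}ᶜ)
    (hZh : ∀ y ≠ 0, ∀ l : ℝ, 0 < l → Z (l • y) = l • Z y) :
    ∃ ρ : ℝ → E → E, (∀ y ≠ 0, ρ 0 y = y) ∧ (∀ t, ∀ y ≠ 0, ρ t y ≠ 0) ∧
      (∀ s t, ∀ y ≠ 0, ρ (s + t) y = ρ s (ρ t y)) ∧
      (∀ y ≠ 0, ∀ t, HasDerivAt (fun s => ρ s y) (Z (ρ t y)) t) ∧
      ContDiffOn ℝ ∞ (fun q : ℝ × E => ρ q.1 q.2) (univ ×ˢ {0}ᶜ) := by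
  have hopen : IsOpen ({0}ᶜ : Set E) := isOpen_compl_singleton
  have : CompleteSpace E := FiniteDimensional.complete ℝ E
  obtain ⟨C, hLip, hbd⟩ := exists_lipschitzOnWith_of_homogeneous hZ hZh
  -- On the ball of radius `‖x‖ / 2` about `x`, which avoids `0`, the speed is at most `2 C ‖x‖`. So
  -- a time `ε` with `C ε ≤ 1/4` works for every `x`; the `+ 1` covers `C = 0`.
  have hloc : ∀ x ∈ ({0}ᶜ : Set E), ∃ α : ℝ → E, α 0 = x ∧
      ∀ t ∈ Ioo (-(1 / (4 * (C + 1)) : ℝ)) (1 / (4 * (C + 1))),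
        HasDerivAt α (Z (α t)) t ∧ α t ∈ ({0}ᶜ : Set E) := by
    intro x hx
    set ε : ℝ := 1 / (4 * (C + 1)) with hε
    have hε0 : 0 < ε := by positivity
    have hx' : 0 < ‖x‖ := norm_pos_iff.2 hx
    have hball : ∀ z ∈ Metric.closedBall x (‖x‖ / 2), z ≠ 0 ∧ ‖z‖ ≤ 2 * ‖x‖ := by
      intro z hz
      rw [mem_closedBall_iff_norm] at hz
      refine ⟨?_, ?_⟩
      · rintro rfl
        rw [zero_sub, norm_neg] at hz
        linarith
      · have := norm_sub_norm_le z x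
        linarith
    have hPL : IsPicardLindelof (fun _ => Z) (tmin := -ε) (tmax := ε)
        ⟨0, by constructor <;> linarith⟩ x (‖x‖₊ / 2) 0 (2 * C * ‖x‖₊) C :=
      { lipschitzOnWith := fun t _ => hLip.mono fun z hz => (hball z (by simpa using hz)).1
        continuousOn := fun _ _ => continuousOn_const
        norm_le := fun t _ z hz => by
          have := hball z (by simpa using hz)
          calc ‖Z z‖ ≤ C * ‖z‖ := hbd z this.1
            _ ≤ C * (2 * ‖x‖) := mul_le_mul_of_nonneg_left this.2 C.2
            _ = _ := by push_cast; ring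
        mul_max_le := by
          have h1 : (C : ℝ) * ε ≤ 1 / 4 := by
            rw [hε, mul_one_div, div_le_div_iff₀ (by positivity) (by norm_num)]
            linarith
          have : max (ε - 0) (0 - -ε) = ε := by simp
          simp only [this]
          push_cast
          nlinarith }
    obtain ⟨α, hα0, hα⟩ := exists_solution_mem_closedBall hPL
    exact ⟨α, hα0, fun t ht => ⟨(hα t (Ioo_subset_Icc_self ht)).1.hasDerivAt
      (Icc_mem_nhds ht.1 ht.2), (hball _ (by simpa using (hα t (Ioo_subset_Icc_self ht)).2)).1⟩⟩
  choose! ρ h0 hρ using fun x (hx : x ∈ ({0}ᶜ : Set E)) =>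
    exists_global_solution hLip (by positivity) hloc hx
  have hadd : ∀ s t, ∀ y ∈ ({0}ᶜ : Set E), ρ y (s + t) = ρ (ρ y t) s := fun s t y hy => by
    refine congrFun (ODE_solution_unique_univ (v := fun _ => Z) (s := fun _ => {0}ᶜ) (K := C)
      (f := fun s => ρ y (s + t)) (g := ρ (ρ y t)) (t₀ := 0) (fun _ => hLip)
      (fun r => ⟨(hρ y hy (r + t)).1.comp_add_const r t, (hρ y hy _).2⟩)
      (hρ _ (hρ y hy t).2) ?_) s
    simp [h0 _ (hρ y hy t).2]
  exact ⟨fun t y => ρ y t, h0, fun t y hy => (hρ y hy t).2, hadd, fun y hy t => (hρ y hy t).1,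
    flow_contDiffOn (ρ := fun t y => ρ y t) hopen hZ hLip h0 (fun t y hy => (hρ y hy t).2) hadd
      fun y hy t => (hρ y hy t).1⟩

end GlobalFlow

/-! ### Derivatives along left invariant vector fields. -/

section LeftDerivative

variable {EG : Type*} [NormedAddCommGroup EG] [NormedSpace ℝ EG]
  {G : Type*} [Group G] [TopologicalSpace G] [ChartedSpace EG G]
  {F : Type*} [NormedAddCommGroup F] [NormedSpace ℝ F]

variable (EG F) in
/-- The derivative of a map of manifolds at a point, as a linear map between the model spaces. -/
def modelDeriv {M N : Type*} [TopologicalSpace M] [ChartedSpace EG M] [TopologicalSpace N]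
    [ChartedSpace F N] (f : M → N) (x : M) : EG →L[ℝ] F :=
  mfderiv 𝓘(ℝ, EG) 𝓘(ℝ, F) f x

/-- The derivative of `f : G → F` at `g` along left invariant vector fields, as a linear map
on the Lie algebra. -/
def leftDeriv (f : G → F) (g : G) : EG →L[ℝ] F :=
  mfderiv 𝓘(ℝ, EG) 𝓘(ℝ, F) (fun h => f (g * h)) (1 : G)

/-- The curve `γ` in `G` has at time `t` the velocity `(L_{γ t})_* v`. -/
def HasLeftVelocityAt (γ : ℝ → G) (v : EG) (t : ℝ) : Prop :=
  HasMFDerivAt 𝓘(ℝ, ℝ) 𝓘(ℝ, EG) γ t ((1 : ℝ →L[ℝ] ℝ).smulRight (leftInv G v (γ t)))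

lemma leftDeriv_mul_left (f : G → F) (k g : G) :
    leftDeriv (EG := EG) (fun h => f (k * h)) g = leftDeriv f (k * g) := by
  have h : (fun h => f (k * (g * h))) = fun h => f (k * g * h) := by
    funext h
    rw [mul_assoc]
  exact congrArg (fun φ : G → F => modelDeriv EG F φ (1 : G)) h

variable [LieGroup 𝓘(ℝ, EG) ∞ G]

lemma hasMFDerivAt_leftMul (g h : G) :
    HasMFDerivAt 𝓘(ℝ, EG) 𝓘(ℝ, EG) (g * ·) h
      (mfderiv 𝓘(ℝ, EG) 𝓘(ℝ, EG) (g * ·) h) :=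
  (((contMDiff_mul_left (I := 𝓘(ℝ, EG)) (n := ∞) (a := g)).mdifferentiable (by simp)) h).hasMFDerivAt

lemma leftDeriv_apply {f : G → F} {g : G} (hf : MDifferentiableAt 𝓘(ℝ, EG) 𝓘(ℝ, F) f g) (v : EG) :
    leftDeriv f g v = mfderiv 𝓘(ℝ, EG) 𝓘(ℝ, F) f g (leftInv G v g) := by
  have hf' : HasMFDerivAt 𝓘(ℝ, EG) 𝓘(ℝ, F) f (g * 1) (mfderiv 𝓘(ℝ, EG) 𝓘(ℝ, F) f (g * 1)) := by
    rw [mul_one]; exact hf.hasMFDerivAt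
  have h := (HasMFDerivAt.comp (1 : G) hf' (hasMFDerivAt_leftMul g 1)).mfderiv
  have h2 := congrArg (fun L : EG →L[ℝ] F => L v) h
  have h3 : mfderiv 𝓘(ℝ, EG) 𝓘(ℝ, F) f (g * 1) = mfderiv 𝓘(ℝ, EG) 𝓘(ℝ, F) f g := by rw [mul_one]
  refine h2.trans ?_
  change (mfderiv 𝓘(ℝ, EG) 𝓘(ℝ, F) f (g * 1)) _ = _
  rw [h3]
  rfl

lemma HasLeftVelocityAt.hasDerivAt {f : G → F} {γ : ℝ → G} {v : EG} {t : ℝ}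
    (hγ : HasLeftVelocityAt γ v t) (hf : MDifferentiableAt 𝓘(ℝ, EG) 𝓘(ℝ, F) f (γ t)) :
    HasDerivAt (fun s => f (γ s)) (leftDeriv f (γ t) v) t := by
  have h := HasMFDerivAt.comp t hf.hasMFDerivAt hγ
  rw [leftDeriv_apply hf]
  have h2 : HasFDerivAt (fun s => f (γ s)) ((modelDeriv EG F f (γ t)).comp
      ((1 : ℝ →L[ℝ] ℝ).smulRight (show EG from leftInv G v (γ t)))) t :=
    hasMFDerivAt_iff_hasFDerivAt.1 h
  refine h2.hasDerivAt.congr_deriv ?_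
  change mfderiv 𝓘(ℝ, EG) 𝓘(ℝ, F) f (γ t) ((1 : ℝ) • leftInv G v (γ t)) = _
  exact congrArg _ (one_smul ℝ _)

lemma leftInv_mul (v : EG) (k g : G) :
    leftInv G v (k * g) = mfderiv 𝓘(ℝ, EG) 𝓘(ℝ, EG) (k * ·) g (leftInv G v g) := by
  have h := HasMFDerivAt.comp (1 : G) (hasMFDerivAt_leftMul (EG := EG) k (g * 1)) (hasMFDerivAt_leftMul g 1)
  have h2 : ((k * ·) ∘ (g * ·) : G → G) = (k * g * ·) := by
    funext x; simp [mul_assoc]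
  rw [h2] at h
  have h3 := congrArg (fun L : EG →L[ℝ] EG => L v) h.mfderiv
  have h4 : modelDeriv EG EG (k * ·) (g * 1) = modelDeriv EG EG (k * ·) g := by rw [mul_one]
  exact h3.trans (congrArg (fun L : EG →L[ℝ] EG => L (leftInv G v g)) h4)

lemma HasLeftVelocityAt.mul_left {γ : ℝ → G} {v : EG} {t : ℝ}
    (hγ : HasLeftVelocityAt γ v t) (k : G) : HasLeftVelocityAt (fun s => k * γ s) v t := by
  refine (HasMFDerivAt.comp t (hasMFDerivAt_leftMul k (γ t)) hγ).congr_mfderiv ?_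
  ext
  change mfderiv 𝓘(ℝ, EG) 𝓘(ℝ, EG) (k * ·) (γ t) ((1 : ℝ) • leftInv G v (γ t))
    = (1 : ℝ) • leftInv G v (k * γ t)
  rw [leftInv_mul, map_smul]

/-- `leftDeriv f x` is the partial derivative of the smooth map `(x, h) ↦ f (x * h)` in `h` at the
fixed point `1`. As this base point is constant and the target is a vector space, the coordinate
changes of the tangent bundles are identities. -/
lemma contMDiffAt_leftDeriv {f : G → F} {g : G} (hf : ContMDiffAt 𝓘(ℝ, EG) 𝓘(ℝ, F) ∞ f g) :
    ContMDiffAt 𝓘(ℝ, EG) 𝓘(ℝ, EG →L[ℝ] F) ∞ (leftDeriv (EG := EG) f) g := by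
  have h1 : ContMDiffAt (𝓘(ℝ, EG).prod 𝓘(ℝ, EG)) 𝓘(ℝ, F) ∞
      (Function.uncurry fun x h : G => f (x * h)) (g, 1) :=
    ContMDiffAt.comp_of_eq (f := fun p : G × G => p.1 * p.2) (g := f) hf
      (contMDiff_mul 𝓘(ℝ, EG) ∞).contMDiffAt (mul_one g)
  have h2 := ContMDiffAt.mfderiv (m := ∞) (fun x h : G => f (x * h)) (fun _ => 1) h1
    contMDiffAt_const (by simp)
  refine h2.congr_of_eventuallyEq (Filter.Eventually.of_forall fun x => ?_)
  refine Eq.symm ((inTangentCoordinates_eq (I := 𝓘(ℝ, EG)) (I' := 𝓘(ℝ, F)) (fun _ : G => (1 : G))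
    (fun x => f (x * 1)) (fun x => (mfderiv 𝓘(ℝ, EG) 𝓘(ℝ, F) (fun h => f (x * h)) (1 : G)
      : EG →L[ℝ] F)) (x₀ := g) (x := x) (mem_chart_source _ _) (by simp only [chartAt_self_eq, OpenPartialHomeomorph.refl_source, mem_univ])).trans ?_)
  ext v
  have e1 := (tangentBundleCore 𝓘(ℝ, EG) G).coordChange_self (achart EG (1 : G)) 1
    (mem_chart_source EG (1 : G)) v
  have e2 := tangentBundleCore_coordChange_model_space (I := 𝓘(ℝ, F)) (f (x * 1)) (f (g * 1))
    (f (x * 1))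
  rw [e2]
  exact congrArg (leftDeriv f x) e1

/-- The derivative of `leftDeriv f (γ s) (u s)` along a curve. -/
lemma HasLeftVelocityAt.hasDerivAt_leftDeriv {f : G → F} {γ : ℝ → G} {v : EG} {t : ℝ}
    (hγ : HasLeftVelocityAt γ v t) (hf : ContMDiffAt 𝓘(ℝ, EG) 𝓘(ℝ, F) ∞ f (γ t))
    {u : ℝ → EG} {u' : EG} (hu : HasDerivAt u u' t) :
    HasDerivAt (fun s => leftDeriv f (γ s) (u s))
      (leftDeriv (leftDeriv (EG := EG) f) (γ t) v (u t) + leftDeriv f (γ t) u') t :=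
  (hγ.hasDerivAt ((contMDiffAt_leftDeriv hf).mdifferentiableAt (by simp))).clm_apply hu

lemma leftDeriv_extChartAt_one :
    leftDeriv (EG := EG) (extChartAt 𝓘(ℝ, EG) (1 : G)) 1 = ContinuousLinearMap.id ℝ EG := by
  have h : (fun h : G => extChartAt 𝓘(ℝ, EG) (1 : G) (1 * h)) = extChartAt 𝓘(ℝ, EG) (1 : G) := by
    funext h
    rw [one_mul]
  exact (congrArg (fun φ : G → EG => modelDeriv EG EG φ (1 : G)) h).trans
    (mfderiv_extChartAt_self (I := 𝓘(ℝ, EG)) (x := (1 : G)))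

/-- `leftDeriv` in a chart of `G`. -/
lemma leftDeriv_eq_fderiv_comp {f : G → F} {g₀ g : G}
    (hg : g ∈ (extChartAt 𝓘(ℝ, EG) g₀).source)
    (hf : MDifferentiableAt 𝓘(ℝ, EG) 𝓘(ℝ, F) f g) :
    leftDeriv (EG := EG) f g = (fderiv ℝ (f ∘ (extChartAt 𝓘(ℝ, EG) g₀).symm) (extChartAt 𝓘(ℝ, EG) g₀ g)).comp
      (leftDeriv (extChartAt 𝓘(ℝ, EG) g₀) g) := by
  set χ := extChartAt 𝓘(ℝ, EG) g₀ with hχ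
  have hχd : MDifferentiableAt 𝓘(ℝ, EG) 𝓘(ℝ, EG) χ g :=
    mdifferentiableAt_extChartAt (by simpa [hχ] using hg)
  have hsymm : MDifferentiableAt 𝓘(ℝ, EG) 𝓘(ℝ, EG) χ.symm (χ g) := by
    have := mdifferentiableWithinAt_extChartAt_symm (I := 𝓘(ℝ, EG)) (x := g₀) (z := χ g)
      (χ.map_source hg)
    rwa [modelWithCornersSelf_coe, range_id, mdifferentiableWithinAt_univ] at this
  have hfs : MDifferentiableAt 𝓘(ℝ, EG) 𝓘(ℝ, F) (f ∘ χ.symm) (χ g) := by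
    refine MDifferentiableAt.comp (χ g) ?_ hsymm
    rwa [χ.left_inv hg]
  have hev : f =ᶠ[𝓝 g] (f ∘ χ.symm) ∘ χ := by
    filter_upwards [(isOpen_extChartAt_source (I := 𝓘(ℝ, EG)) g₀).mem_nhds hg] with x hx
    simp [χ.left_inv hx]
  ext v
  rw [leftDeriv_apply hf, ContinuousLinearMap.comp_apply, leftDeriv_apply hχd, ← mfderiv_eq_fderiv]
  have h := (HasMFDerivAt.comp g hfs.hasMFDerivAt hχd.hasMFDerivAt).congr_of_eventuallyEq hev
  exact congrArg (fun L : EG →L[ℝ] F => L (leftInv G v g)) h.mfderiv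

end LeftDerivative

/-! ### The Lie bracket as a commutator of left derivatives. -/

section Bracket

lemma one_le_infty : (1 : WithTop ℕ∞) ≤ ∞ := by exact_mod_cast le_top

lemma two_le_infty : (2 : WithTop ℕ∞) ≤ ∞ :=
  WithTop.coe_le_coe.2 (le_top : (2 : ℕ∞) ≤ ⊤)

variable {EG : Type*} [NormedAddCommGroup EG] [NormedSpace ℝ EG]
  {G : Type*} [Group G] [TopologicalSpace G] [ChartedSpace EG G]
  {F : Type*} [NormedAddCommGroup F] [NormedSpace ℝ F]
  [LieGroup 𝓘(ℝ, EG) ∞ G]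

lemma contDiffOn_leftDeriv_extChartAt (g₀ : G) :
    ContDiffOn ℝ ∞ (fun z => leftDeriv (EG := EG) (extChartAt 𝓘(ℝ, EG) g₀)
      ((extChartAt 𝓘(ℝ, EG) g₀).symm z)) (extChartAt 𝓘(ℝ, EG) g₀).target := by
  have h1 : ContMDiffOn 𝓘(ℝ, EG) 𝓘(ℝ, EG →L[ℝ] EG) ∞
      (leftDeriv (EG := EG) (F := EG) (extChartAt 𝓘(ℝ, EG) g₀))
      (extChartAt 𝓘(ℝ, EG) g₀).source := by
    intro g hg
    have hg' : g ∈ (chartAt EG g₀).source := by simpa using hg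
    have h : ContMDiffAt 𝓘(ℝ, EG) 𝓘(ℝ, EG) ∞ (extChartAt 𝓘(ℝ, EG) g₀) g :=
      contMDiffAt_extChartAt' hg'
    exact (contMDiffAt_leftDeriv (EG := EG) (F := EG) h).contMDiffWithinAt
  have h2 : ContMDiffOn 𝓘(ℝ, EG) 𝓘(ℝ, EG) ∞ (extChartAt 𝓘(ℝ, EG) g₀).symm
      (extChartAt 𝓘(ℝ, EG) g₀).target := contMDiffOn_extChartAt_symm (n := ∞) g₀
  exact contMDiffOn_iff_contDiffOn.1
    (h1.comp h2 fun z hz => (extChartAt 𝓘(ℝ, EG) g₀).map_target hz)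

/-- In the chart `χ` at `1` the left invariant field of `v` reads `z ↦ L z v` with `L (χ 1) = id`,
so the bracket is the vector space bracket of two such fields. -/
lemma lieBr_eq [CompleteSpace EG] (v w : EG) :
    lieBr G v w = leftDeriv (leftDeriv (EG := EG) (extChartAt 𝓘(ℝ, EG) (1 : G))) 1 v w
      - leftDeriv (leftDeriv (EG := EG) (extChartAt 𝓘(ℝ, EG) (1 : G))) 1 w v := by
  set χ := extChartAt 𝓘(ℝ, EG) (1 : G) with hχ
  set L : EG → EG →L[ℝ] EG := fun z => leftDeriv χ (χ.symm z) with hL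
  have htgt : χ.target ∈ 𝓝 (χ 1) := extChartAt_target_mem_nhds (1 : G)
  have hsrc : (1 : G) ∈ χ.source := mem_extChartAt_source (1 : G)
  have hLd : DifferentiableAt ℝ L (χ 1) :=
    ((contDiffOn_leftDeriv_extChartAt (1 : G)).contDiffAt htgt).differentiableAt (by simp)
  have hχc : ContMDiffAt 𝓘(ℝ, EG) 𝓘(ℝ, EG) ∞ χ 1 := contMDiffAt_extChartAt
  have hLL : leftDeriv (leftDeriv (EG := EG) χ) 1 = fderiv ℝ L (χ 1) := by
    rw [leftDeriv_eq_fderiv_comp (EG := EG) (g₀ := (1 : G)) hsrc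
      ((contMDiffAt_leftDeriv hχc).mdifferentiableAt (by simp)), leftDeriv_extChartAt_one]
    rfl
  rw [hLL]
  let A : EG → EG → EG := fun v => VectorField.mpullbackWithin 𝓘(ℝ, EG) 𝓘(ℝ, EG) χ.symm
    (mulInvariantVectorField (I := 𝓘(ℝ, EG)) (G := G) (show GroupLieAlgebra 𝓘(ℝ, EG) G from v))
    (range 𝓘(ℝ, EG))
  have hpull : ∀ v : EG, A v =ᶠ[𝓝 (χ 1)] fun z => L z v := by
    intro v
    filter_upwards [htgt] with z hz
    have hzs : χ.symm z ∈ (chartAt EG (1 : G)).source := by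
      simpa [hχ] using χ.map_target hz
    have h1 := mfderiv_extChartAt_comp_mfderivWithin_extChartAt_symm (I := 𝓘(ℝ, EG)) hz
    have h2 := mfderivWithin_extChartAt_symm_comp_mfderiv_extChartAt (I := 𝓘(ℝ, EG)) hz
    have h3 := ContinuousLinearMap.inverse_eq h2 h1
    exact (congrArg (fun D : EG →L[ℝ] EG => D (leftInv G v (χ.symm z))) h3).trans
      (leftDeriv_apply (EG := EG) (f := χ) (mdifferentiableAt_extChartAt hzs) v).symm
  have key : lieBr G v w = (modelDeriv EG EG χ (1 : G)).inverse
      (VectorField.lieBracket ℝ (fun z => L z v) (fun z => L z w) (χ 1)) := by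
    have huniv : (χ.symm ⁻¹' univ ∩ range 𝓘(ℝ, EG)) = univ := by simp
    have h1 : lieBr G v w = (modelDeriv EG EG χ (1 : G)).inverse
      (VectorField.lieBracketWithin ℝ (A v) (A w) (χ.symm ⁻¹' univ ∩ range 𝓘(ℝ, EG)) (χ 1)) := rfl
    rw [h1, huniv, VectorField.lieBracketWithin_univ,
      (hpull v).lieBracket_vectorField_eq (hpull w)]
  have hid : modelDeriv EG EG χ (1 : G) = ContinuousLinearMap.id ℝ EG :=
    mfderiv_extChartAt_self (I := 𝓘(ℝ, EG)) (x := (1 : G))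
  have hL1 : L (χ 1) = ContinuousLinearMap.id ℝ EG := by
    simp only [hL, χ.left_inv hsrc]
    exact leftDeriv_extChartAt_one
  have hfd : ∀ v : EG, fderiv ℝ (fun z => L z v) (χ 1) = (fderiv ℝ L (χ 1)).flip v := by
    intro v
    have := (hLd.hasFDerivAt.clm_apply (hasFDerivAt_const v (χ 1))).fderiv
    rw [this]
    ext
    simp
  rw [key, hid, ContinuousLinearMap.inverse_id, VectorField.lieBracket, hfd, hfd, hL1]
  simp

/-- With `fh = f ∘ χ.symm`, the second left derivative at `1` is the Hessian of `fh` plus `D fh (DL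
v w)`. The Hessian is symmetric and cancels; the rest is the bracket by `lieBr_eq`. -/
lemma leftDeriv_leftDeriv_sub [CompleteSpace EG] {f : G → F}
    (hf : ContMDiffAt 𝓘(ℝ, EG) 𝓘(ℝ, F) ∞ f 1) (v w : EG) :
    leftDeriv (leftDeriv (EG := EG) f) 1 v w - leftDeriv (leftDeriv (EG := EG) f) 1 w v
      = leftDeriv f 1 (lieBr G v w) := by
  rw [lieBr_eq]
  set χ := extChartAt 𝓘(ℝ, EG) (1 : G) with hχ
  set L : EG → EG →L[ℝ] EG := fun z => leftDeriv χ (χ.symm z) with hL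
  set fh : EG → F := f ∘ χ.symm with hfh
  have htgt : χ.target ∈ 𝓝 (χ 1) := extChartAt_target_mem_nhds (1 : G)
  have hsrc : (1 : G) ∈ χ.source := mem_extChartAt_source (1 : G)
  have hLd : DifferentiableAt ℝ L (χ 1) :=
    ((contDiffOn_leftDeriv_extChartAt (1 : G)).contDiffAt htgt).differentiableAt (by simp)
  have hχc : ContMDiffAt 𝓘(ℝ, EG) 𝓘(ℝ, EG) ∞ χ 1 := contMDiffAt_extChartAt
  have hL1 : leftDeriv (EG := EG) χ 1 = ContinuousLinearMap.id ℝ EG := leftDeriv_extChartAt_one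
  have hfhc : ContDiffAt ℝ ∞ fh (χ 1) := by
    rw [← contMDiffAt_iff_contDiffAt]
    have h1 : ContMDiffAt 𝓘(ℝ, EG) 𝓘(ℝ, EG) ∞ χ.symm (χ 1) :=
      (contMDiffOn_extChartAt_symm (1 : G)).contMDiffAt htgt
    exact ContMDiffAt.comp (χ 1) (by rwa [χ.left_inv hsrc]) h1
  have hfhd : DifferentiableAt ℝ (fderiv ℝ fh) (χ 1) :=
    (hfhc.fderiv_right (m := 1) (by norm_num; exact two_le_infty)).differentiableAt (by simp)
  have hLL : leftDeriv (leftDeriv (EG := EG) χ) 1 = fderiv ℝ L (χ 1) := by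
    rw [leftDeriv_eq_fderiv_comp (EG := EG) (g₀ := (1 : G)) hsrc
      ((contMDiffAt_leftDeriv hχc).mdifferentiableAt (by simp)), ← hχ, hL1]
    rfl
  have hfirst : ∀ᶠ g in 𝓝 (1 : G), leftDeriv (EG := EG) f g
      = (fderiv ℝ fh (χ g)).comp (leftDeriv χ g) := by
    filter_upwards [(isOpen_extChartAt_source (I := 𝓘(ℝ, EG)) (1 : G)).mem_nhds hsrc,
      ((contMDiffAt_iff_contMDiffAt_nhds (by simp)).1 (hf.of_le one_le_infty))] with g hg hfg
    exact leftDeriv_eq_fderiv_comp hg (hfg.mdifferentiableAt (by simp))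
  have hsecond : ∀ v w, leftDeriv (leftDeriv (EG := EG) f) 1 v w
      = fderiv ℝ (fderiv ℝ fh) (χ 1) v w + fderiv ℝ fh (χ 1) (fderiv ℝ L (χ 1) v w) := by
    intro v w
    rw [leftDeriv_eq_fderiv_comp (EG := EG) (g₀ := (1 : G)) hsrc
      ((contMDiffAt_leftDeriv hf).mdifferentiableAt (by simp)), ← hχ, hL1]
    have hev : leftDeriv (EG := EG) f ∘ χ.symm =ᶠ[𝓝 (χ 1)] fun z => (fderiv ℝ fh z).comp (L z) := by
      have hc : Filter.Tendsto χ.symm (𝓝 (χ 1)) (𝓝 1) := by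
        have := continuousAt_extChartAt_symm (I := 𝓘(ℝ, EG)) (1 : G)
        rw [ContinuousAt, ← hχ, χ.left_inv hsrc] at this
        exact this
      filter_upwards [hc.eventually hfirst, htgt] with z hz hzt
      simp only [Function.comp_apply, hz, χ.right_inv hzt, hL]
    rw [hev.fderiv_eq, (hfhd.hasFDerivAt.clm_comp hLd.hasFDerivAt).fderiv]
    have hL1' : L (χ 1) = ContinuousLinearMap.id ℝ EG := by
      simp only [hL, χ.left_inv hsrc, hL1]
    simp [hL1', add_comm]
  have hf1 : leftDeriv (EG := EG) f 1 = fderiv ℝ fh (χ 1) := by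
    rw [hfirst.self_of_nhds, hL1, ContinuousLinearMap.comp_id]
  have hsymm : fderiv ℝ (fderiv ℝ fh) (χ 1) v w = fderiv ℝ (fderiv ℝ fh) (χ 1) w v :=
    (hfhc.isSymmSndFDerivAt (by simpa using two_le_infty)).eq v w
  rw [hsecond, hsecond, hf1, hLL, hsymm, map_sub]
  abel

/-- The second left invariant derivatives of a function commute up to the bracket. -/
lemma leftDeriv_leftDeriv_sub_at [CompleteSpace EG] {f : G → F} {g : G}
    (hf : ContMDiffAt 𝓘(ℝ, EG) 𝓘(ℝ, F) ∞ f g) (v w : EG) :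
    leftDeriv (leftDeriv (EG := EG) f) g v w - leftDeriv (leftDeriv (EG := EG) f) g w v
      = leftDeriv f g (lieBr G v w) := by
  have hf' : ContMDiffAt 𝓘(ℝ, EG) 𝓘(ℝ, F) ∞ (fun h => f (g * h)) 1 :=
    ContMDiffAt.comp_of_eq (f := fun h => g * h) (g := f) hf contMDiff_mul_left.contMDiffAt (mul_one g)
  have h := leftDeriv_leftDeriv_sub hf' v w
  have h1 : leftDeriv (EG := EG) (fun h => f (g * h)) = fun h => leftDeriv f (g * h) := by
    funext h
    exact leftDeriv_mul_left f g h
  rw [h1, leftDeriv_mul_left, mul_one] at h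
  simpa only [mul_one] using h

end Bracket

/-! ### Curves in `G` with prescribed left velocity. -/

section Curves

variable {EG : Type*} [NormedAddCommGroup EG] [NormedSpace ℝ EG]
  {G : Type*} [Group G] [TopologicalSpace G] [ChartedSpace EG G]
  [LieGroup 𝓘(ℝ, EG) ∞ G]

lemma hasMFDerivAt_extChartAt_symm {M : Type*} [TopologicalSpace M] [ChartedSpace EG M]
    [IsManifold 𝓘(ℝ, EG) ∞ M] {g₀ : M} {z : EG} (hz : z ∈ (extChartAt 𝓘(ℝ, EG) g₀).target) :
    MDifferentiableAt 𝓘(ℝ, EG) 𝓘(ℝ, EG) (extChartAt 𝓘(ℝ, EG) g₀).symm z := by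
  have := mdifferentiableWithinAt_extChartAt_symm (I := 𝓘(ℝ, EG)) (x := g₀) (z := z) hz
  rwa [modelWithCornersSelf_coe, range_id, mdifferentiableWithinAt_univ] at this

/-- A curve in a chart of `G` satisfying the equation of left velocity in coordinates. -/
lemma hasLeftVelocityAt_of_hasDerivAt_chart {g₀ : G} {z : ℝ → EG} {v : EG} {t : ℝ}
    (hz : z t ∈ (extChartAt 𝓘(ℝ, EG) g₀).target)
    (hd : HasDerivAt z (leftDeriv (extChartAt 𝓘(ℝ, EG) g₀)
      ((extChartAt 𝓘(ℝ, EG) g₀).symm (z t)) v) t) :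
    HasLeftVelocityAt (fun s => (extChartAt 𝓘(ℝ, EG) g₀).symm (z s)) v t := by
  set χ := extChartAt 𝓘(ℝ, EG) g₀ with hχ
  have hsymm : MDifferentiableAt 𝓘(ℝ, EG) 𝓘(ℝ, EG) χ.symm (z t) := hasMFDerivAt_extChartAt_symm hz
  have hzs : χ.symm (z t) ∈ (chartAt EG g₀).source := by simpa [hχ] using χ.map_target hz
  have hmz : HasMFDerivAt 𝓘(ℝ, ℝ) 𝓘(ℝ, EG) z t _ := hd.hasFDerivAt.hasMFDerivAt
  refine (HasMFDerivAt.comp t hsymm.hasMFDerivAt hmz).congr_mfderiv ?_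
  have h2 := mfderivWithin_extChartAt_symm_comp_mfderiv_extChartAt (I := 𝓘(ℝ, EG)) hz
  rw [modelWithCornersSelf_coe, range_id, mfderivWithin_univ] at h2
  have h3 := congrArg (fun D : EG →L[ℝ] EG => D (leftInv G v (χ.symm (z t)))) h2
  have h4 : leftDeriv χ (χ.symm (z t)) v = modelDeriv EG EG χ (χ.symm (z t)) (leftInv G v (χ.symm (z t))) :=
    leftDeriv_apply (EG := EG) (f := χ) (mdifferentiableAt_extChartAt hzs) v
  ext
  change modelDeriv EG EG χ.symm (z t) ((1 : ℝ) • leftDeriv χ (χ.symm (z t)) v)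
    = (1 : ℝ) • (show EG from leftInv G v (χ.symm (z t)))
  rw [one_smul, one_smul, h4]
  exact h3

/-- A curve with smooth left velocity is smooth. -/
lemma contMDiffOn_of_hasLeftVelocityAt [CompleteSpace EG] {γ : ℝ → G} {u : ℝ → EG} {J : Set ℝ} (hJ : IsOpen J)
    (hu : ContDiffOn ℝ ∞ u J) (hγ : ∀ t ∈ J, HasLeftVelocityAt γ (u t) t) :
    ContMDiffOn 𝓘(ℝ, ℝ) 𝓘(ℝ, EG) ∞ γ J := by
  intro t₀ ht₀
  refine ContMDiffAt.contMDiffWithinAt ?_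
  set χ := extChartAt 𝓘(ℝ, EG) (γ t₀) with hχ
  have hc : ContinuousAt γ t₀ := (hγ t₀ ht₀).continuousAt
  have hnb : J ∩ γ ⁻¹' χ.source ∈ 𝓝 t₀ :=
    Filter.inter_mem (hJ.mem_nhds ht₀) (hc (extChartAt_source_mem_nhds (γ t₀)))
  obtain ⟨ε, hε, hεs⟩ := Metric.nhds_basis_closedBall.mem_iff.1 hnb
  rw [Real.closedBall_eq_Icc] at hεs
  have hz : ContDiffOn ℝ ∞ (χ ∘ γ) (Icc (t₀ - ε) (t₀ + ε)) := by
    -- In a chart the curve solves an ODE with smooth right-hand side, so its regularity bootstraps.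
    refine ODE.contDiffOn_enat_Icc_of_hasDerivWithinAt (n := ⊤) (u := χ.target)
      (f := fun t z => leftDeriv χ (χ.symm z) (u t)) ?_ (fun t ht => ?_)
      (fun t ht => χ.map_source (hεs ht).2)
    · refine ContDiffOn.clm_apply
        (f := fun q : ℝ × EG => leftDeriv (EG := EG) χ (χ.symm q.2)) (g := fun q : ℝ × EG => u q.1) ?_ ?_
      · exact (contDiffOn_leftDeriv_extChartAt (γ t₀)).comp contDiff_snd.contDiffOn
          (fun q hq => hq.2)
      · exact hu.comp contDiff_fst.contDiffOn (fun q hq => (hεs hq.1).1)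
    · have h := (hγ t (hεs ht).1).hasDerivAt (f := χ)
        (mdifferentiableAt_extChartAt (by simpa [hχ] using (hεs ht).2))
      simp only [Function.comp_apply, χ.left_inv (hεs ht).2]
      exact h.hasDerivWithinAt
  have hz' : ContMDiffAt 𝓘(ℝ, ℝ) 𝓘(ℝ, EG) ∞ (χ ∘ γ) t₀ :=
    (hz.contDiffAt (Icc_mem_nhds (by linarith) (by linarith))).contMDiffAt
  have hs : ContMDiffAt 𝓘(ℝ, EG) 𝓘(ℝ, EG) ∞ χ.symm (χ (γ t₀)) :=
    (contMDiffOn_extChartAt_symm (γ t₀)).contMDiffAt (extChartAt_target_mem_nhds (γ t₀))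
  refine (ContMDiffAt.comp t₀ hs hz').congr_of_eventuallyEq ?_
  filter_upwards [hnb] with t ht
  simp [χ.left_inv ht.2]

/-- Local solutions of the equations `u' = ζ(u)`, `γ⁻¹ γ' = u`. -/
lemma exists_curve_of_velocity_equation [CompleteSpace EG] {V : Type*} [NormedAddCommGroup V] [NormedSpace ℝ V]
    [CompleteSpace V] (A : V →L[ℝ] EG) {ζ : V → V} {U : Set V} (hU : IsOpen U)
    (hζ : ContDiffOn ℝ ∞ ζ U) {y : V} (hy : y ∈ U) :
    ∃ (ε : ℝ) (γ : ℝ → G) (u : ℝ → V), 0 < ε ∧ γ 0 = 1 ∧ u 0 = y ∧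
      ContMDiffOn 𝓘(ℝ, ℝ) 𝓘(ℝ, EG) ∞ γ (Ioo (-ε) ε) ∧ ContDiffOn ℝ ∞ u (Ioo (-ε) ε) ∧
      ∀ t ∈ Ioo (-ε) ε, u t ∈ U ∧ HasDerivAt u (ζ (u t)) t ∧ HasLeftVelocityAt γ (A (u t)) t := by
  set χ := extChartAt 𝓘(ℝ, EG) (1 : G) with hχ
  have hsrc : (1 : G) ∈ χ.source := mem_extChartAt_source (1 : G)
  have htgt : χ 1 ∈ χ.target := χ.map_source hsrc
  have hot : IsOpen χ.target := isOpen_extChartAt_target (1 : G)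
  -- In the chart at `1` the two equations form one autonomous system whose second component drives
  -- the first.
  let X : EG × V → EG × V := fun q => (leftDeriv χ (χ.symm q.1) (A q.2), ζ q.2)
  have hX : ContDiffOn ℝ ∞ X (χ.target ×ˢ U) := by
    refine ContDiffOn.prodMk (ContDiffOn.clm_apply
        (f := fun q : EG × V => leftDeriv (EG := EG) χ (χ.symm q.1)) (g := fun q : EG × V => A q.2) ?_ ?_) ?_
    · exact (contDiffOn_leftDeriv_extChartAt (1 : G)).comp contDiff_fst.contDiffOn (fun q hq => hq.1)
    · exact (A.contDiff.comp contDiff_snd).contDiffOn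
    · exact hζ.comp contDiff_snd.contDiffOn (fun q hq => hq.2)
  have hopen : IsOpen (χ.target ×ˢ U) := hot.prod hU
  have hX1 : ContDiffAt ℝ 1 X (χ 1, y) :=
    (hX.contDiffAt (hopen.mem_nhds ⟨htgt, hy⟩)).of_le one_le_infty
  obtain ⟨α, hα0, ε₁, hε₁, hα⟩ :=
    hX1.exists_forall_mem_closedBall_exists_eq_forall_mem_Ioo_hasDerivAt₀ 0
  have hα0' : α 0 ∈ χ.target ×ˢ U := by rw [hα0]; exact ⟨htgt, hy⟩
  have hnb : α ⁻¹' (χ.target ×ˢ U) ∩ Ioo (0 - ε₁) (0 + ε₁) ∈ 𝓝 (0 : ℝ) :=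
    Filter.inter_mem ((hα 0 (by simpa using hε₁)).continuousAt (hopen.mem_nhds hα0'))
      (Ioo_mem_nhds (by linarith) (by linarith))
  obtain ⟨ε, hε, hεs⟩ := Metric.nhds_basis_ball.mem_iff.1 hnb
  rw [Real.ball_eq_Ioo, zero_sub, zero_add] at hεs
  have hu : ∀ t ∈ Ioo (-ε) ε, HasDerivAt (fun s => (α s).2) (ζ (α t).2) t := fun t ht =>
    (hα t (hεs ht).2).snd
  have hγ : ∀ t ∈ Ioo (-ε) ε, HasLeftVelocityAt (fun s => χ.symm (α s).1) (A (α t).2) t :=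
    fun t ht => hasLeftVelocityAt_of_hasDerivAt_chart (hεs ht).1.1 (hα t (hεs ht).2).fst
  have hus : ContDiffOn ℝ ∞ (fun s => (α s).2) (Ioo (-ε) ε) := by
    intro t ht
    obtain ⟨a, ha, hat⟩ := exists_between ht.1
    obtain ⟨b, hb, hbt⟩ := exists_between ht.2
    have hsub : Icc a b ⊆ Ioo (-ε) ε := fun s hs => ⟨ha.trans_le hs.1, hs.2.trans_lt hbt⟩
    have := ODE.contDiffOn_enat_Icc_of_hasDerivWithinAt (n := ⊤) (u := U) (tmin := a) (tmax := b)
      (f := fun _ y => ζ y) (α := fun s => (α s).2)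
      (hζ.comp contDiff_snd.contDiffOn (fun q hq => hq.2))
      (fun t ht => (hu t (hsub ht)).hasDerivWithinAt) (fun t ht => (hεs (hsub ht)).1.2)
    exact (this.contDiffAt (Icc_mem_nhds hat hb)).contDiffWithinAt
  refine ⟨ε, fun s => χ.symm (α s).1, fun s => (α s).2, hε, by simp only [hα0]; exact χ.left_inv hsrc,
    by simp only [hα0], ?_, hus, fun t ht => ⟨(hεs ht).1.2, hu t ht, hγ t ht⟩⟩
  exact contMDiffOn_of_hasLeftVelocityAt isOpen_Ioo (A.contDiff.comp_contDiffOn hus) hγ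

/-! ### The exponential map and one-parameter subgroups. -/

section Exp

omit [LieGroup 𝓘(ℝ, EG) ∞ G] in
lemma leftInv_smul (a : ℝ) (v : EG) : leftInv G (a • v) = a • leftInv G v :=
  funext fun g => map_smul (modelDeriv EG EG (g * ·) (1 : G)) a v

lemma contMDiff_leftInv (v : EG) : ContMDiff 𝓘(ℝ, EG) 𝓘(ℝ, EG).tangent 1
    (fun g : G => (⟨g, leftInv G v g⟩ : TangentBundle 𝓘(ℝ, EG) G)) := by
  have : LieGroup 𝓘(ℝ, EG) (minSmoothness ℝ 3) G := by
    rw [minSmoothness_of_isRCLikeNormedField]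
    exact LieGroup.of_le (n := ∞) (WithTop.coe_le_coe.2 (le_top : (3 : ℕ∞) ≤ ⊤))
  exact (contMDiff_mulInvariantVectorField (I := 𝓘(ℝ, EG)) (G := G)
    (show GroupLieAlgebra 𝓘(ℝ, EG) G from v)).of_le (by
      rw [minSmoothness_of_isRCLikeNormedField]; exact one_le_two)

variable [CompleteSpace EG] [T2Space G]

omit [CompleteSpace EG] in
/-- Curves with constant left velocity are determined by their initial point. -/
lemma eq_of_hasLeftVelocityAt {γ₁ γ₂ : ℝ → G} {v : EG} (h₁ : ∀ t, HasLeftVelocityAt γ₁ v t)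
    (h₂ : ∀ t, HasLeftVelocityAt γ₂ v t) (h : γ₁ 0 = γ₂ 0) : γ₁ = γ₂ :=
  isMIntegralCurve_Ioo_eq_of_contMDiff_boundaryless (I := 𝓘(ℝ, EG)) (t₀ := 0)
    (v := leftInv G v) (contMDiff_leftInv v) h₁ h₂ h

/-- Left translates of a local integral curve at `1` give integral curves through every point for
the same time, hence a global one. -/
lemma exists_hasLeftVelocityAt (v : EG) :
    ∃ γ : ℝ → G, γ 0 = 1 ∧ ∀ t, HasLeftVelocityAt γ v t := by
  obtain ⟨γ, hγ0, hγ⟩ := exists_isMIntegralCurveAt_of_contMDiffAt_boundaryless (I := 𝓘(ℝ, EG))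
    (v := leftInv G v) 0 (contMDiff_leftInv v).contMDiffAt (x₀ := (1 : G))
  obtain ⟨ε, hε, hγε⟩ := Metric.eventually_nhds_iff_ball.1 hγ
  refine exists_isMIntegralCurve_of_isMIntegralCurveOn (I := 𝓘(ℝ, EG)) (v := leftInv G v)
    (contMDiff_leftInv v) hε (fun x => ⟨fun s => x * γ s, by simp only [hγ0, mul_one], fun t ht => ?_⟩) 1
  have h1 : HasLeftVelocityAt γ v t := hγε t (by
    rw [Real.ball_eq_Ioo]; simpa using ht)
  exact (h1.mul_left x).hasMFDerivWithinAt

/-- `lieExp` picks its value through some integral curve; uniqueness forces that curve to be `s ↦ γ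
(s * a)`. -/
lemma lieExp_smul {γ : ℝ → G} {v : EG} (h0 : γ 0 = 1) (hγ : ∀ t, HasLeftVelocityAt γ v t) (a : ℝ) :
    lieExp G (a • v) = γ a := by
  have h : ∃ g : G, ∃ δ : ℝ → G, δ 0 = 1 ∧
      IsMIntegralCurve (I := 𝓘(ℝ, EG)) δ (leftInv G (a • v)) ∧ δ 1 = g := by
    refine ⟨γ a, fun s => γ (s * a), by simpa using h0, ?_, by simp⟩
    have := IsMIntegralCurve.comp_mul (I := 𝓘(ℝ, EG)) (γ := γ) (v := leftInv G v) hγ a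
    rw [leftInv_smul]
    exact this
  obtain ⟨δ, hδ0, hδ, hδ1⟩ := Classical.epsilon_spec h
  have hγa : IsMIntegralCurve (I := 𝓘(ℝ, EG)) (fun s => γ (s * a)) (leftInv G (a • v)) := by
    have := IsMIntegralCurve.comp_mul (I := 𝓘(ℝ, EG)) (γ := γ) (v := leftInv G v) hγ a
    rw [leftInv_smul]
    exact this
  have he : δ = fun s => γ (s * a) := eq_of_hasLeftVelocityAt hδ hγa (by simp [hδ0, h0])
  have : lieExp G (a • v) = δ 1 := hδ1.symm
  rw [this, he]
  simp

lemma lieExp_hasLeftVelocityAt (v : EG) (t : ℝ) :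
    HasLeftVelocityAt (fun s : ℝ => lieExp G (s • v)) v t := by
  obtain ⟨γ, h0, hγ⟩ := exists_hasLeftVelocityAt (G := G) v
  have : (fun s : ℝ => lieExp G (s • v)) = γ := funext fun s => lieExp_smul h0 hγ s
  rw [this]
  exact hγ t

lemma lieExp_zero_smul (v : EG) : lieExp G ((0 : ℝ) • v) = 1 := by
  obtain ⟨γ, h0, hγ⟩ := exists_hasLeftVelocityAt (G := G) v
  rw [lieExp_smul h0 hγ, h0]

lemma lieExp_add_smul (v : EG) (s t : ℝ) :
    lieExp G ((s + t) • v) = lieExp G (s • v) * lieExp G (t • v) := by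
  have h1 : ∀ r, HasLeftVelocityAt (fun r : ℝ => lieExp G (s • v) * lieExp G (r • v)) v r :=
    fun r => (lieExp_hasLeftVelocityAt v r).mul_left _
  have h2 : IsMIntegralCurve (I := 𝓘(ℝ, EG)) (fun r : ℝ => lieExp G ((r + s) • v)) (leftInv G v) :=
    IsMIntegralCurve.comp_add (I := 𝓘(ℝ, EG)) (γ := fun r : ℝ => lieExp G (r • v))
      (lieExp_hasLeftVelocityAt v) s
  have := congrFun (eq_of_hasLeftVelocityAt h2 h1 (by
    simp only [zero_add, lieExp_zero_smul, mul_one])) t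
  rwa [add_comm] at this

lemma lieExp_neg_smul (v : EG) (t : ℝ) : lieExp G (-(t • v)) = (lieExp G (t • v))⁻¹ := by
  have := lieExp_add_smul (G := G) v (-t) t
  rw [neg_add_cancel, lieExp_zero_smul, neg_smul] at this
  exact eq_inv_of_mul_eq_one_left this.symm

lemma contMDiff_lieExp_smul (v : EG) :
    ContMDiff 𝓘(ℝ, ℝ) 𝓘(ℝ, EG) ∞ (fun t : ℝ => lieExp G (t • v)) :=
  contMDiffOn_univ.1 (contMDiffOn_of_hasLeftVelocityAt (u := fun _ => v) isOpen_univ contDiffOn_const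
    fun t _ => lieExp_hasLeftVelocityAt v t)

end Exp

end Curves

/-! ### Standard local coordinates on the tangent bundle. -/

section StdCoord

variable {E : Type*} [NormedAddCommGroup E] [NormedSpace ℝ E]
  {M : Type*} [TopologicalSpace M] [ChartedSpace E M]
  [IsManifold 𝓘(ℝ, E) ∞ M]

variable (E) in
/-- The chart of `TM` induced by the chart of `M` at `x₀`. -/
def tangentChart (x₀ : M) : PartialEquiv (TangentBundle 𝓘(ℝ, E) M) (E × E) :=
  extChartAt 𝓘(ℝ, E).tangent (⟨x₀, 0⟩ : TangentBundle 𝓘(ℝ, E) M)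

lemma mem_tangentChart_source {x₀ : M} {p : TangentBundle 𝓘(ℝ, E) M} :
    p ∈ (tangentChart E x₀).source ↔ p.1 ∈ (extChartAt 𝓘(ℝ, E) x₀).source := by
  rw [tangentChart, extChartAt_source, TangentBundle.mem_chart_source_iff, extChartAt_source]

/-- The derivative at `p` of a vector-valued map on `TM`. -/
def bundleDeriv (f : TangentBundle 𝓘(ℝ, E) M → E × E) (p : TangentBundle 𝓘(ℝ, E) M) :
    E × E →L[ℝ] E × E :=
  mfderiv 𝓘(ℝ, E).tangent 𝓘(ℝ, E × E) f p

/-- The derivative at `p` of a self-map of `TM`. -/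
def bundleMapDeriv (f : TangentBundle 𝓘(ℝ, E) M → TangentBundle 𝓘(ℝ, E) M)
    (p : TangentBundle 𝓘(ℝ, E) M) : E × E →L[ℝ] E × E :=
  mfderiv 𝓘(ℝ, E).tangent 𝓘(ℝ, E).tangent f p

/-- The differential of the chart is the fibre coordinate change of the tangent bundle. Smoothness
and injectivity of `stdCoord` are thereby inherited from a genuine chart of `TM`. -/
lemma stdCoord_eq_tangentChart {x₀ : M} {p : TangentBundle 𝓘(ℝ, E) M}
    (hp : p.1 ∈ (extChartAt 𝓘(ℝ, E) x₀).source) : stdCoord x₀ p = tangentChart E x₀ p := by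
  have hp' : p.1 ∈ (chartAt E x₀).source := by simpa using hp
  have h : (mfderiv 𝓘(ℝ, E) 𝓘(ℝ, E) (extChartAt 𝓘(ℝ, E) x₀) p.1 : E →L[ℝ] E)
      = tangentCoordChange 𝓘(ℝ, E) p.1 x₀ p.1 := by
    have := mfderiv_chartAt_eq_tangentCoordChange (I := 𝓘(ℝ, E)) hp'
    exact this
  refine Prod.ext ?_ ?_
  · rfl
  · exact congrArg (fun L : E →L[ℝ] E => L p.2) h

lemma contMDiffAt_stdCoord {x₀ : M} {p : TangentBundle 𝓘(ℝ, E) M}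
    (hp : p.1 ∈ (extChartAt 𝓘(ℝ, E) x₀).source) :
    ContMDiffAt 𝓘(ℝ, E).tangent 𝓘(ℝ, E × E) ∞ (stdCoord x₀) p := by
  have h1 : ContMDiffAt 𝓘(ℝ, E).tangent 𝓘(ℝ, E × E) ∞ (tangentChart E x₀) p :=
    contMDiffAt_extChartAt' (by
      simpa [tangentChart] using mem_tangentChart_source.2 hp)
  refine h1.congr_of_eventuallyEq ?_
  have ho : IsOpen (tangentChart E x₀).source := isOpen_extChartAt_source _
  filter_upwards [ho.mem_nhds (mem_tangentChart_source.2 hp)] with q hq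
  exact stdCoord_eq_tangentChart (mem_tangentChart_source.1 hq)

lemma stdCoord_injOn {x₀ : M} {p q : TangentBundle 𝓘(ℝ, E) M}
    (hp : p.1 ∈ (extChartAt 𝓘(ℝ, E) x₀).source) (hq : q.1 ∈ (extChartAt 𝓘(ℝ, E) x₀).source)
    (h : stdCoord x₀ p = stdCoord x₀ q) : p = q := by
  rw [stdCoord_eq_tangentChart hp, stdCoord_eq_tangentChart hq] at h
  exact (tangentChart E x₀).injOn (mem_tangentChart_source.2 hp) (mem_tangentChart_source.2 hq) h

lemma stdCoord_snd_eq_zero_iff {x₀ : M} {p : TangentBundle 𝓘(ℝ, E) M}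
    (hp : p.1 ∈ (extChartAt 𝓘(ℝ, E) x₀).source) : (stdCoord x₀ p).2 = 0 ↔ p.2 = 0 := by
  constructor
  · intro h
    have h1 : p = ⟨p.1, 0⟩ := stdCoord_injOn (x₀ := x₀) hp hp (Prod.ext rfl (h.trans
      (map_zero (modelDeriv E E (extChartAt 𝓘(ℝ, E) x₀) p.1)).symm))
    rw [h1]
  · intro h
    exact (congrArg (fun v : E => modelDeriv E E (extChartAt 𝓘(ℝ, E) x₀) p.1 v) h).trans
      (map_zero (modelDeriv E E (extChartAt 𝓘(ℝ, E) x₀) p.1))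

lemma stdCoord_stdCoordSymm {x₀ : M} {q : E × E} (hq : q.1 ∈ (extChartAt 𝓘(ℝ, E) x₀).target) :
    stdCoord x₀ (stdCoordSymm x₀ q) = q := by
  refine Prod.ext ((extChartAt 𝓘(ℝ, E) x₀).right_inv hq) ?_
  have h1 := mfderiv_extChartAt_comp_mfderivWithin_extChartAt_symm (I := 𝓘(ℝ, E)) hq
  rw [modelWithCornersSelf_coe, range_id, mfderivWithin_univ] at h1
  exact congrArg (fun D : E →L[ℝ] E => D q.2) h1

lemma stdCoordSymm_stdCoord {x₀ : M} {p : TangentBundle 𝓘(ℝ, E) M}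
    (hp : p.1 ∈ (extChartAt 𝓘(ℝ, E) x₀).source) : stdCoordSymm x₀ (stdCoord x₀ p) = p := by
  have ht : (stdCoord x₀ p).1 ∈ (extChartAt 𝓘(ℝ, E) x₀).target :=
    (extChartAt 𝓘(ℝ, E) x₀).map_source hp
  exact stdCoord_injOn ((extChartAt 𝓘(ℝ, E) x₀).map_target ht) hp (stdCoord_stdCoordSymm ht)

lemma contMDiffAt_of_stdCoord {F : Type*} [NormedAddCommGroup F] [NormedSpace ℝ F]
    {X : F → TangentBundle 𝓘(ℝ, E) M} {x₀ : M} {t : F}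
    (hX : ∀ᶠ s in 𝓝 t, (X s).1 ∈ (extChartAt 𝓘(ℝ, E) x₀).source)
    (h : ContDiffAt ℝ ∞ (fun s => stdCoord x₀ (X s)) t) :
    ContMDiffAt 𝓘(ℝ, F) 𝓘(ℝ, E).tangent ∞ X t := by
  have ht : stdCoord x₀ (X t) ∈ (tangentChart E x₀).target := by
    rw [stdCoord_eq_tangentChart hX.self_of_nhds]
    exact (tangentChart E x₀).map_source (mem_tangentChart_source.2 hX.self_of_nhds)
  have ho : IsOpen (tangentChart E x₀).target := isOpen_extChartAt_target _
  have hs : ContMDiffAt 𝓘(ℝ, E × E) 𝓘(ℝ, E).tangent ∞ (tangentChart E x₀).symm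
      (stdCoord x₀ (X t)) :=
    (contMDiffOn_extChartAt_symm (⟨x₀, 0⟩ : TangentBundle 𝓘(ℝ, E) M)).contMDiffAt
      (ho.mem_nhds ht)
  refine (ContMDiffAt.comp t hs h.contMDiffAt).congr_of_eventuallyEq ?_
  filter_upwards [hX] with s hs
  exact (stdCoord_eq_tangentChart hs ▸
    (tangentChart E x₀).left_inv (mem_tangentChart_source.2 hs)).symm

/-- A vector of `T(TM)` is determined by its components in standard local coordinates. -/
lemma fieldCoord_injective {x₀ : M} {p : TangentBundle 𝓘(ℝ, E) M}
    (hp : p.1 ∈ (extChartAt 𝓘(ℝ, E) x₀).source) {ξ ζ : TangentSpace 𝓘(ℝ, E).tangent p}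
    (h : fieldCoord x₀ p ξ = fieldCoord x₀ p ζ) : ξ = ζ := by
  have ho : IsOpen (tangentChart E x₀).source := isOpen_extChartAt_source _
  have hev : stdCoord x₀ =ᶠ[𝓝 p] tangentChart E x₀ := by
    filter_upwards [ho.mem_nhds (mem_tangentChart_source.2 hp)] with q hq
    exact stdCoord_eq_tangentChart (mem_tangentChart_source.1 hq)
  have hm : bundleDeriv (stdCoord x₀) p
      = bundleDeriv (tangentChart E x₀) p := hev.mfderiv_eq
  have hp' : p ∈ (chartAt (ModelProd E E) (⟨x₀, 0⟩ : TangentBundle 𝓘(ℝ, E) M)).source := by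
    simpa [tangentChart] using mem_tangentChart_source.2 hp
  have hi : (mfderiv 𝓘(ℝ, E).tangent 𝓘(ℝ, E × E) (tangentChart E x₀) p).IsInvertible :=
    isInvertible_mfderiv_extChartAt (I := 𝓘(ℝ, E).tangent)
      (mem_tangentChart_source.2 hp)
  obtain ⟨e, he⟩ := hi
  refine e.injective ?_
  have h1 : ∀ ν : E × E, fieldCoord x₀ p ν = e ν := fun ν =>
    (congrArg (fun L : E × E →L[ℝ] E × E => L ν) hm).trans
      (congrArg (fun L : E × E →L[ℝ] E × E => L ν) he).symm
  exact (h1 ξ).symm.trans (h.trans (h1 ζ))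

lemma hasDerivAt_stdCoord {X : ℝ → TangentBundle 𝓘(ℝ, E) M} {t : ℝ} {x₀ : M}
    {ξ : TangentSpace 𝓘(ℝ, E).tangent (X t)}
    (hX : HasMFDerivAt 𝓘(ℝ, ℝ) 𝓘(ℝ, E).tangent X t ((1 : ℝ →L[ℝ] ℝ).smulRight ξ))
    (hp : (X t).1 ∈ (extChartAt 𝓘(ℝ, E) x₀).source) :
    HasDerivAt (fun s => stdCoord x₀ (X s)) (fieldCoord x₀ (X t) ξ) t := by
  have h := HasMFDerivAt.comp t ((contMDiffAt_stdCoord hp).mdifferentiableAt (by simp)).hasMFDerivAt hX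
  have h2 : HasFDerivAt (fun s => stdCoord x₀ (X s))
      ((bundleDeriv (stdCoord x₀) (X t)).comp
      ((1 : ℝ →L[ℝ] ℝ).smulRight (show E × E from ξ))) t :=
    hasMFDerivAt_iff_hasFDerivAt.1 h
  refine h2.hasDerivAt.congr_deriv ?_
  exact congrArg (bundleDeriv (stdCoord x₀) (X t)) (one_smul ℝ (show E × E from ξ))

/-- Smoothness supplies some derivative, and `fieldCoord_injective` identifies it by its components.
Integral curves in `TM` can thus be verified in one chart. -/
lemma hasMFDerivAt_of_stdCoord {X : ℝ → TangentBundle 𝓘(ℝ, E) M} {t : ℝ} {x₀ : M}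
    {ξ : TangentSpace 𝓘(ℝ, E).tangent (X t)}
    (hX : ContMDiffAt 𝓘(ℝ, ℝ) 𝓘(ℝ, E).tangent ∞ X t)
    (hp : (X t).1 ∈ (extChartAt 𝓘(ℝ, E) x₀).source)
    (hd : HasDerivAt (fun s => stdCoord x₀ (X s)) (fieldCoord x₀ (X t) ξ) t) :
    HasMFDerivAt 𝓘(ℝ, ℝ) 𝓘(ℝ, E).tangent X t ((1 : ℝ →L[ℝ] ℝ).smulRight ξ) := by
  have hX' := (hX.mdifferentiableAt (by simp)).hasMFDerivAt
  set D : ℝ →L[ℝ] E × E := mfderiv 𝓘(ℝ, ℝ) 𝓘(ℝ, E).tangent X t with hD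
  have hDe : D = (1 : ℝ →L[ℝ] ℝ).smulRight (D 1) := by
    ext <;> simp
  have hX2 : HasMFDerivAt 𝓘(ℝ, ℝ) 𝓘(ℝ, E).tangent X t
      ((1 : ℝ →L[ℝ] ℝ).smulRight (show TangentSpace 𝓘(ℝ, E).tangent (X t) from D 1)) := by
    refine hX'.congr_mfderiv ?_
    exact hDe
  have := fieldCoord_injective hp ((hasDerivAt_stdCoord hX2 hp).unique hd)
  rw [← this]
  exact hX2

lemma Spray.fieldCoord_eq (S : Spray E M) {x₀ : M} {p : TangentBundle 𝓘(ℝ, E) M}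
    (hp : p.1 ∈ (extChartAt 𝓘(ℝ, E) x₀).source) (h0 : p.2 ≠ 0) :
    fieldCoord x₀ p (S.field p) = ((stdCoord x₀ p).2,
      -(2 : ℝ) • sprayCoeff S.field x₀ (stdCoord x₀ p).1 (stdCoord x₀ p).2) := by
  refine Prod.ext (S.horizontal x₀ p hp h0) ?_
  simp only [sprayCoeff]
  rw [stdCoordSymm_stdCoord hp, smul_smul]
  norm_num

end StdCoord

lemma stdCoord_velocity {E : Type*} [NormedAddCommGroup E] [NormedSpace ℝ E]
    {M : Type*} [TopologicalSpace M] [ChartedSpace E M] [IsManifold 𝓘(ℝ, E) ∞ M]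
    {c : ℝ → M} {t : ℝ} {x₀ : M} (hc : MDifferentiableAt 𝓘(ℝ, ℝ) 𝓘(ℝ, E) c t)
    (ht : c t ∈ (extChartAt 𝓘(ℝ, E) x₀).source) :
    stdCoord x₀ (velocity c t)
      = (extChartAt 𝓘(ℝ, E) x₀ (c t), deriv (fun s => extChartAt 𝓘(ℝ, E) x₀ (c s)) t) := by
  have hχ : MDifferentiableAt 𝓘(ℝ, E) 𝓘(ℝ, E) (extChartAt 𝓘(ℝ, E) x₀) (c t) :=
    mdifferentiableAt_extChartAt (by simpa using ht)
  have h := HasMFDerivAt.comp t hχ.hasMFDerivAt hc.hasMFDerivAt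
  have h2 : HasFDerivAt (fun s => extChartAt 𝓘(ℝ, E) x₀ (c s))
      ((modelDeriv E E (extChartAt 𝓘(ℝ, E) x₀) (c t)).comp (modelDeriv ℝ E c t)) t :=
    hasMFDerivAt_iff_hasFDerivAt.1 h
  exact Prod.ext rfl h2.hasDerivAt.deriv.symm

/-! ### Coset spaces: local sections, the action, and charts read on `G`. -/

section Coset

variable {EG : Type*} [NormedAddCommGroup EG] [NormedSpace ℝ EG]
  {G : Type*} [Group G] [TopologicalSpace G] [ChartedSpace EG G]
  {H : Subgroup G}
  {EM : Type*} [NormedAddCommGroup EM] [NormedSpace ℝ EM] [ChartedSpace EM (G ⧸ H)]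

/-- The chart of `G ⧸ H` at `x₁`, as a function on `G`. -/
def cosetChart (EM : Type*) [NormedAddCommGroup EM] [NormedSpace ℝ EM] [ChartedSpace EM (G ⧸ H)]
    (x₁ : G ⧸ H) (g : G) : EM :=
  extChartAt 𝓘(ℝ, EM) x₁ (g : G ⧸ H)

/-- The tangent vector `g_* v` at `g · o`, for `v ∈ 𝔤` projected to `T_o(G ⧸ H)`. -/
def projTangent (H : Subgroup G) (EM : Type*) [NormedAddCommGroup EM] [NormedSpace ℝ EM]
    [ChartedSpace EM (G ⧸ H)] (g : G) (v : EG) : TangentBundle 𝓘(ℝ, EM) (G ⧸ H) :=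
  actTangent H EM g (originVec H EM v)

lemma projTangent_fst (g : G) (v : EG) :
    (projTangent H EM g v).1 = (g : G ⧸ H) := by
  change ((g * 1 : G) : G ⧸ H) = g
  rw [mul_one]

lemma actTangent_one (p : TangentBundle 𝓘(ℝ, EM) (G ⧸ H)) : actTangent H EM (1 : G) p = p := by
  have : (fun x : G ⧸ H => (1 : G) • x) = id := by
    funext x
    exact one_smul G x
  rw [actTangent, this, tangentMap_id]
  rfl

lemma projTangent_one (v : EG) : projTangent H EM (1 : G) v = originVec H EM v :=
  actTangent_one _

variable [IsManifold 𝓘(ℝ, EM) ∞ (G ⧸ H)]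

namespace IsSmoothCosetSpace

variable (hGH : IsSmoothCosetSpace EG H EM)
include hGH

omit [IsManifold 𝓘(ℝ, EM) ∞ (G ⧸ H)] in
lemma contMDiff_mk : ContMDiff 𝓘(ℝ, EG) 𝓘(ℝ, EM) ∞ (fun g : G => (g : G ⧸ H)) :=
  hGH.isSubmersion.contMDiff

variable [LieGroup 𝓘(ℝ, EG) ∞ G]

omit [IsManifold 𝓘(ℝ, EM) ∞ (G ⧸ H)] [LieGroup 𝓘(ℝ, EG) ∞ G] in
/-- `G → G ⧸ H` has smooth local sections. -/
lemma exists_section (g : G) : ∃ σ : G ⧸ H → G,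
    ContMDiffAt 𝓘(ℝ, EM) 𝓘(ℝ, EG) ∞ σ (g : G ⧸ H) ∧ σ (g : G ⧸ H) = g ∧
      ∀ᶠ x in 𝓝 (g : G ⧸ H), ((σ x : G) : G ⧸ H) = x := by
  have h := hGH.isSubmersion.isSubmersionAt g
  set φ := h.domChart.extend 𝓘(ℝ, EG) with hφ
  set ψ := h.codChart.extend 𝓘(ℝ, EM) with hψ
  have hgφ : g ∈ φ.source := by simpa [hφ] using h.mem_domChart_source
  have hgψ : (g : G ⧸ H) ∈ ψ.source := by simpa [hψ] using h.mem_codChart_source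
  have hw : EqOn (ψ ∘ (fun g : G => (g : G ⧸ H)) ∘ φ.symm) (Prod.fst ∘ h.equiv) φ.target :=
    h.writtenInCharts
  -- In submersion charts the projection is `Prod.fst`; the section keeps the fibre coordinate of
  -- `g` fixed.
  let τ : G ⧸ H → EG := fun x => h.equiv.symm (ψ x, (h.equiv (φ g)).2)
  have hτg : τ (g : G ⧸ H) = φ g := by
    have h1 := hw (φ.map_source hgφ)
    simp only [Function.comp_apply, φ.left_inv hgφ] at h1
    simp only [τ, h1, Prod.mk.eta, ContinuousLinearEquiv.symm_apply_apply]
  have hψs : ContMDiffAt 𝓘(ℝ, EM) 𝓘(ℝ, EM) ∞ ψ (g : G ⧸ H) :=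
    OpenPartialHomeomorph.contMDiffAt_extend h.codChart_mem_maximalAtlas h.mem_codChart_source
  have hτs : ContMDiffAt 𝓘(ℝ, EM) 𝓘(ℝ, EG) ∞ τ (g : G ⧸ H) := by
    have : ContDiff ℝ ∞ (fun e : EM => h.equiv.symm (e, (h.equiv (φ g)).2)) :=
      h.equiv.symm.contDiff.comp (contDiff_id.prodMk contDiff_const)
    exact ContMDiffAt.comp (g := fun e : EM => h.equiv.symm (e, (h.equiv (φ g)).2)) (f := ψ)
      (g : G ⧸ H) this.contMDiff.contMDiffAt hψs
  have hφo : φ.target ∈ 𝓝 (φ g) := by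
    have : IsOpen φ.target := h.domChart.isOpen_extend_target
    exact this.mem_nhds (φ.map_source hgφ)
  have hφs : ContMDiffAt 𝓘(ℝ, EG) 𝓘(ℝ, EG) ∞ φ.symm (τ (g : G ⧸ H)) := by
    rw [hτg]
    exact (contMDiffOn_extend_symm h.domChart_mem_maximalAtlas).contMDiffAt (by
      simpa [hφ, OpenPartialHomeomorph.extend_target] using hφo)
  refine ⟨φ.symm ∘ τ, ContMDiffAt.comp (g : G ⧸ H) hφs hτs, ?_, ?_⟩
  · simp only [Function.comp_apply, hτg, φ.left_inv hgφ]
  · have h1 : ∀ᶠ x in 𝓝 (g : G ⧸ H), τ x ∈ φ.target :=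
      hτs.continuousAt (by rw [hτg]; exact hφo)
    have h2 : ∀ᶠ x in 𝓝 (g : G ⧸ H), x ∈ ψ.source := by
      have : IsOpen ψ.source := h.codChart.isOpen_extend_source
      exact this.mem_nhds hgψ
    filter_upwards [h1, h2] with x hx1 hx2
    have hs : ((φ.symm (τ x) : G) : G ⧸ H) ∈ ψ.source := by
      have := h.source_subset_preimage_source (show φ.symm (τ x) ∈ h.domChart.source by
        simpa [hφ] using φ.map_target hx1)
      simpa [hψ] using this
    refine ψ.injOn hs hx2 ((hw hx1).trans ?_)
    simp [τ]

/-- Every element of `G` acts smoothly on `G ⧸ H`. -/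
lemma contMDiff_smul (k : G) : ContMDiff 𝓘(ℝ, EM) 𝓘(ℝ, EM) ∞ (fun x : G ⧸ H => k • x) := by
  intro x
  obtain ⟨g, rfl⟩ := QuotientGroup.mk_surjective x
  obtain ⟨σ, hσ, hσg, hσx⟩ := hGH.exists_section g
  -- Near `gH` the action of `k` is: lift by the section, multiply by `k`, project.
  have h1 : ContMDiffAt 𝓘(ℝ, EM) 𝓘(ℝ, EG) ∞ (fun x => k * σ x) (g : G ⧸ H) :=
    ContMDiffAt.comp (g : G ⧸ H) (contMDiff_mul_left (I := 𝓘(ℝ, EG)) (n := ∞) (a := k)).contMDiffAt hσ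
  refine (ContMDiffAt.comp (g : G ⧸ H) hGH.contMDiff_mk.contMDiffAt h1).congr_of_eventuallyEq ?_
  filter_upwards [hσx] with x hx
  conv_lhs => rw [← hx]
  rfl

omit [LieGroup 𝓘(ℝ, EG) ∞ G] in
lemma contMDiffAt_cosetChart {x₁ : G ⧸ H} {g : G}
    (hg : (g : G ⧸ H) ∈ (extChartAt 𝓘(ℝ, EM) x₁).source) :
    ContMDiffAt 𝓘(ℝ, EG) 𝓘(ℝ, EM) ∞ (cosetChart EM x₁) g :=
  ContMDiffAt.comp g (contMDiffAt_extChartAt' (by simpa using hg)) hGH.contMDiff_mk.contMDiffAt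

lemma actTangent_mul (k g : G) (p : TangentBundle 𝓘(ℝ, EM) (G ⧸ H)) :
    actTangent H EM (k * g) p = actTangent H EM k (actTangent H EM g p) := by
  have h := tangentMap_comp_at (I := 𝓘(ℝ, EM)) (I' := 𝓘(ℝ, EM)) (I'' := 𝓘(ℝ, EM)) p
    (g := fun x : G ⧸ H => k • x) (f := fun x : G ⧸ H => g • x)
    ((hGH.contMDiff_smul k).mdifferentiable (by simp) _)
    ((hGH.contMDiff_smul g).mdifferentiable (by simp) _)
  refine Eq.trans ?_ h
  have : (fun x : G ⧸ H => (k * g) • x) = (fun x : G ⧸ H => k • x) ∘ fun x => g • x := by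
    funext x
    exact mul_smul k g x
  rw [actTangent, this]

lemma actTangent_mul_projTangent (k g : G) (v : EG) :
    projTangent H EM (k * g) v = actTangent H EM k (projTangent H EM g v) :=
  hGH.actTangent_mul k g _

/-- The chain rule for `h ↦ cosetChart EM x₁ (g * h)`, factored as projection, action of `g`, chart.
All later coordinate computations on `T(G ⧸ H)` pass through this formula. -/
lemma stdCoord_projTangent {x₁ : G ⧸ H} {g : G}
    (hg : (g : G ⧸ H) ∈ (extChartAt 𝓘(ℝ, EM) x₁).source) (v : EG) :
    stdCoord x₁ (projTangent H EM g v) = (cosetChart EM x₁ g, leftDeriv (cosetChart EM x₁) g v) := by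
  have hg' : g • ((1 : G) : G ⧸ H) = (g : G ⧸ H) := projTangent_fst (EM := EM) g v
  refine Prod.ext (congrArg (extChartAt 𝓘(ℝ, EM) x₁) hg') ?_
  have h1 := ((hGH.contMDiff_mk (1 : G)).mdifferentiableAt (by simp)).hasMFDerivAt
  have h2 := ((hGH.contMDiff_smul g ((1 : G) : G ⧸ H)).mdifferentiableAt (by simp)).hasMFDerivAt
  have h3 : MDifferentiableAt 𝓘(ℝ, EM) 𝓘(ℝ, EM) (extChartAt 𝓘(ℝ, EM) x₁)
      (g • ((1 : G) : G ⧸ H)) := by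
    rw [hg']
    exact mdifferentiableAt_extChartAt (by simpa using hg)
  have h4 := HasMFDerivAt.comp (1 : G) (HasMFDerivAt.comp ((1 : G) : G ⧸ H) h3.hasMFDerivAt h2) h1
  exact (congrArg (fun L : EG →L[ℝ] EM => L v) h4.mfderiv).symm

lemma velocity_mk {γ : ℝ → G} {v : EG} {t : ℝ} (hγ : HasLeftVelocityAt γ v t) :
    velocity (E := EM) (fun s => (γ s : G ⧸ H)) t = projTangent H EM (γ t) v := by
  have hs : (γ t : G ⧸ H) ∈ (extChartAt 𝓘(ℝ, EM) (γ t : G ⧸ H)).source :=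
    mem_extChartAt_source _
  have hd : MDifferentiableAt 𝓘(ℝ, ℝ) 𝓘(ℝ, EM) (fun s => (γ s : G ⧸ H)) t :=
    MDifferentiableAt.comp t ((hGH.contMDiff_mk (γ t)).mdifferentiableAt (by simp))
      hγ.mdifferentiableAt
  refine stdCoord_injOn (x₀ := (γ t : G ⧸ H)) hs (by rw [projTangent_fst]; exact hs) ?_
  rw [stdCoord_velocity hd hs, hGH.stdCoord_projTangent hs]
  refine Prod.ext rfl ?_
  exact (hγ.hasDerivAt (f := cosetChart EM (γ t : G ⧸ H))
    ((hGH.contMDiffAt_cosetChart hs).mdifferentiableAt (by simp))).deriv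

/-- A local section `σ` gives a right inverse: the derivative of `e ↦ g⁻¹ * σ (χ.symm e)`. -/
lemma leftDeriv_cosetChart_surjective {x₁ : G ⧸ H} {g : G}
    (hg : (g : G ⧸ H) ∈ (extChartAt 𝓘(ℝ, EM) x₁).source) :
    Function.Surjective (leftDeriv (EG := EG) (cosetChart EM x₁) g) := by
  obtain ⟨σ, hσ, hσg, hσx⟩ := hGH.exists_section g
  set χ := extChartAt 𝓘(ℝ, EM) x₁ with hχ
  have hsymm : ContMDiffAt 𝓘(ℝ, EM) 𝓘(ℝ, EM) ∞ χ.symm (χ g) :=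
    (contMDiffOn_extChartAt_symm x₁).contMDiffAt
      ((isOpen_extChartAt_target x₁).mem_nhds (χ.map_source hg))
  have hinv : χ.symm (χ g) = g := χ.left_inv hg
  have hσ' : ContMDiffAt 𝓘(ℝ, EM) 𝓘(ℝ, EG) ∞ σ (χ.symm (χ g)) := by rwa [hinv]
  let F : EM → G := fun e => g⁻¹ * σ (χ.symm e)
  have hF : ContMDiffAt 𝓘(ℝ, EM) 𝓘(ℝ, EG) ∞ F (χ g) :=
    ContMDiffAt.comp (χ g) (contMDiff_mul_left (I := 𝓘(ℝ, EG)) (n := ∞) (a := g⁻¹)).contMDiffAt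
      (ContMDiffAt.comp (χ g) hσ' hsymm)
  have hFg : F (χ g) = 1 := by simp only [F, hinv, hσg, inv_mul_cancel]
  have hf : ContMDiffAt 𝓘(ℝ, EG) 𝓘(ℝ, EM) ∞ (fun h => cosetChart EM x₁ (g * h)) (F (χ g)) := by
    rw [hFg]
    exact ContMDiffAt.comp_of_eq (f := fun h => g * h) (hGH.contMDiffAt_cosetChart hg)
      (contMDiff_mul_left (I := 𝓘(ℝ, EG)) (n := ∞) (a := g)).contMDiffAt (mul_one g)
  have h1 := HasMFDerivAt.comp (χ g) (hf.mdifferentiableAt (by simp)).hasMFDerivAt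
    (hF.mdifferentiableAt (by simp)).hasMFDerivAt
  have hev : ((fun h => cosetChart EM x₁ (g * h)) ∘ F) =ᶠ[𝓝 (χ g)] id := by
    have ht : ∀ᶠ e in 𝓝 (χ g), e ∈ χ.target :=
      (isOpen_extChartAt_target x₁).mem_nhds (χ.map_source hg)
    have hs : ∀ᶠ e in 𝓝 (χ g), ((σ (χ.symm e) : G) : G ⧸ H) = χ.symm e :=
      hsymm.continuousAt.eventually (by rwa [hinv])
    filter_upwards [ht, hs] with e he1 he2
    simp only [Function.comp_apply, F, cosetChart, mul_inv_cancel_left, he2, id]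
    exact χ.right_inv he1
  have h2 : (modelDeriv EG EM (fun h => cosetChart EM x₁ (g * h)) (F (χ g))).comp
      (modelDeriv EM EG F (χ g)) = ContinuousLinearMap.id ℝ EM :=
    h1.mfderiv.symm.trans ((hev.mfderiv_eq).trans mfderiv_id)
  rw [hFg] at h2
  intro e
  exact ⟨modelDeriv EM EG F (χ g) e, congrArg (fun L : EM →L[ℝ] EM => L e) h2⟩

end IsSmoothCosetSpace

end Coset

/-! ### The differential of the projection and its kernel. -/

section CosetTangent

variable {EG : Type*} [NormedAddCommGroup EG] [NormedSpace ℝ EG]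
  {G : Type*} [Group G] [TopologicalSpace G] [ChartedSpace EG G]
  {H : Subgroup G}
  {EM : Type*} [NormedAddCommGroup EM] [NormedSpace ℝ EM] [ChartedSpace EM (G ⧸ H)]

lemma actTangent_snd_eq_zero (k : G) {p : TangentBundle 𝓘(ℝ, EM) (G ⧸ H)} (hp : p.2 = 0) :
    (actTangent H EM k p).2 = 0 :=
  (congrArg (fun v : EM => modelDeriv EM EM (fun x : G ⧸ H => k • x) p.1 v) hp).trans
    (map_zero (modelDeriv EM EM (fun x : G ⧸ H => k • x) p.1))

variable [LieGroup 𝓘(ℝ, EG) ∞ G]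

lemma lieExp_nat_mul_smul [CompleteSpace EG] [T2Space G] (v : EG) (s : ℝ) (n : ℕ) :
    lieExp G ((n * s : ℝ) • v) = lieExp G (s • v) ^ n := by
  induction n with
  | zero => rw [Nat.cast_zero, zero_mul, lieExp_zero_smul, pow_zero]
  | succ n ih => rw [Nat.cast_succ, add_mul, one_mul, lieExp_add_smul, ih, pow_succ]

variable [IsManifold 𝓘(ℝ, EM) ∞ (G ⧸ H)]

namespace IsSmoothCosetSpace

variable (hGH : IsSmoothCosetSpace EG H EM)
include hGH

omit [LieGroup 𝓘(ℝ, EG) ∞ G] in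
lemma eventually_mem_source {X : Type*} [TopologicalSpace X] {γ : X → G} {t : X}
    (hγ : ContinuousAt γ t) {x₁ : G ⧸ H} (hg : (γ t : G ⧸ H) ∈ (extChartAt 𝓘(ℝ, EM) x₁).source) :
    ∀ᶠ s in 𝓝 t, (γ s : G ⧸ H) ∈ (extChartAt 𝓘(ℝ, EM) x₁).source :=
  (hGH.contMDiff_mk.continuous.continuousAt.comp hγ)
    ((isOpen_extChartAt_source x₁).mem_nhds hg)

lemma contMDiffAt_projTangent {γ : ℝ → G} {u : ℝ → EG} {t : ℝ}
    (hγ : ContMDiffAt 𝓘(ℝ, ℝ) 𝓘(ℝ, EG) ∞ γ t) (hu : ContDiffAt ℝ ∞ u t) :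
    ContMDiffAt 𝓘(ℝ, ℝ) 𝓘(ℝ, EM).tangent ∞ (fun s => projTangent H EM (γ s) (u s)) t := by
  have hs : (γ t : G ⧸ H) ∈ (extChartAt 𝓘(ℝ, EM) (γ t : G ⧸ H)).source := mem_extChartAt_source _
  have hev := hGH.eventually_mem_source hγ.continuousAt hs
  refine contMDiffAt_of_stdCoord (x₀ := (γ t : G ⧸ H)) ?_ ?_
  · filter_upwards [hev] with s hs
    rwa [projTangent_fst]
  · have hf := hGH.contMDiffAt_cosetChart hs
    have h1 : ContDiffAt ℝ ∞ (fun s => cosetChart EM (γ t : G ⧸ H) (γ s)) t :=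
      (ContMDiffAt.comp t hf hγ).contDiffAt
    have h2 : ContDiffAt ℝ ∞ (fun s => leftDeriv (EG := EG) (cosetChart EM (γ t : G ⧸ H)) (γ s)) t :=
      (ContMDiffAt.comp t (contMDiffAt_leftDeriv hf) hγ).contDiffAt
    refine (h1.prodMk (h2.clm_apply hu)).congr_of_eventuallyEq ?_
    filter_upwards [hev] with s hs
    exact hGH.stdCoord_projTangent hs (u s)

lemma hasDerivAt_stdCoord_projTangent {γ : ℝ → G} {v : EG} {u : ℝ → EG} {u' : EG} {t : ℝ}
    (hγ : HasLeftVelocityAt γ v t) (hu : HasDerivAt u u' t) {x₁ : G ⧸ H}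
    (hs : (γ t : G ⧸ H) ∈ (extChartAt 𝓘(ℝ, EM) x₁).source) :
    HasDerivAt (fun s => stdCoord x₁ (projTangent H EM (γ s) (u s)))
      (leftDeriv (cosetChart EM x₁) (γ t) v,
        leftDeriv (leftDeriv (EG := EG) (cosetChart EM x₁)) (γ t) v (u t)
          + leftDeriv (cosetChart EM x₁) (γ t) u') t := by
  have hf := hGH.contMDiffAt_cosetChart hs
  refine ((hγ.hasDerivAt (hf.mdifferentiableAt (by simp))).prodMk
    (hγ.hasDerivAt_leftDeriv hf hu)).congr_of_eventuallyEq ?_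
  filter_upwards [hGH.eventually_mem_source hγ.continuousAt hs] with s hs
  exact hGH.stdCoord_projTangent hs (u s)

variable [CompleteSpace EG] [T2Space G]

/-- The curve `g exp(tv) H` is constant. -/
lemma leftDeriv_cosetChart_eq_zero {v : EG} (hv : ∀ t : ℝ, lieExp G (t • v) ∈ H) {x₁ : G ⧸ H} {g : G}
    (hg : (g : G ⧸ H) ∈ (extChartAt 𝓘(ℝ, EM) x₁).source) :
    leftDeriv (cosetChart EM x₁) g v = 0 := by
  have h0 : g * lieExp G ((0 : ℝ) • v) = g := by rw [lieExp_zero_smul, mul_one]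
  have h1 := ((lieExp_hasLeftVelocityAt (G := G) v 0).mul_left g).hasDerivAt
    (f := cosetChart EM x₁) (by
      rw [h0]
      exact (hGH.contMDiffAt_cosetChart hg).mdifferentiableAt (by simp))
  rw [h0] at h1
  have h2 : (fun s : ℝ => cosetChart EM x₁ (g * lieExp G (s • v)))
      = fun _ => cosetChart EM x₁ g := by
    funext s
    refine congrArg (extChartAt 𝓘(ℝ, EM) x₁) ?_
    rw [QuotientGroup.eq]
    simpa using hv s
  rw [h2] at h1
  exact h1.unique (hasDerivAt_const 0 _)

/-- If `v` projects to zero at one `g`, then by translation it does so at all. The curve `exp(tv) ·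
o` then has zero velocity, so `exp(tv)` lies in `H` for small `t`, and its powers reach every `t`.
-/
lemma lieExp_mem_of_leftDeriv_eq_zero {v : EG} {x₁ : G ⧸ H} {g : G}
    (hg : (g : G ⧸ H) ∈ (extChartAt 𝓘(ℝ, EM) x₁).source)
    (hv : leftDeriv (cosetChart EM x₁) g v = 0) (t : ℝ) : lieExp G (t • v) ∈ H := by
  have h1 : (projTangent H EM g v).2 = 0 := by
    rw [← stdCoord_snd_eq_zero_iff (x₀ := x₁) (by rwa [projTangent_fst]),
      hGH.stdCoord_projTangent hg, hv]
  have h2 : ∀ k : G, (projTangent H EM k v).2 = 0 := by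
    intro k
    have := actTangent_snd_eq_zero (k * g⁻¹) h1
    rwa [← hGH.actTangent_mul_projTangent, inv_mul_cancel_right] at this
  set o : G ⧸ H := ((1 : G) : G ⧸ H) with ho
  have hc : ContinuousAt (fun s : ℝ => lieExp G (s • v)) 0 :=
    (lieExp_hasLeftVelocityAt (G := G) v 0).continuousAt
  have hs := hGH.eventually_mem_source hc (x₁ := o) (by
    rw [lieExp_zero_smul]; exact mem_extChartAt_source _)
  obtain ⟨ε, hε, hεs⟩ := Metric.eventually_nhds_iff_ball.1 hs
  have hd : ∀ s ∈ Metric.ball (0 : ℝ) ε,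
      HasDerivAt (fun s : ℝ => cosetChart EM o (lieExp G (s • v))) 0 s := by
    intro s hs
    have h3 := (lieExp_hasLeftVelocityAt (G := G) v s).hasDerivAt
      ((hGH.contMDiffAt_cosetChart (hεs s hs)).mdifferentiableAt (by simp))
    have h4 := (stdCoord_snd_eq_zero_iff (x₀ := o) (p := projTangent H EM (lieExp G (s • v)) v)
      (by rw [projTangent_fst]; exact hεs s hs)).2 (h2 _)
    rw [hGH.stdCoord_projTangent (hεs s hs)] at h4
    exact h3.congr_deriv h4
  have hmem : ∀ s ∈ Metric.ball (0 : ℝ) ε, lieExp G (s • v) ∈ H := by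
    intro s hs
    have h3 := Metric.isOpen_ball.is_const_of_deriv_eq_zero
      (convex_ball (0 : ℝ) ε).isPreconnected
      (fun s hs => (hd s hs).differentiableAt.differentiableWithinAt)
      (fun s hs => (hd s hs).deriv) hs (Metric.mem_ball_self hε)
    have h4 := (extChartAt 𝓘(ℝ, EM) o).injOn (hεs s hs) (hεs 0 (Metric.mem_ball_self hε)) h3
    simp only [lieExp_zero_smul] at h4
    have h5 := QuotientGroup.eq.1 h4.symm
    simpa using h5
  obtain ⟨n, hn⟩ := exists_nat_gt (|t| / ε)
  have hn0 : (0 : ℝ) < n := lt_of_le_of_lt (by positivity) hn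
  have h6 : t / n ∈ Metric.ball (0 : ℝ) ε := by
    rw [mem_ball_zero_iff, Real.norm_eq_abs, abs_div, abs_of_pos hn0, div_lt_iff₀ hn0]
    rwa [div_lt_iff₀ hε, mul_comm] at hn
  have h7 := H.pow_mem (hmem _ h6) n
  rwa [← lieExp_nat_mul_smul, mul_div_cancel₀ _ hn0.ne'] at h7

/-- The derivative of `G → G ⧸ H` at `g`, read in a chart, is an isomorphism on any complement of the
Lie algebra of `H`. -/
lemma exists_equiv_leftDeriv [FiniteDimensional ℝ EG] {𝔥 𝔪 : Submodule ℝ EG}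
    (h𝔥 : ∀ v : EG, v ∈ 𝔥 ↔ ∀ t : ℝ, lieExp G (t • v) ∈ H) (hc : IsCompl 𝔥 𝔪)
    {x₁ : G ⧸ H} {g : G} (hg : (g : G ⧸ H) ∈ (extChartAt 𝓘(ℝ, EM) x₁).source) :
    ∃ e : 𝔪 ≃L[ℝ] EM, (e : 𝔪 →L[ℝ] EM) = (leftDeriv (cosetChart EM x₁) g).comp 𝔪.subtypeL := by
  set L : 𝔪 →L[ℝ] EM := (leftDeriv (cosetChart EM x₁) g).comp 𝔪.subtypeL with hL
  have hinj : Function.Injective (L : 𝔪 →ₗ[ℝ] EM) := by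
    rw [← LinearMap.ker_eq_bot, LinearMap.ker_eq_bot']
    intro u hu
    have h1 : (u : EG) ∈ 𝔥 := (h𝔥 u).2 fun t => hGH.lieExp_mem_of_leftDeriv_eq_zero hg hu t
    exact Subtype.ext ((Submodule.disjoint_def.1 hc.disjoint) u h1 u.2)
  have hsurj : Function.Surjective (L : 𝔪 →ₗ[ℝ] EM) := by
    intro x
    obtain ⟨v, rfl⟩ := hGH.leftDeriv_cosetChart_surjective hg x
    obtain ⟨a, ha, b, hb, rfl⟩ := Submodule.mem_sup.1 (hc.sup_eq_top ▸ Submodule.mem_top : v ∈ 𝔥 ⊔ 𝔪)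
    refine ⟨⟨b, hb⟩, ?_⟩
    have := hGH.leftDeriv_cosetChart_eq_zero ((h𝔥 a).1 ha) hg
    rw [map_add, this, zero_add]
    rfl
  let e := LinearEquiv.ofBijective (L : 𝔪 →ₗ[ℝ] EM) ⟨hinj, hsurj⟩
  have : FiniteDimensional ℝ EM := e.finiteDimensional
  exact ⟨e.toContinuousLinearEquiv, by ext u; rfl⟩

end IsSmoothCosetSpace

end CosetTangent

/-! ### The spray equation on `𝔪`. -/

section SprayVector

variable {EG : Type*} [NormedAddCommGroup EG] [NormedSpace ℝ EG] [FiniteDimensional ℝ EG]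
  {G : Type*} [Group G] [TopologicalSpace G] [T2Space G] [ChartedSpace EG G]
  [LieGroup 𝓘(ℝ, EG) ∞ G]
  {H : Subgroup G}
  {EM : Type*} [NormedAddCommGroup EM] [NormedSpace ℝ EM] [ChartedSpace EM (G ⧸ H)]
  [IsManifold 𝓘(ℝ, EM) ∞ (G ⧸ H)]

/-- The equation relating a map `η : 𝔪 → 𝔪` to the spray coefficients in all charts of `G ⧸ H`:
curves with left velocity `u` satisfying `u' = -η(u)` project to geodesics. -/
def IsSprayEquation (S : Spray EM (G ⧸ H)) (𝔪 : Submodule ℝ EG) (η : 𝔪 → 𝔪) : Prop :=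
  ∀ (x₁ : G ⧸ H) (g : G), (g : G ⧸ H) ∈ (extChartAt 𝓘(ℝ, EM) x₁).source → ∀ u : 𝔪, u ≠ 0 →
    -(2 : ℝ) • sprayCoeff S.field x₁ (cosetChart EM x₁ g) (leftDeriv (cosetChart EM x₁) g (u : EG))
      = leftDeriv (leftDeriv (EG := EG) (cosetChart EM x₁)) g (u : EG) (u : EG)
        - leftDeriv (cosetChart EM x₁) g (η u : EG)

namespace IsSmoothCosetSpace

variable (hGH : IsSmoothCosetSpace EG H EM)
include hGH

lemma projTangent_ne_zero {𝔥 𝔪 : Submodule ℝ EG}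
    (h𝔥 : ∀ v : EG, v ∈ 𝔥 ↔ ∀ t : ℝ, lieExp G (t • v) ∈ H) (hc : IsCompl 𝔥 𝔪) (k : G) {u : 𝔪}
    (hu : u ≠ 0) : (projTangent H EM k (u : EG)).2 ≠ 0 := by
  intro h
  have hs : (k : G ⧸ H) ∈ (extChartAt 𝓘(ℝ, EM) (k : G ⧸ H)).source := mem_extChartAt_source _
  rw [← stdCoord_snd_eq_zero_iff (x₀ := (k : G ⧸ H)) (by rwa [projTangent_fst]),
    hGH.stdCoord_projTangent hs] at h
  obtain ⟨e, he⟩ := hGH.exists_equiv_leftDeriv h𝔥 hc hs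
  refine hu (e.map_eq_zero_iff.1 ?_)
  exact (congrArg (fun L : 𝔪 →L[ℝ] EM => L u) he).trans h

lemma projTangent_injective {𝔥 𝔪 : Submodule ℝ EG}
    (h𝔥 : ∀ v : EG, v ∈ 𝔥 ↔ ∀ t : ℝ, lieExp G (t • v) ∈ H) (hc : IsCompl 𝔥 𝔪) (k : G) :
    Function.Injective (fun u : 𝔪 => projTangent H EM k (u : EG)) := by
  intro u v h
  have hs : (k : G ⧸ H) ∈ (extChartAt 𝓘(ℝ, EM) (k : G ⧸ H)).source := mem_extChartAt_source _
  obtain ⟨e, he⟩ := hGH.exists_equiv_leftDeriv h𝔥 hc hs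
  have h1 := congrArg (fun p => (stdCoord (k : G ⧸ H) p).2) h
  simp only [hGH.stdCoord_projTangent hs] at h1
  refine e.injective ?_
  exact (congrArg (fun L : 𝔪 →L[ℝ] EM => L u) he).trans
    (h1.trans (congrArg (fun L : 𝔪 →L[ℝ] EM => L v) he).symm)

/-- The spray equation at the identity in the chart at the origin implies it everywhere, for an
invariant spray structure. -/
lemma isSprayEquation_of_origin {S : Spray EM (G ⧸ H)} (hS : IsInvariant S)
    {𝔥 𝔪 : Submodule ℝ EG}
    (h𝔥 : ∀ v : EG, v ∈ 𝔥 ↔ ∀ t : ℝ, lieExp G (t • v) ∈ H) (hc : IsCompl 𝔥 𝔪) {η : 𝔪 → 𝔪}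
    (hη : ∀ u : 𝔪, u ≠ 0 →
      -(2 : ℝ) • sprayCoeff S.field ((1 : G) : G ⧸ H) (cosetChart EM ((1 : G) : G ⧸ H) (1 : G))
        (leftDeriv (cosetChart EM ((1 : G) : G ⧸ H)) (1 : G) (u : EG))
      = leftDeriv (leftDeriv (EG := EG) (cosetChart EM ((1 : G) : G ⧸ H))) (1 : G) (u : EG) (u : EG)
        - leftDeriv (cosetChart EM ((1 : G) : G ⧸ H)) (1 : G) (η u : EG)) :
    IsSprayEquation S 𝔪 η := by
  intro x₁ g hg u hu
  -- A test curve through `k_* u`. For `k = 1` the hypothesis says that its velocity at `0` is the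
  -- spray; `g_*` maps `Y 1` to `Y g` and preserves the spray, so the same holds for `Y g`. Reading
  -- this in the chart `x₁` is the equation at `g`.
  let Y : G → ℝ → TangentBundle 𝓘(ℝ, EM) (G ⧸ H) := fun k s =>
    projTangent H EM (k * lieExp G (s • (u : EG))) ((u : EG) - s • (η u : EG))
  have hu' : HasDerivAt (fun s : ℝ => (u : EG) - s • (η u : EG)) (-(η u : EG)) 0 := by
    simpa using ((hasDerivAt_id (0 : ℝ)).smul_const (η u : EG)).const_sub (u : EG)
  have hvel : ∀ k : G, HasLeftVelocityAt (fun s : ℝ => k * lieExp G (s • (u : EG))) (u : EG) 0 :=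
    fun k => (lieExp_hasLeftVelocityAt (G := G) (u : EG) 0).mul_left k
  have hk0 : ∀ k : G, k * lieExp G ((0 : ℝ) • (u : EG)) = k := fun k => by
    rw [lieExp_zero_smul, mul_one]
  have hu0 : (u : EG) - (0 : ℝ) • (η u : EG) = u := by rw [zero_smul, sub_zero]
  have hY0 : ∀ k, Y k 0 = projTangent H EM k (u : EG) := fun k => by
    simp only [Y, hk0, hu0]
  have hYd : ∀ (k : G) (x : G ⧸ H), (k : G ⧸ H) ∈ (extChartAt 𝓘(ℝ, EM) x).source →
      HasDerivAt (fun s => stdCoord x (Y k s))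
        (leftDeriv (cosetChart EM x) k (u : EG), leftDeriv (leftDeriv (EG := EG) (cosetChart EM x)) k (u : EG) (u : EG)
          - leftDeriv (cosetChart EM x) k (η u : EG)) 0 := by
    intro k x hk
    refine (hGH.hasDerivAt_stdCoord_projTangent (hvel k) hu' (x₁ := x) ?_).congr_deriv ?_
    · simpa only [hk0] using hk
    · simp only [hk0, hu0, map_neg, sub_eq_add_neg]
  have hcoord : ∀ (k : G) (x : G ⧸ H), (k : G ⧸ H) ∈ (extChartAt 𝓘(ℝ, EM) x).source →
      fieldCoord x (Y k 0) (S.field (Y k 0)) = (leftDeriv (cosetChart EM x) k (u : EG),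
        -(2 : ℝ) • sprayCoeff S.field x (cosetChart EM x k) (leftDeriv (cosetChart EM x) k (u : EG))) := by
    intro k x hk
    rw [hY0, S.fieldCoord_eq (x₀ := x) (by rwa [projTangent_fst])
      (hGH.projTangent_ne_zero h𝔥 hc k hu),
      hGH.stdCoord_projTangent hk]
  have ho : ((1 : G) : G ⧸ H) ∈ (extChartAt 𝓘(ℝ, EM) ((1 : G) : G ⧸ H)).source :=
    mem_extChartAt_source _
  have hfst : ∀ k : G, (Y k 0).1 = (k : G ⧸ H) := fun k => by rw [hY0, projTangent_fst]
  have h1 : HasMFDerivAt 𝓘(ℝ, ℝ) 𝓘(ℝ, EM).tangent (Y 1) 0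
      ((1 : ℝ →L[ℝ] ℝ).smulRight (S.field (Y 1 0))) := by
    refine hasMFDerivAt_of_stdCoord (x₀ := ((1 : G) : G ⧸ H)) ?_ (by rw [hfst]; exact ho) ?_
    · refine hGH.contMDiffAt_projTangent ?_ ?_
      · simp only [one_mul]
        exact (contMDiff_lieExp_smul (u : EG)).contMDiffAt
      · exact (contDiff_const.sub (contDiff_id.smul contDiff_const)).contDiffAt
    · rw [hcoord 1 _ ho, hη u hu]
      exact hYd 1 _ ho
  have hYg : Y g = fun s => actTangent H EM g (Y 1 s) := by
    funext s
    simp only [Y, one_mul]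
    exact hGH.actTangent_mul_projTangent g _ _
  have hact : MDifferentiableAt 𝓘(ℝ, EM).tangent 𝓘(ℝ, EM).tangent (actTangent H EM g) (Y 1 0) :=
    ((hGH.contMDiff_smul g).contMDiff_tangentMap (m := 1) (by
      exact two_le_infty)).mdifferentiable one_ne_zero _
  have h2 := HasMFDerivAt.comp (0 : ℝ) hact.hasMFDerivAt h1
  have hne1 : (Y 1 0).2 ≠ 0 := by rw [hY0]; exact hGH.projTangent_ne_zero h𝔥 hc 1 hu
  have h3 : HasMFDerivAt 𝓘(ℝ, ℝ) 𝓘(ℝ, EM).tangent (fun s => actTangent H EM g (Y 1 s)) 0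
      ((1 : ℝ →L[ℝ] ℝ).smulRight (S.field (actTangent H EM g (Y 1 0)))) := by
    rw [← hS g (Y 1 0) hne1]
    refine h2.congr_mfderiv ?_
    ext
    exact map_smul (bundleMapDeriv (actTangent H EM g) (Y 1 0)) (1 : ℝ) (S.field (Y 1 0))
  have h4 := hasDerivAt_stdCoord (x₀ := x₁) h3 (by
    rw [← congrFun hYg 0, hfst]; exact hg)
  rw [← congrFun hYg 0, hcoord g x₁ hg] at h4
  have h5 : (fun s => stdCoord x₁ (actTangent H EM g (Y 1 s))) = fun s => stdCoord x₁ (Y g s) := by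
    rw [hYg]
  rw [h5] at h4
  exact congrArg Prod.snd (h4.unique (hYd g x₁ hg))

/-- At the origin `leftDeriv` restricts to an isomorphism `e` on `𝔪`, so the equation can be solved:
`η u = e⁻¹ (B u u + 2 𝐆(e u))`. Smoothness and homogeneity come from `𝐆`. -/
lemma exists_isSprayEquation {S : Spray EM (G ⧸ H)} (hS : IsInvariant S)
    {𝔥 𝔪 : Submodule ℝ EG}
    (h𝔥 : ∀ v : EG, v ∈ 𝔥 ↔ ∀ t : ℝ, lieExp G (t • v) ∈ H) (hc : IsCompl 𝔥 𝔪) :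
    ∃ η : 𝔪 → 𝔪, ContDiffOn ℝ ∞ η {0}ᶜ ∧
      (∀ y : 𝔪, y ≠ 0 → ∀ l : ℝ, 0 < l → η (l • y) = l ^ 2 • η y) ∧ IsSprayEquation S 𝔪 η := by
  let o : G ⧸ H := ((1 : G) : G ⧸ H)
  have hs : o ∈ (extChartAt 𝓘(ℝ, EM) o).source := mem_extChartAt_source _
  have ht : cosetChart EM o (1 : G) ∈ (extChartAt 𝓘(ℝ, EM) o).target :=
    (extChartAt 𝓘(ℝ, EM) o).map_source hs
  obtain ⟨e, he⟩ := hGH.exists_equiv_leftDeriv h𝔥 hc (x₁ := o) (g := 1) hs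
  have he' : ∀ u : 𝔪, leftDeriv (cosetChart EM o) (1 : G) (u : EG) = e u := fun u =>
    (congrArg (fun L : 𝔪 →L[ℝ] EM => L u) he).symm
  obtain ⟨B, hB⟩ : ∃ B : EG →L[ℝ] EG →L[ℝ] EM,
      B = leftDeriv (leftDeriv (EG := EG) (cosetChart EM o)) (1 : G) := ⟨_, rfl⟩
  have hsmooth : ContDiffOn ℝ ∞ (fun y : 𝔪 => sprayCoeff S.field o (cosetChart EM o (1 : G)) (e y))
      {0}ᶜ := by
    have h1 : ContDiffOn ℝ ∞ (fun y : 𝔪 => (cosetChart EM o (1 : G), e y)) {0}ᶜ :=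
      (contDiff_const.prodMk e.contDiff).contDiffOn
    have h2 : MapsTo (fun y : 𝔪 => (cosetChart EM o (1 : G), e y)) {0}ᶜ
        ((extChartAt 𝓘(ℝ, EM) o).target ×ˢ {0}ᶜ) := fun y hy => mk_mem_prod ht
      (fun h => hy (e.map_eq_zero_iff.1 h))
    have h3 := (S.smooth o).comp h1 h2
    exact h3
  have hhom : ∀ y : 𝔪, y ≠ 0 → ∀ l : ℝ, 0 < l →
      sprayCoeff S.field o (cosetChart EM o (1 : G)) (e (l • y))
        = l ^ 2 • sprayCoeff S.field o (cosetChart EM o (1 : G)) (e y) := by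
    intro y hy l hl
    rw [map_smul]
    exact S.homogeneous o _ ht _ (fun h => hy (e.map_eq_zero_iff.1 h)) l hl
  have heq : ∀ u : 𝔪, -(2 : ℝ) • sprayCoeff S.field o (cosetChart EM o (1 : G)) (e u)
      = B (u : EG) (u : EG) - e (e.symm (B (u : EG) (u : EG)
        + (2 : ℝ) • sprayCoeff S.field o (cosetChart EM o (1 : G)) (e u))) := by
    intro u
    rw [ContinuousLinearEquiv.apply_symm_apply]
    simp
  generalize hsp : (fun y : 𝔪 => sprayCoeff S.field o (cosetChart EM o (1 : G)) (e y)) = σ at *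
  replace hsp : ∀ y, sprayCoeff S.field o (cosetChart EM o (1 : G)) (e y) = σ y := congrFun hsp
  simp only [hsp] at hhom heq
  refine ⟨fun y => e.symm (B (y : EG) (y : EG) + (2 : ℝ) • σ y), ?_, ?_,
    hGH.isSprayEquation_of_origin hS h𝔥 hc ?_⟩
  · refine e.symm.contDiff.comp_contDiffOn (ContDiffOn.add ?_ (contDiffOn_const.smul hsmooth))
    have h1 : ContDiff ℝ ∞ (fun y : 𝔪 => (y : EG)) := 𝔪.subtypeL.contDiff
    exact ((B.contDiff.comp h1).clm_apply h1).contDiffOn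
  · intro y hy l hl
    rw [← map_smul]
    change e.symm (B ((l • y : 𝔪) : EG) ((l • y : 𝔪) : EG) + (2 : ℝ) • σ (l • y)) = _
    rw [hhom y hy l hl, Submodule.coe_smul]
    congr 1
    simp only [map_smul, smul_apply, smul_add, smul_smul]
    congr 2
    · ring
    · ring
  · intro u hu
    change -(2 : ℝ) • sprayCoeff S.field o (cosetChart EM o (1 : G))
      (leftDeriv (cosetChart EM o) (1 : G) (u : EG)) = _
    rw [he', hsp, heq, hB, ← he']

end IsSmoothCosetSpace

end SprayVector

lemma velocity_congr {E : Type*} [NormedAddCommGroup E] [NormedSpace ℝ E]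
    {M : Type*} [TopologicalSpace M] [ChartedSpace E M]
    {c₁ c₂ : ℝ → M} {t : ℝ} (h : c₁ =ᶠ[𝓝 t] c₂) : velocity (E := E) c₁ t = velocity c₂ t := by
  have h1 : modelDeriv ℝ E c₁ t = modelDeriv ℝ E c₂ t := h.mfderiv_eq
  exact congrArg₂ (fun (x : M) (L : ℝ →L[ℝ] E) => (⟨x, L 1⟩ : TangentBundle 𝓘(ℝ, E) M))
    h.self_of_nhds h1

/-! ### Identification of the spray vector field with the solution of the spray equation. -/

section SprayVector

variable {EG : Type*} [NormedAddCommGroup EG] [NormedSpace ℝ EG] [FiniteDimensional ℝ EG]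
  {G : Type*} [Group G] [TopologicalSpace G] [T2Space G] [ChartedSpace EG G]
  [LieGroup 𝓘(ℝ, EG) ∞ G]
  {H : Subgroup G}
  {EM : Type*} [NormedAddCommGroup EM] [NormedSpace ℝ EM] [ChartedSpace EM (G ⧸ H)]
  [IsManifold 𝓘(ℝ, EM) ∞ (G ⧸ H)]

namespace IsSmoothCosetSpace

variable (hGH : IsSmoothCosetSpace EG H EM)
include hGH

/-- The velocity of the geodesic is `cb(t)_* u(t)`. Its derivative at `0` is computed once from the
geodesic equation and once from `u'(0) = -v`; the spray equation and injectivity on `𝔪` force `v = η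
y`. -/
lemma eq_of_isSprayVector {S : Spray EM (G ⧸ H)} {𝔥 𝔪 : Submodule ℝ EG}
    (h𝔥 : ∀ v : EG, v ∈ 𝔥 ↔ ∀ t : ℝ, lieExp G (t • v) ∈ H) (hc : IsCompl 𝔥 𝔪) {η : 𝔪 → 𝔪}
    (hη : IsSprayEquation S 𝔪 η) {y v : 𝔪} (hv : IsSprayVector S 𝔪 y v) :
    v = η y := by
  obtain ⟨ε, c, cb, u, hε, hgeo, hvel, hcb, hcb0, hccb, hu, hud⟩ := hv
  have hJ : Ioo (-ε) ε ∈ 𝓝 (0 : ℝ) := Ioo_mem_nhds (by linarith) hε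
  have hleft : ∀ t ∈ Ioo (-ε) ε, HasLeftVelocityAt cb (u t : EG) t := by
    intro t ht
    have h1 := ((hcb.contMDiffAt (Ioo_mem_nhds ht.1 ht.2)).mdifferentiableAt (by simp)).hasMFDerivAt
    refine h1.congr_mfderiv ?_
    have h2 : modelDeriv ℝ EG cb t = (1 : ℝ →L[ℝ] ℝ).smulRight (modelDeriv ℝ EG cb t 1) := by
      ext; simp
    exact h2.trans (congrArg (fun e : EG => (1 : ℝ →L[ℝ] ℝ).smulRight e) (hu t ht).2)
  have hveq : ∀ t ∈ Ioo (-ε) ε, velocity c t = projTangent H EM (cb t) (u t : EG) := by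
    intro t ht
    rw [← hGH.velocity_mk (hleft t ht)]
    refine velocity_congr ?_
    filter_upwards [Ioo_mem_nhds ht.1 ht.2] with s hs using hccb s hs
  have h0 : (0 : ℝ) ∈ Ioo (-ε) ε := mem_of_mem_nhds hJ
  have hu0 : u 0 = y := by
    refine hGH.projTangent_injective h𝔥 hc 1 ?_
    change projTangent H EM (1 : G) (u 0 : EG) = projTangent H EM (1 : G) (y : EG)
    rw [← hcb0, ← hveq 0 h0, hvel, hcb0, projTangent_one]
  let o : G ⧸ H := ((1 : G) : G ⧸ H)
  have hs : ((cb 0 : G) : G ⧸ H) ∈ (extChartAt 𝓘(ℝ, EM) o).source := by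
    rw [hcb0]
    exact mem_extChartAt_source _
  have hud' : HasDerivAt (fun t => (u t : EG)) (-(v : EG)) 0 :=
    (𝔪.subtypeL.hasFDerivAt.comp_hasDerivAt (0 : ℝ) hud)
  have h1 := hGH.hasDerivAt_stdCoord_projTangent (hleft 0 h0) hud' hs
  have hv0 := hveq 0 h0
  have hs' : (velocity (E := EM) c 0).1 ∈ (extChartAt 𝓘(ℝ, EM) o).source := by
    rw [hv0, projTangent_fst]; exact hs
  have h2 := hasDerivAt_stdCoord (x₀ := o)
    ((hgeo.integralCurve 0 h0).hasMFDerivAt hJ) hs'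
  have hne : (velocity (E := EM) c 0).2 ≠ 0 := hgeo.velocity_ne_zero 0 h0
  rw [S.fieldCoord_eq hs' hne, hv0, hGH.stdCoord_projTangent hs] at h2
  have h3 : (fun t => stdCoord o (velocity (E := EM) c t)) =ᶠ[𝓝 0]
      fun t => stdCoord o (projTangent H EM (cb t) (u t : EG)) := by
    filter_upwards [hJ] with t ht
    rw [hveq t ht]
  have h4 := congrArg Prod.snd (h2.unique (h1.congr_of_eventuallyEq h3))
  have h5 := hη o (cb 0) hs (u 0) (hu 0 h0).1
  have h6 := h5.symm.trans h4
  rw [map_neg, ← sub_eq_add_neg, sub_right_inj] at h6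
  obtain ⟨e, he⟩ := hGH.exists_equiv_leftDeriv h𝔥 hc hs
  rw [← hu0]
  refine e.injective ?_
  exact (congrArg (fun L : 𝔪 →L[ℝ] EM => L v) he).trans
    (h6.symm.trans (congrArg (fun L : 𝔪 →L[ℝ] EM => L (η (u 0))) he).symm)

/-- Solving `u' = -η(u)` with left velocity `u` gives a curve in `G` whose projection is a geodesic,
by the spray equation at each time. -/
lemma isSprayVector {S : Spray EM (G ⧸ H)} {𝔥 𝔪 : Submodule ℝ EG}
    (h𝔥 : ∀ v : EG, v ∈ 𝔥 ↔ ∀ t : ℝ, lieExp G (t • v) ∈ H) (hc : IsCompl 𝔥 𝔪) {η : 𝔪 → 𝔪}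
    (hηs : ContDiffOn ℝ ∞ η {0}ᶜ) (hη : IsSprayEquation S 𝔪 η) {y : 𝔪} (hy : y ≠ 0) :
    IsSprayVector S 𝔪 y (η y) := by
  obtain ⟨ε, cb, u, hε, hcb0, hu0, hcb, hus, hcu⟩ := exists_curve_of_velocity_equation (G := G)
    𝔪.subtypeL (isOpen_compl_singleton (x := (0 : 𝔪))) hηs.neg (y := y) hy
  have h0 : (0 : ℝ) ∈ Ioo (-ε) ε := ⟨by linarith, hε⟩
  have hleft : ∀ t ∈ Ioo (-ε) ε, HasLeftVelocityAt cb (u t : EG) t := fun t ht => (hcu t ht).2.2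
  have hveq : ∀ t ∈ Ioo (-ε) ε, velocity (fun t => (cb t : G ⧸ H)) t
      = projTangent H EM (cb t) (u t : EG) := fun t ht => hGH.velocity_mk (hleft t ht)
  have hne : ∀ t ∈ Ioo (-ε) ε, u t ≠ 0 := fun t ht => (hcu t ht).1
  have hvne : ∀ t ∈ Ioo (-ε) ε, (velocity (E := EM) (fun t => (cb t : G ⧸ H)) t).2 ≠ 0 := by
    intro t ht
    rw [hveq t ht]
    exact hGH.projTangent_ne_zero h𝔥 hc _ (hne t ht)
  refine ⟨ε, fun t => (cb t : G ⧸ H), cb, u, hε, ⟨?_, hvne, ?_⟩, ?_, hcb, hcb0, fun _ _ => rfl,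
    fun t ht => ⟨hne t ht, ?_⟩, ?_⟩
  · exact hGH.contMDiff_mk.comp_contMDiffOn hcb
  · intro t ht
    refine HasMFDerivAt.hasMFDerivWithinAt ?_
    have hJ : Ioo (-ε) ε ∈ 𝓝 t := Ioo_mem_nhds ht.1 ht.2
    have hev : velocity (E := EM) (fun t => (cb t : G ⧸ H)) =ᶠ[𝓝 t]
        fun s => projTangent H EM (cb s) (u s : EG) := by
      filter_upwards [hJ] with s hs using hveq s hs
    have hs : (cb t : G ⧸ H) ∈ (extChartAt 𝓘(ℝ, EM) (cb t : G ⧸ H)).source :=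
      mem_extChartAt_source _
    have hus' : ContDiffAt ℝ ∞ (fun s => (u s : EG)) t :=
      𝔪.subtypeL.contDiff.contDiffAt.comp t (hus.contDiffAt hJ)
    have hud : HasDerivAt (fun s => (u s : EG)) (-(η (u t) : EG)) t :=
      𝔪.subtypeL.hasFDerivAt.comp_hasDerivAt t (hcu t ht).2.1
    refine hasMFDerivAt_of_stdCoord (x₀ := (cb t : G ⧸ H))
      ((hGH.contMDiffAt_projTangent (hcb.contMDiffAt hJ) hus').congr_of_eventuallyEq hev) hs ?_
    rw [S.fieldCoord_eq hs (hvne t ht), hveq t ht, hGH.stdCoord_projTangent hs]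
    have h1 := (hGH.hasDerivAt_stdCoord_projTangent (hleft t ht) hud hs).congr_of_eventuallyEq
      (hev.fun_comp (stdCoord (cb t : G ⧸ H)))
    refine h1.congr_deriv (Prod.ext rfl ?_)
    refine Eq.trans ?_ (hη _ (cb t) hs (u t) (hne t ht)).symm
    rw [map_neg, ← sub_eq_add_neg]
  · rw [hveq 0 h0, hcb0, hu0, projTangent_one]
  · refine (congrArg (fun L : ℝ →L[ℝ] EG => L 1) (hleft t ht).mfderiv).trans ?_
    exact one_smul ℝ (show EG from leftInv G (u t : EG) (cb t))
  · have := (hcu 0 h0).2.1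
    rwa [hu0] at this

lemma sprayVectorField_eq {S : Spray EM (G ⧸ H)} {𝔥 𝔪 : Submodule ℝ EG}
    (h𝔥 : ∀ v : EG, v ∈ 𝔥 ↔ ∀ t : ℝ, lieExp G (t • v) ∈ H) (hc : IsCompl 𝔥 𝔪) {η : 𝔪 → 𝔪}
    (hηs : ContDiffOn ℝ ∞ η {0}ᶜ) (hη : IsSprayEquation S 𝔪 η) {y : 𝔪} (hy : y ≠ 0) :
    sprayVectorField S 𝔪 y = η y :=
  hGH.eq_of_isSprayVector h𝔥 hc hη
    (Classical.epsilon_spec (p := fun v => IsSprayVector S 𝔪 y v)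
      ⟨η y, hGH.isSprayVector h𝔥 hc hηs hη hy⟩)

end IsSmoothCosetSpace

end SprayVector

lemma Spray.differentiableAt_sprayCoeff {E : Type*} [NormedAddCommGroup E] [NormedSpace ℝ E]
    {M : Type*} [TopologicalSpace M] [ChartedSpace E M] [IsManifold 𝓘(ℝ, E) ∞ M] (S : Spray E M)
    {x₁ : M} {x y : E} (hx : x ∈ (extChartAt 𝓘(ℝ, E) x₁).target) (hy : y ≠ 0) :
    DifferentiableAt ℝ (fun z => sprayCoeff S.field x₁ x z) y := by
  have h1 : ContDiffOn ℝ ∞ (fun z : E => (x, z)) {0}ᶜ :=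
    (contDiff_const.prodMk contDiff_id).contDiffOn
  have h2 : MapsTo (fun z : E => (x, z)) {0}ᶜ ((extChartAt 𝓘(ℝ, E) x₁).target ×ˢ {0}ᶜ) :=
    fun z hz => mk_mem_prod hx hz
  have h3 := ((S.smooth x₁).comp h1 h2).contDiffAt (isOpen_compl_singleton.mem_nhds hy)
  have h4 := h3.differentiableAt (by simp)
  exact h4

/-! ### The connection operator and the connection coefficients. -/

section Connection

variable {EG : Type*} [NormedAddCommGroup EG] [NormedSpace ℝ EG] [FiniteDimensional ℝ EG]
  {G : Type*} [Group G] [TopologicalSpace G] [T2Space G] [ChartedSpace EG G]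
  [LieGroup 𝓘(ℝ, EG) ∞ G]
  {H : Subgroup G}
  {EM : Type*} [NormedAddCommGroup EM] [NormedSpace ℝ EM] [ChartedSpace EM (G ⧸ H)]
  [IsManifold 𝓘(ℝ, EM) ∞ (G ⧸ H)]

namespace IsSmoothCosetSpace

variable (hGH : IsSmoothCosetSpace EG H EM) {S : Spray EM (G ⧸ H)} {𝔥 𝔪 : Submodule ℝ EG}
  (h𝔥 : ∀ v : EG, v ∈ 𝔥 ↔ ∀ t : ℝ, lieExp G (t • v) ∈ H) (hc : IsCompl 𝔥 𝔪) {η : 𝔪 → 𝔪}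
  (hηs : ContDiffOn ℝ ∞ η {0}ᶜ) (hη : IsSprayEquation S 𝔪 η)

include hηs in
omit [FiniteDimensional ℝ EG] [LieGroup 𝓘(ℝ, EG) ∞ G] [T2Space G] [TopologicalSpace G]
  [ChartedSpace EG G] [Group G] in
lemma hasDerivAt_comp_line {y : 𝔪} (hy : y ≠ 0) (w : 𝔪) :
    HasDerivAt (fun t : ℝ => η (y + t • w)) (fderiv ℝ η y w) 0 := by
  have h1 : HasDerivAt (fun t : ℝ => y + t • w) w 0 := by
    simpa using ((hasDerivAt_id (0 : ℝ)).smul_const w).const_add y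
  have h2 : HasFDerivAt η (fderiv ℝ η y) (y + (0 : ℝ) • w) := by
    rw [zero_smul, add_zero]
    exact ((hηs.contDiffAt (isOpen_compl_singleton.mem_nhds hy)).differentiableAt
      (by simp)).hasFDerivAt
  exact h2.comp_hasDerivAt (0 : ℝ) h1

omit [FiniteDimensional ℝ EG] in
lemma eventually_line_ne_zero {y : 𝔪} (hy : y ≠ 0) (w : 𝔪) :
    ∀ᶠ t : ℝ in 𝓝 0, y + t • w ≠ 0 := by
  have h1 : ContinuousAt (fun t : ℝ => y + t • w) 0 := by fun_prop
  exact h1.eventually_ne (by simpa using hy)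

-- `sprayVectorField` has a junk value at `0`, but `y + t • w` avoids `0` for small `t`, so the
-- derivative only sees `η`.
include hGH h𝔥 hηs hη in
lemma connOp_eq {y : 𝔪} (hy : y ≠ 0) (w : 𝔪) :
    connOp S hc y w = (1 / 2 : ℝ) • fderiv ℝ η y w
      - (1 / 2 : ℝ) • 𝔪.projectionOnto 𝔥 hc.symm (lieBr G (y : EG) (w : EG)) := by
  have h1 : (fun t : ℝ => sprayVectorField S 𝔪 (y + t • w)) =ᶠ[𝓝 0] fun t => η (y + t • w) := by
    filter_upwards [eventually_line_ne_zero hy w] with t ht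
    exact hGH.sprayVectorField_eq h𝔥 hc hηs hη ht
  rw [connOp, h1.deriv_eq, (hasDerivAt_comp_line hηs hy w).deriv]

include hGH h𝔥 hηs hη in
lemma contDiffOn_connOp (w : 𝔪) : ContDiffOn ℝ ∞ (fun y : 𝔪 => connOp S hc y w) {0}ᶜ := by
  have h1 : ContDiffOn ℝ ∞ (fun y => fderiv ℝ η y w) {0}ᶜ :=
    (hηs.fderiv_of_isOpen isOpen_compl_singleton (by simp)).clm_apply contDiffOn_const
  obtain ⟨B, hB⟩ : ∃ B : EG →L[ℝ] EG →L[ℝ] EG, ∀ v w : EG, lieBr G v w = B v w - B w v :=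
    ⟨_, lieBr_eq (G := G)⟩
  have h2 : ContDiff ℝ ∞ (fun y : 𝔪 => lieBr G (y : EG) (w : EG)) := by
    simp only [hB]
    have h3 : ContDiff ℝ ∞ (fun y : 𝔪 => (y : EG)) := 𝔪.subtypeL.contDiff
    exact ((B.contDiff.comp h3).clm_apply contDiff_const).sub (contDiff_const.clm_apply h3)
  have h4 : ContDiff ℝ ∞ (fun y : 𝔪 => 𝔪.projectionOnto 𝔥 hc.symm (lieBr G (y : EG) (w : EG))) :=
    (LinearMap.toContinuousLinearMap (𝔪.projectionOnto 𝔥 hc.symm)).contDiff.comp h2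
  have h5 : ContDiffOn ℝ ∞ (fun y => (1 / 2 : ℝ) • fderiv ℝ η y w) {0}ᶜ := h1.const_smul _
  have h6 : ContDiff ℝ ∞ (fun y : 𝔪 => (1 / 2 : ℝ) • 𝔪.projectionOnto 𝔥 hc.symm
      (lieBr G (y : EG) (w : EG))) := h4.const_smul _
  refine (h5.sub h6.contDiffOn).congr fun y hy => ?_
  exact hGH.connOp_eq h𝔥 hc hηs hη hy w

include hGH h𝔥 hηs hη in
lemma connOp_smul (hηh : ∀ y : 𝔪, y ≠ 0 → ∀ l : ℝ, 0 < l → η (l • y) = l ^ 2 • η y) (w : 𝔪)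
    {y : 𝔪} (hy : y ≠ 0) {l : ℝ} (hl : 0 < l) :
    connOp S hc (l • y) w = l • connOp S hc y w := by
  have hly : l • y ≠ 0 := smul_ne_zero hl.ne' hy
  have h1 : fderiv ℝ η (l • y) w = l • fderiv ℝ η y w := by
    -- The increment is scaled as well, so that `l • y + t • l • w = l • (y + t • w)` and
    -- homogeneity applies along the line.
    have h2 := hasDerivAt_comp_line hηs hly (l • w)
    have h3 := (hasDerivAt_comp_line hηs hy w).const_smul (l ^ 2)
    have h4 : (fun t : ℝ => η (l • y + t • l • w)) =ᶠ[𝓝 0] fun t => l ^ 2 • η (y + t • w) := by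
      filter_upwards [eventually_line_ne_zero hy w] with t ht
      rw [← hηh _ ht l hl, smul_add, smul_comm]
    have h5 := h2.unique (h3.congr_of_eventuallyEq h4)
    rw [map_smul, pow_two, mul_smul] at h5
    exact smul_right_injective _ hl.ne' h5
  have h2 : lieBr G ((l • y : 𝔪) : EG) (w : EG) = l • lieBr G (y : EG) (w : EG) := by
    rw [lieBr_eq, lieBr_eq, Submodule.coe_smul, map_smul, map_smul, smul_apply,
      smul_sub]
  rw [hGH.connOp_eq h𝔥 hc hηs hη hly, hGH.connOp_eq h𝔥 hc hηs hη hy, h1, h2, map_smul, smul_sub,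
    smul_comm l, smul_comm l]

include hGH h𝔥 hηs hη in
/-- The connection coefficients of an invariant spray structure in terms of its connection
operator. -/
lemma leftDeriv_leftDeriv_add_connCoeff {x₁ : G ⧸ H} {g : G}
    (hg : (g : G ⧸ H) ∈ (extChartAt 𝓘(ℝ, EM) x₁).source) {u : 𝔪} (hu : u ≠ 0) (w : 𝔪) :
    leftDeriv (leftDeriv (EG := EG) (cosetChart EM x₁)) g (w : EG) (u : EG)
      + S.connCoeff x₁ (cosetChart EM x₁ g) (leftDeriv (cosetChart EM x₁) g (u : EG))
        (leftDeriv (cosetChart EM x₁) g (w : EG))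
      = leftDeriv (cosetChart EM x₁) g (connOp S hc u w : EG) := by
  obtain ⟨B, hB⟩ : ∃ B : EG →L[ℝ] EG →L[ℝ] EM,
    B = leftDeriv (leftDeriv (EG := EG) (cosetChart EM x₁)) g := ⟨_, rfl⟩
  obtain ⟨L, hL⟩ : ∃ L : EG →L[ℝ] EM, L = leftDeriv (cosetChart EM x₁) g := ⟨_, rfl⟩
  obtain ⟨e, he⟩ := hGH.exists_equiv_leftDeriv h𝔥 hc hg
  have hLe : ∀ v : 𝔪, L (v : EG) = e v := fun v => by
    rw [hL]
    exact (congrArg (fun K : 𝔪 →L[ℝ] EM => K v) he).symm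
  have hLu : L (u : EG) ≠ 0 := by
    rw [hLe]
    exact fun h => hu (e.map_eq_zero_iff.1 h)
  have hbr := leftDeriv_leftDeriv_sub_at (hGH.contMDiffAt_cosetChart hg) (w : EG) (u : EG)
  have hanti : lieBr G (w : EG) (u : EG) = -lieBr G (u : EG) (w : EG) := by
    rw [lieBr_eq, lieBr_eq, neg_sub]
  -- `L` kills the `𝔥`-component, so only the `𝔪`-part of the bracket survives. No reductivity is
  -- needed.
  have hproj : L (lieBr G (u : EG) (w : EG))
      = L (𝔪.projectionOnto 𝔥 hc.symm (lieBr G (u : EG) (w : EG)) : EG) := by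
    set b := lieBr G (u : EG) (w : EG)
    have h1 : b - (𝔪.projectionOnto 𝔥 hc.symm b : EG) ∈ 𝔥 := by
      rw [← Submodule.projectionOnto_apply_eq_zero_iff hc.symm, map_sub,
        Submodule.projectionOnto_apply_left, sub_self]
    have h2 := hGH.leftDeriv_cosetChart_eq_zero ((h𝔥 _).1 h1) hg
    rw [← hL, map_sub, sub_eq_zero] at h2
    exact h2
  rw [← hB, ← hL, hanti, map_neg, hproj] at hbr
  have hxt : cosetChart EM x₁ g ∈ (extChartAt 𝓘(ℝ, EM) x₁).target :=
    (extChartAt 𝓘(ℝ, EM) x₁).map_source hg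
  have hφ := S.differentiableAt_sprayCoeff hxt hLu
  have hline : HasDerivAt (fun t : ℝ => L ((u + t • w : 𝔪) : EG)) (L (w : EG)) 0 := by
    have h1 : HasDerivAt (fun t : ℝ => u + t • w) w 0 := by
      simpa using ((hasDerivAt_id (0 : ℝ)).smul_const w).const_add u
    exact (L.comp 𝔪.subtypeL).hasFDerivAt.comp_hasDerivAt (0 : ℝ) h1
  have hd1 : HasDerivAt (fun t : ℝ => -(2 : ℝ) • sprayCoeff S.field x₁ (cosetChart EM x₁ g)
      (L ((u + t • w : 𝔪) : EG)))
      (-(2 : ℝ) • S.connCoeff x₁ (cosetChart EM x₁ g) (L (u : EG)) (L (w : EG))) 0 := by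
    have h1 : HasFDerivAt (fun z => sprayCoeff S.field x₁ (cosetChart EM x₁ g) z)
        (fderiv ℝ (fun z => sprayCoeff S.field x₁ (cosetChart EM x₁ g) z) (L (u : EG)))
        (L ((u + (0 : ℝ) • w : 𝔪) : EG)) := by
      rw [zero_smul, add_zero]
      exact hφ.hasFDerivAt
    exact (h1.comp_hasDerivAt (0 : ℝ) hline).const_smul (-(2 : ℝ))
  have hd2 : HasDerivAt (fun t : ℝ => B ((u + t • w : 𝔪) : EG) ((u + t • w : 𝔪) : EG)
      - L (η (u + t • w) : EG))
      (B (w : EG) (u : EG) + B (u : EG) (w : EG) - L (fderiv ℝ η u w : EG)) 0 := by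
    have h1 : HasDerivAt (fun t : ℝ => ((u + t • w : 𝔪) : EG)) (w : EG) 0 := by
      have h2 : HasDerivAt (fun t : ℝ => u + t • w) w 0 := by
        simpa using ((hasDerivAt_id (0 : ℝ)).smul_const w).const_add u
      exact 𝔪.subtypeL.hasFDerivAt.comp_hasDerivAt (0 : ℝ) h2
    have h3 := (B.hasFDerivAt.comp_hasDerivAt (0 : ℝ) h1).clm_apply h1
    have h4 := (L.comp 𝔪.subtypeL).hasFDerivAt.comp_hasDerivAt (0 : ℝ)
      (hasDerivAt_comp_line hηs hu w)
    refine (h3.sub h4).congr_deriv ?_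
    simp
  -- The spray equation along the line `u + t • w`; differentiating it polarizes the quadratic term
  -- `B u u` into `B w u + B u w`.
  have hev : (fun t : ℝ => -(2 : ℝ) • sprayCoeff S.field x₁ (cosetChart EM x₁ g)
      (L ((u + t • w : 𝔪) : EG))) =ᶠ[𝓝 0] fun t : ℝ =>
        B ((u + t • w : 𝔪) : EG) ((u + t • w : 𝔪) : EG) - L (η (u + t • w) : EG) := by
    filter_upwards [eventually_line_ne_zero hu w] with t ht
    rw [hL, hB]
    exact hη x₁ g hg _ ht
  have hfin := hd1.unique (hd2.congr_of_eventuallyEq hev)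
  rw [← hB, ← hL, hGH.connOp_eq h𝔥 hc hηs hη hu]
  simp only [Submodule.coe_sub, Submodule.coe_smul, map_sub, map_smul]
  have h1 : S.connCoeff x₁ (cosetChart EM x₁ g) (L (u : EG)) (L (w : EG))
      = -(1 / 2 : ℝ) • (B (w : EG) (u : EG) + B (u : EG) (w : EG) - L (fderiv ℝ η u w : EG)) := by
    rw [← hfin, smul_smul]
    norm_num
  have h2 : B (u : EG) (w : EG) = B (w : EG) (u : EG)
      + L (𝔪.projectionOnto 𝔥 hc.symm (lieBr G (u : EG) (w : EG)) : EG) := by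
    rw [← sub_eq_iff_eq_add', ← neg_sub, hbr, neg_neg]
  rw [h1, h2]
  module

end IsSmoothCosetSpace

end Connection

/-! ### Parallel fields along `exp(tw) · o` as solutions of an ODE on `𝔪`. -/

section Transport

variable {EG : Type*} [NormedAddCommGroup EG] [NormedSpace ℝ EG] [FiniteDimensional ℝ EG]
  {G : Type*} [Group G] [TopologicalSpace G] [T2Space G] [ChartedSpace EG G]
  [LieGroup 𝓘(ℝ, EG) ∞ G]
  {H : Subgroup G}
  {EM : Type*} [NormedAddCommGroup EM] [NormedSpace ℝ EM] [ChartedSpace EM (G ⧸ H)]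
  [IsManifold 𝓘(ℝ, EM) ∞ (G ⧸ H)]

namespace IsSmoothCosetSpace

variable (hGH : IsSmoothCosetSpace EG H EM) {S : Spray EM (G ⧸ H)} {𝔥 𝔪 : Submodule ℝ EG}
  (h𝔥 : ∀ v : EG, v ∈ 𝔥 ↔ ∀ t : ℝ, lieExp G (t • v) ∈ H) (hc : IsCompl 𝔥 𝔪) {η : 𝔪 → 𝔪}
  (hηs : ContDiffOn ℝ ∞ η {0}ᶜ) (hη : IsSprayEquation S 𝔪 η)
include hGH h𝔥 hηs hη

/-- The nonlinear covariant derivative along the projection of a one-parameter subgroup, in the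
trivialization given by the one-parameter subgroup. -/
lemma nonlinCovDeriv_projTangent {w : 𝔪} {y : ℝ → 𝔪} {y' : 𝔪} {t : ℝ} (hy : HasDerivAt y y' t)
    (hy0 : y t ≠ 0) :
    S.nonlinCovDeriv (fun s => ((lieExp G (s • (w : EG)) : G) : G ⧸ H))
        (fun s => projTangent H EM (lieExp G (s • (w : EG))) (y s : EG)) t
      = leftDeriv (cosetChart EM ((lieExp G (t • (w : EG)) : G) : G ⧸ H)) (lieExp G (t • (w : EG)))
        ((y' + connOp S hc (y t) w : 𝔪) : EG) := by
  have hvel := lieExp_hasLeftVelocityAt (G := G) (w : EG) t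
  set g : G := lieExp G (t • (w : EG)) with hg
  have hs : (g : G ⧸ H) ∈ (extChartAt 𝓘(ℝ, EM) (g : G ⧸ H)).source := mem_extChartAt_source _
  have hy' : HasDerivAt (fun s => (y s : EG)) (y' : EG) t :=
    𝔪.subtypeL.hasFDerivAt.comp_hasDerivAt t hy
  have h1 : HasDerivAt (fun s => (stdCoord (g : G ⧸ H)
      (projTangent H EM (lieExp G (s • (w : EG))) (y s : EG))).2)
      (leftDeriv (leftDeriv (EG := EG) (cosetChart EM (g : G ⧸ H))) g (w : EG) (y t : EG)
          + leftDeriv (cosetChart EM (g : G ⧸ H)) g (y' : EG)) t :=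
    (hGH.hasDerivAt_stdCoord_projTangent hvel hy' (x₁ := (g : G ⧸ H)) hs).snd
  have h2 := hGH.leftDeriv_leftDeriv_add_connCoeff h𝔥 hc hηs hη hs hy0 w
  have h3 := hGH.velocity_mk hvel
  rw [Spray.nonlinCovDeriv, h1.deriv, h3]
  simp only [← hg]
  rw [hGH.stdCoord_projTangent hs, hGH.stdCoord_projTangent hs, Submodule.coe_add, map_add, ← h2]
  abel

lemma isNonlinParallel_projTangent {w : 𝔪} {y : ℝ → 𝔪} (hy0 : ∀ t, y t ≠ 0)
    (hys : ContDiff ℝ ∞ y) (hy : ∀ t, HasDerivAt y (-connOp S hc (y t) w) t) :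
    S.IsNonlinParallel (fun s => ((lieExp G (s • (w : EG)) : G) : G ⧸ H))
      (fun s => projTangent H EM (lieExp G (s • (w : EG))) (y s : EG)) where
  along t := projTangent_fst _ _
  smooth t := hGH.contMDiffAt_projTangent (contMDiff_lieExp_smul (w : EG)).contMDiffAt
    (𝔪.subtypeL.contDiff.comp hys).contDiffAt
  ne_zero t := hGH.projTangent_ne_zero h𝔥 hc _ (hy0 t)
  parallel t := by
    rw [hGH.nonlinCovDeriv_projTangent h𝔥 hc hηs hη (hy t) (hy0 t), neg_add_cancel,
      Submodule.coe_zero, map_zero]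

/-- The representative `y t` is obtained fibre by fibre, so its differentiability must be proved:
near `t` it is the inverse of `leftDeriv` on `𝔪` applied to the components of `X`, and operator
inversion is differentiable at invertible maps. The covariant derivative formula then gives the
equation. -/
lemma exists_of_isNonlinParallel {w : 𝔪} {X : ℝ → TangentBundle 𝓘(ℝ, EM) (G ⧸ H)}
    (hX : S.IsNonlinParallel (fun s => ((lieExp G (s • (w : EG)) : G) : G ⧸ H)) X) :
    ∃ y : ℝ → 𝔪, (∀ t, X t = projTangent H EM (lieExp G (t • (w : EG))) (y t : EG)) ∧
      (∀ t, y t ≠ 0) ∧ ∀ t, HasDerivAt y (-connOp S hc (y t) w) t := by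
  have hrep : ∀ t, ∃ y : 𝔪, X t = projTangent H EM (lieExp G (t • (w : EG))) (y : EG) := by
    intro t
    set g : G := lieExp G (t • (w : EG)) with hg
    have hs : (g : G ⧸ H) ∈ (extChartAt 𝓘(ℝ, EM) (g : G ⧸ H)).source := mem_extChartAt_source _
    have hXg : (X t).1 = (g : G ⧸ H) := hX.along t
    obtain ⟨e, he⟩ := hGH.exists_equiv_leftDeriv h𝔥 hc hs
    refine ⟨e.symm (stdCoord (g : G ⧸ H) (X t)).2, stdCoord_injOn (x₀ := (g : G ⧸ H))
      (by rw [hXg]; exact hs) (by rw [projTangent_fst]; exact hs) ?_⟩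
    rw [hGH.stdCoord_projTangent hs]
    refine Prod.ext (congrArg (extChartAt 𝓘(ℝ, EM) (g : G ⧸ H)) hXg) ?_
    exact (e.apply_symm_apply _).symm.trans (congrArg (fun K : 𝔪 →L[ℝ] EM => K _) he)
  choose y hy using hrep
  have hy0 : ∀ t, y t ≠ 0 := by
    intro t h
    refine hX.ne_zero t ?_
    rw [hy t, h, ← stdCoord_snd_eq_zero_iff (x₀ := ((lieExp G (t • (w : EG)) : G) : G ⧸ H))
      (by rw [projTangent_fst]; exact mem_extChartAt_source _),
      hGH.stdCoord_projTangent (mem_extChartAt_source _), Submodule.coe_zero, map_zero]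
  refine ⟨y, hy, hy0, fun t => ?_⟩
  have hvel := lieExp_hasLeftVelocityAt (G := G) (w : EG) t
  set x₁ : G ⧸ H := ((lieExp G (t • (w : EG)) : G) : G ⧸ H) with hx₁
  have hs : ((lieExp G (t • (w : EG)) : G) : G ⧸ H) ∈ (extChartAt 𝓘(ℝ, EM) x₁).source :=
    mem_extChartAt_source _
  have hev := hGH.eventually_mem_source hvel.continuousAt hs
  have hΛ : DifferentiableAt ℝ (fun s : ℝ =>
      (leftDeriv (EG := EG) (cosetChart EM x₁) (lieExp G (s • (w : EG)))).comp 𝔪.subtypeL) t := by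
    have h1 : ContMDiffAt 𝓘(ℝ, ℝ) 𝓘(ℝ, EG →L[ℝ] EM) ∞
        (fun s : ℝ => leftDeriv (EG := EG) (cosetChart EM x₁) (lieExp G (s • (w : EG)))) t :=
      ContMDiffAt.comp t (contMDiffAt_leftDeriv (hGH.contMDiffAt_cosetChart hs))
        (contMDiff_lieExp_smul (w : EG)).contMDiffAt
    exact (h1.contDiffAt.differentiableAt (by simp)).clm_comp (differentiableAt_const _)
  obtain ⟨e, he⟩ := hGH.exists_equiv_leftDeriv h𝔥 hc hs
  have hinv : DifferentiableAt ℝ (fun s : ℝ => ContinuousLinearMap.inverse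
      ((leftDeriv (EG := EG) (cosetChart EM x₁) (lieExp G (s • (w : EG)))).comp 𝔪.subtypeL)) t := by
    have h1 : DifferentiableAt ℝ (ContinuousLinearMap.inverse : (𝔪 →L[ℝ] EM) → EM →L[ℝ] 𝔪)
        ((leftDeriv (EG := EG) (cosetChart EM x₁) (lieExp G (t • (w : EG)))).comp 𝔪.subtypeL) := by
      rw [← he]
      exact (contDiffAt_map_inverse (n := 1) e).differentiableAt one_ne_zero
    exact DifferentiableAt.comp (𝕜 := ℝ) (E := ℝ) (F := 𝔪 →L[ℝ] EM) (G := EM →L[ℝ] 𝔪) t h1 hΛ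
  have hXt : (X t).1 ∈ (extChartAt 𝓘(ℝ, EM) x₁).source := by
    rw [hX.along t]; exact hs
  have hXs : DifferentiableAt ℝ (fun s => (stdCoord x₁ (X s)).2) t := by
    have h1 : ContMDiffAt 𝓘(ℝ, ℝ) 𝓘(ℝ, EM × EM) ∞ (fun s => stdCoord x₁ (X s)) t :=
      ContMDiffAt.comp t (contMDiffAt_stdCoord hXt) hX.smooth.contMDiffAt
    exact (h1.contDiffAt.differentiableAt (by simp)).snd
  have hyd : DifferentiableAt ℝ y t := by
    refine (hinv.clm_apply hXs).congr_of_eventuallyEq ?_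
    filter_upwards [hev] with s hs
    obtain ⟨e, he⟩ := hGH.exists_equiv_leftDeriv h𝔥 hc hs
    rw [hy s, hGH.stdCoord_projTangent hs, ← he, ContinuousLinearMap.inverse_equiv]
    exact (e.symm_apply_apply (y s)).symm.trans
      (congrArg e.symm (congrArg (fun K : 𝔪 →L[ℝ] EM => K (y s)) he))
  have h1 := hX.parallel t
  have hXe : X = fun s => projTangent H EM (lieExp G (s • (w : EG))) (y s : EG) := funext hy
  rw [hXe, hGH.nonlinCovDeriv_projTangent h𝔥 hc hηs hη hyd.hasDerivAt (hy0 t)] at h1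
  have h2 : e (deriv y t + connOp S hc (y t) w) = 0 :=
    (congrArg (fun K : 𝔪 →L[ℝ] EM => K (deriv y t + connOp S hc (y t) w)) he).trans h1
  rw [e.map_eq_zero_iff, add_eq_zero_iff_eq_neg] at h2
  exact hyd.hasDerivAt.congr_deriv h2

end IsSmoothCosetSpace

end Transport

/-! ### One-parameter groups and their orbits. -/

section OneParamGroup

variable {V : Type*} [NormedAddCommGroup V] [NormedSpace ℝ V]

lemma IsOneParamGroup.eq_flow {Z : V → V} {C : NNReal} (hZ : LipschitzOnWith C Z {0}ᶜ)
    {ρ : ℝ → slit V → slit V} (hρ : IsOneParamGroup ρ fun y => Z (y : V)) {y : slit V}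
    {α : ℝ → V} (hα0 : α 0 = y) (hα : ∀ t, α t ≠ 0) (hαd : ∀ t, HasDerivAt α (Z (α t)) t) (t : ℝ) :
    (ρ t y : V) = α t := by
  have h := ODE_solution_unique_univ (v := fun _ => Z) (s := fun _ => ({0}ᶜ : Set V)) (K := C)
    (t₀ := 0) (f := fun t => (ρ t y : V)) (g := α) (fun _ => hZ)
    (fun t => ⟨hρ.generator t y, (ρ t y).2⟩) (fun t => ⟨hαd t, hα t⟩) (by
      simp only [hρ.zero, hα0])
  exact congrFun h t

lemma exists_isOneParamGroup {Z : V → V} {ρ : ℝ → V → V} (h0 : ∀ y ≠ 0, ρ 0 y = y)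
    (hne : ∀ t, ∀ y ≠ 0, ρ t y ≠ 0) (hadd : ∀ s t, ∀ y ≠ 0, ρ (s + t) y = ρ s (ρ t y))
    (hd : ∀ y ≠ 0, ∀ t, HasDerivAt (fun s => ρ s y) (Z (ρ t y)) t)
    (hs : ContDiffOn ℝ ∞ (fun q : ℝ × V => ρ q.1 q.2) (univ ×ˢ {0}ᶜ)) :
    IsOneParamGroup (fun t (y : slit V) => (⟨ρ t y, hne t y y.2⟩ : slit V)) fun y => Z (y : V) where
  zero y := Subtype.ext (h0 y y.2)
  add s t y := Subtype.ext (hadd s t y y.2)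
  generator t y := hd y y.2 t
  smooth := by
    rw [← ContMDiff.subtypeVal_comp_iff]
    intro q
    have h1 : ContDiffAt ℝ ∞ (fun q : ℝ × V => ρ q.1 q.2) (q.1, (q.2 : V)) :=
      hs.contDiffAt ((isOpen_univ.prod isOpen_compl_singleton).mem_nhds ⟨mem_univ _, q.2.2⟩)
    have h2 : ContMDiffAt (𝓘(ℝ, ℝ).prod 𝓘(ℝ, V)) 𝓘(ℝ, ℝ × V) ∞
        (fun q : ℝ × slit V => (q.1, (q.2 : V))) q :=
      contMDiffAt_fst.prodMk_space
        (ContMDiffAt.comp q contMDiff_subtype_val.contMDiffAt contMDiffAt_snd)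
    exact ContMDiffAt.comp (g := fun q : ℝ × V => ρ q.1 q.2) q h1.contMDiffAt h2

end OneParamGroup

end SprayGeometry

end

/-! ### The main theorem. -/

theorem corollary6p6
    {EG : Type*} [NormedAddCommGroup EG] [NormedSpace ℝ EG] [FiniteDimensional ℝ EG]
    {G : Type*} [Group G] [TopologicalSpace G] [T2Space G] [ChartedSpace EG G]
    [LieGroup 𝓘(ℝ, EG) ∞ G]
    (H : Subgroup G)
    {EM : Type*} [NormedAddCommGroup EM] [NormedSpace ℝ EM] [FiniteDimensional ℝ EM]
    [ChartedSpace EM (G ⧸ H)] [IsManifold 𝓘(ℝ, EM) ∞ (G ⧸ H)]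
    (hGH : SprayGeometry.IsSmoothCosetSpace EG H EM)
    (S : SprayGeometry.Spray EM (G ⧸ H)) (hS : SprayGeometry.IsInvariant S)
    (𝔥 𝔪 : Submodule ℝ EG)
    (h𝔥 : ∀ v : EG, v ∈ 𝔥 ↔ ∀ t : ℝ, SprayGeometry.lieExp G (t • v) ∈ H)
    (hc : IsCompl 𝔥 𝔪)
    (w : 𝔪) (hw : w ≠ 0)
    (c : ℝ → G ⧸ H)
    (hcurve : ∀ t : ℝ, c t = SprayGeometry.lieExp G (t • (w : EG)) • ((1 : G) : G ⧸ H)) :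
    -- the vector field `-N(·, w)` on `𝔪 ∖ 0` is smooth and generates a one-parameter group
    ContDiffOn ℝ ∞ (fun y : 𝔪 => -SprayGeometry.connOp S hc y w) {0}ᶜ ∧
    (∃! ρ : ℝ → SprayGeometry.slit 𝔪 → SprayGeometry.slit 𝔪,
      SprayGeometry.IsOneParamGroup ρ (fun y => -SprayGeometry.connOp S hc (y : 𝔪) w)) ∧
    -- nonlinearly parallel translation along `c` is well defined for all times
    (∀ y : 𝔪, y ≠ 0 → ∃! X : ℝ → TangentBundle 𝓘(ℝ, EM) (G ⧸ H),
      S.IsNonlinParallel c X ∧ X 0 = SprayGeometry.originVec H EM (y : EG)) ∧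
    -- the formula `ρ_t = (exp(-tw))_* ∘ P_{c;0,t}`
    (∀ ρ : ℝ → SprayGeometry.slit 𝔪 → SprayGeometry.slit 𝔪,
      SprayGeometry.IsOneParamGroup ρ (fun y => -SprayGeometry.connOp S hc (y : 𝔪) w) →
      ∀ (t : ℝ) (y : SprayGeometry.slit 𝔪),
        SprayGeometry.originVec H EM ((ρ t y : 𝔪) : EG)
          = SprayGeometry.actTangent H EM (SprayGeometry.lieExp G (-(t • (w : EG))))
              (S.nonlinTransport c 0 t (SprayGeometry.originVec H EM ((y : 𝔪) : EG)))) := by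
  have hcurve' : c = fun t => ((SprayGeometry.lieExp G (t • (w : EG)) : G) : G ⧸ H) := by
    funext t
    rw [hcurve]
    exact SprayGeometry.projTangent_fst (EM := EM) _ (0 : EG)
  subst hcurve'
  obtain ⟨η, hηs, hηh, hη⟩ := hGH.exists_isSprayEquation hS h𝔥 hc
  have hZs : ContDiffOn ℝ ∞ (fun y : 𝔪 => -SprayGeometry.connOp S hc y w) {0}ᶜ :=
    (hGH.contDiffOn_connOp h𝔥 hc hηs hη w).neg
  have hZh : ∀ y : 𝔪, y ≠ 0 → ∀ l : ℝ, 0 < l →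
      -SprayGeometry.connOp S hc (l • y) w = l • -SprayGeometry.connOp S hc y w := by
    intro y hy l hl
    rw [hGH.connOp_smul h𝔥 hc hηs hη hηh w hy hl, smul_neg]
  obtain ⟨C, hC, -⟩ := SprayGeometry.exists_lipschitzOnWith_of_homogeneous hZs hZh
  obtain ⟨ρ, hρ0, hρne, hρadd, hρd, hρs⟩ := SprayGeometry.exists_flow_of_homogeneous hZs hZh
  have hρt : ∀ y : 𝔪, y ≠ 0 → ContDiff ℝ ∞ fun t => ρ t y := by
    intro y hy
    have h1 : ContDiff ℝ ∞ fun t : ℝ => (t, y) := contDiff_id.prodMk contDiff_const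
    exact contDiffOn_univ.1 (hρs.comp h1.contDiffOn fun t _ => ⟨mem_univ t, hy⟩)
  have hpar : ∀ y : 𝔪, y ≠ 0 → S.IsNonlinParallel
      (fun t => ((SprayGeometry.lieExp G (t • (w : EG)) : G) : G ⧸ H))
      (fun t => SprayGeometry.projTangent H EM (SprayGeometry.lieExp G (t • (w : EG))) (ρ t y : EG)) :=
    fun y hy => hGH.isNonlinParallel_projTangent h𝔥 hc hηs hη (fun t => hρne t y hy) (hρt y hy)
      (hρd y hy)
  have hpar0 : ∀ y : 𝔪, y ≠ 0 → SprayGeometry.projTangent H EM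
      (SprayGeometry.lieExp G ((0 : ℝ) • (w : EG))) (ρ 0 y : EG)
        = SprayGeometry.originVec H EM (y : EG) := by
    intro y hy
    rw [SprayGeometry.lieExp_zero_smul, hρ0 y hy, SprayGeometry.projTangent_one]
  -- In the moving frame any parallel field solves the ODE of the flow, whose field is Lipschitz on
  -- `𝔪 ∖ 0`; equal initial values force equality with the flow line.
  have huniq : ∀ y : 𝔪, y ≠ 0 → ∀ X : ℝ → TangentBundle 𝓘(ℝ, EM) (G ⧸ H),
      S.IsNonlinParallel (fun t => ((SprayGeometry.lieExp G (t • (w : EG)) : G) : G ⧸ H)) X →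
      X 0 = SprayGeometry.originVec H EM (y : EG) → X = fun t =>
        SprayGeometry.projTangent H EM (SprayGeometry.lieExp G (t • (w : EG))) (ρ t y : EG) := by
    intro y hy X hX hX0
    obtain ⟨z, hz, hz0, hzd⟩ := hGH.exists_of_isNonlinParallel h𝔥 hc hηs hη hX
    have hz1 : z 0 = y := by
      refine hGH.projTangent_injective h𝔥 hc 1 ?_
      change SprayGeometry.projTangent H EM (1 : G) (z 0 : EG)
        = SprayGeometry.projTangent H EM (1 : G) (y : EG)
      rw [SprayGeometry.projTangent_one (y : EG), ← hX0, hz 0, SprayGeometry.lieExp_zero_smul]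
    have hzρ : z = fun t => ρ t y :=
      ODE_solution_unique_univ (v := fun _ y => -SprayGeometry.connOp S hc y w)
        (s := fun _ => ({0}ᶜ : Set 𝔪)) (K := C) (t₀ := 0) (fun _ => hC)
        (fun t => ⟨hzd t, hz0 t⟩) (fun t => ⟨hρd y hy t, hρne t y hy⟩) (by rw [hz1, hρ0 y hy])
    funext t
    rw [hz t, hzρ]
  refine ⟨hZs, ⟨_, SprayGeometry.exists_isOneParamGroup
    (Z := fun y : 𝔪 => -SprayGeometry.connOp S hc y w) hρ0 hρne hρadd hρd hρs, ?_⟩, ?_, ?_⟩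
  · intro ρ' hρ'
    funext t y
    exact Subtype.ext (SprayGeometry.IsOneParamGroup.eq_flow
      (Z := fun y : 𝔪 => -SprayGeometry.connOp S hc y w) hC hρ' (hρ0 y y.2) (fun t => hρne t y y.2) (hρd y y.2) t)
  · exact fun y hy => ⟨_, ⟨hpar y hy, hpar0 y hy⟩, fun X hX => huniq y hy X hX.1 hX.2⟩
  · intro ρ' hρ' t y
    have hy : (y : 𝔪) ≠ 0 := y.2
    rw [SprayGeometry.IsOneParamGroup.eq_flow
      (Z := fun y : 𝔪 => -SprayGeometry.connOp S hc y w) hC hρ' (hρ0 y hy) (fun t => hρne t y hy) (hρd y hy) t]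
    -- The chosen value of the transport comes from some parallel field, which `huniq` identifies as
    -- `exp(tw)_* ρ_t y`; then `exp(-tw)` cancels `exp(tw)`.
    obtain ⟨X, hX, hX0, hXt⟩ := @Classical.epsilon_spec (TangentBundle 𝓘(ℝ, EM) (G ⧸ H))
      (fun q => ∃ X, S.IsNonlinParallel
        (fun t => ((SprayGeometry.lieExp G (t • (w : EG)) : G) : G ⧸ H)) X ∧
          X 0 = SprayGeometry.originVec H EM ((y : 𝔪) : EG) ∧ X t = q)
      ⟨_, _, hpar y hy, hpar0 y hy, rfl⟩
    refine Eq.trans ?_ (congrArg (SprayGeometry.actTangent H EM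
      (SprayGeometry.lieExp G (-(t • (w : EG))))) hXt)
    rw [huniq y hy X hX hX0, SprayGeometry.lieExp_neg_smul, ← hGH.actTangent_mul_projTangent,
      inv_mul_cancel, SprayGeometry.projTangent_one]
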